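/- Let $n\ge 0$ and let $(M,\xi)$ be a contact manifold of dimension $2n+3$, i.e. $M$ is a smooth manifold and $\xi$ is a hyperplane field that is locally the kernel of a $1$-form $\alpha$ with $d\alpha$ nondegenerate on $\xi=\ker\alpha$. Let $\mathbb D^2_{\le\pi}$ be the closed disk of radius $\pi$ with polar coordinates $(r,\vartheta)$ and let $\mathbb T^n=(\mathbb S^1)^n$. For an embedding $\iota$ of a manifold $N$ (possibly with boundary) into $M$, the singular distribution induced by $\xi$ on $N$ is $(D\iota)^{-1}(\xi)\subset TN$. Suppose that $(M,\xi)$ contains a plastikstufe $\mathbb D_{\mathrm{OT}}\times\mathbb T^n$ with toric core, that is, there is a smooth embedding of $\mathbb D^2_{\le\pi}\times\mathbb T^n$ into $M$ on which $\xi$ induces the singular distribution $\ker(r\sin r\,d\vartheta)$. Then, for every $C>0$, there is a smooth embedding into $M$ of the hypersurface $$\Sigma_C=\mathbb D^2_{\le\pi}\times(-C,C)^n\times(-C,C)^n$$ on which $\xi$ induces the singular distribution $\mathcal D_C=\ker\Bigl(r\sin r\,d\vartheta-\sum_{j=1}^n t_j\,ds_j\Bigr)$, where $(s_1,\dots,s_n,t_1,\dots,t_n)$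 are the coordinates on $(-C,C)^n\times(-C,C)^n$. In particular, whatever the threshold $C_{\mathrm{OT}}>0$ in the definition of an overtwisted convex disk (an embedded $(\Sigma_C,\mathcal D_C)$ with $C>C_{\mathrm{OT}}$), $(M,\xi)$ contains an embedded overtwisted convex disk. -/

import Mathlib

open scoped Manifold ContDiff Topology

noncomputable section

/-- `a` is a contact form on the subset `V` (meant to be open) of the normed space `E`: it is a
smooth, nowhere vanishing `1`-form, and its exterior derivative
`da (u, v) = (D_u a) v - (D_v a) u` is nondegenerate on each hyperplane `ker a`. -/
structure IsContactFormOn {E : Type*} [NormedAddCommGroup E] [NormedSpace ℝ E]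
    (a : E → E →L[ℝ] ℝ) (V : Set E) : Prop where
  contDiffOn : ContDiffOn ℝ ∞ a V
  ne_zero : ∀ x ∈ V, a x ≠ 0
  nondegenerate : ∀ x ∈ V, ∀ u : E, a x u = 0 →
    (∀ v : E, a x v = 0 → fderiv ℝ a x u v - fderiv ℝ a x v u = 0) → u = 0

/-- A field `ξ` of subspaces of the tangent spaces of the smooth `d`-manifold `M` is a contact
structure if near every point, read in a chart, it is the kernel of a contact form. No global
contact form, that is, no coorientation, is required. -/
def IsContactStructure {d : ℕ} {M : Type*} [TopologicalSpace M]
    [ChartedSpace (EuclideanSpace ℝ (Fin d)) M]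
    (ξ : (p : M) → Submodule ℝ (TangentSpace (𝓡 d) p)) : Prop :=
  ∀ p : M, ∃ (V : Set (EuclideanSpace ℝ (Fin d)))
    (a : EuclideanSpace ℝ (Fin d) → EuclideanSpace ℝ (Fin d) →L[ℝ] ℝ),
    IsOpen V ∧ extChartAt (𝓡 d) p p ∈ V ∧ V ⊆ (extChartAt (𝓡 d) p).target ∧
    IsContactFormOn a V ∧
    ∀ q ∈ (extChartAt (𝓡 d) p).source, extChartAt (𝓡 d) p q ∈ V →
      ∀ w : TangentSpace (𝓡 d) q, w ∈ ξ q ↔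
        a (extChartAt (𝓡 d) p q)
          (mfderiv (𝓡 d) 𝓘(ℝ, EuclideanSpace ℝ (Fin d)) (extChartAt (𝓡 d) p) q w) = 0

/-- `f` restricts to a smooth embedding of `K ⊆ N` into `M`: it is smooth on an open neighbourhood
of `K`, immersive at the points of `K`, and a homeomorphism of `K` onto its image. It is used only
for sets `K` that are codimension `0` submanifolds with boundary of `N`; the values of `f` outside
`K` then only serve to express smoothness up to the boundary. -/
structure IsSmoothEmbeddingOn {E H N E' H' M : Type*}
    [NormedAddCommGroup E] [NormedSpace ℝ E] [TopologicalSpace H] (I : ModelWithCorners ℝ E H)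
    [TopologicalSpace N] [ChartedSpace H N]
    [NormedAddCommGroup E'] [NormedSpace ℝ E'] [TopologicalSpace H'] (I' : ModelWithCorners ℝ E' H')
    [TopologicalSpace M] [ChartedSpace H' M]
    (f : N → M) (K : Set N) : Prop where
  smooth : ∃ W : Set N, IsOpen W ∧ K ⊆ W ∧ ContMDiffOn I I' ∞ f W
  immersive : ∀ x ∈ K, Function.Injective (mfderiv I I' f x)
  isEmbedding : Topology.IsEmbedding (K.domRestrict f)

/-- The plane containing the disk `𝔻²`. -/
abbrev Plane : Type := EuclideanSpace ℝ (Fin 2)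

/-- The closed disk `𝔻²_{≤ π}` of radius `π`. -/
def diskPi : Set Plane := Metric.closedBall 0 Real.pi

/-- The `1`-form `r sin r dϑ` on the plane. In Cartesian coordinates `r² dϑ = x dy - y dx`, so the
form is `(sin r / r) (x dy - y dx)`, with the continuous value `1` of `sin r / r` at `r = 0`. -/
def otForm (x v : Plane) : ℝ :=
  Real.sinc ‖x‖ * (x 0 * v 1 - x 1 * v 0)

/-- The torus `𝕋ⁿ = (𝕊¹)ⁿ`. -/
abbrev Torus (n : ℕ) : Type := Fin n → Circle

/-- The model of the manifold `𝕋ⁿ`. -/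
abbrev torusModel (n : ℕ) := ModelWithCorners.pi (fun _ : Fin n => 𝓡 1)

/-- `f` is a plastikstufe `𝔻_OT × 𝕋ⁿ` with toric core in `(M, ξ)`: an embedding of
`𝔻²_{≤ π} × 𝕋ⁿ` on which `ξ` induces the same singular distribution `ker (r sin r dϑ)` as the
contact structure `ker (cos r dz + r sin r dϑ + λ_can)` of `ℝ³ × T*𝕋ⁿ` does on `𝔻_OT × 𝕋ⁿ`. -/
structure IsToricPlastikstufe {n : ℕ} {M : Type*} [TopologicalSpace M]
    [ChartedSpace (EuclideanSpace ℝ (Fin (2 * n + 3))) M]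
    (ξ : (p : M) → Submodule ℝ (TangentSpace (𝓡 (2 * n + 3)) p))
    (f : Plane × Torus n → M) : Prop where
  embedding : IsSmoothEmbeddingOn (𝓘(ℝ, Plane).prod (torusModel n)) (𝓡 (2 * n + 3)) f
    (diskPi ×ˢ Set.univ)
  distribution : ∀ x ∈ diskPi ×ˢ (Set.univ : Set (Torus n)),
    ∀ v : TangentSpace (𝓘(ℝ, Plane).prod (torusModel n)) x,
      mfderiv (𝓘(ℝ, Plane).prod (torusModel n)) (𝓡 (2 * n + 3)) f x v ∈ ξ (f x) ↔
        otForm x.1 v.1 = 0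

/-- The space `ℝ² × ℝⁿ × ℝⁿ` with coordinates `(x, s, t)`, which contains `Σ_C`. -/
abbrev SigmaSpace (n : ℕ) : Type := Plane × (Fin n → ℝ) × (Fin n → ℝ)

/-- `Σ_C = 𝔻²_{≤ π} × (-C, C)ⁿ × (-C, C)ⁿ`. -/
def sigmaSet (n : ℕ) (C : ℝ) : Set (SigmaSpace n) :=
  {x | x.1 ∈ diskPi ∧ (∀ j, x.2.1 j ∈ Set.Ioo (-C) C) ∧ ∀ j, x.2.2 j ∈ Set.Ioo (-C) C}

/-- The `1`-form `β = r sin r dϑ - ∑ⱼ tⱼ dsⱼ`. -/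
def sigmaForm {n : ℕ} (x v : SigmaSpace n) : ℝ :=
  otForm x.1 v.1 - ∑ j, x.2.2 j * v.2.1 j

/-- `g` embeds the hypersurface `(Σ_C, D_C)` in `(M, ξ)`: it is an embedding of `Σ_C` on which `ξ`
induces the singular distribution `D_C = ker β`. -/
structure IsConvexDiskEmbedding {n : ℕ} {M : Type*} [TopologicalSpace M]
    [ChartedSpace (EuclideanSpace ℝ (Fin (2 * n + 3))) M]
    (ξ : (p : M) → Submodule ℝ (TangentSpace (𝓡 (2 * n + 3)) p)) (C : ℝ)
    (g : SigmaSpace n → M) : Prop where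
  embedding : IsSmoothEmbeddingOn 𝓘(ℝ, SigmaSpace n) (𝓡 (2 * n + 3)) g (sigmaSet n C)
  distribution : ∀ x ∈ sigmaSet n C, ∀ v : SigmaSpace n,
    mfderiv 𝓘(ℝ, SigmaSpace n) (𝓡 (2 * n + 3)) g x v ∈ ξ (g x) ↔ sigmaForm x v = 0

end

/-! The core of the argument is a normal form. On the universal covering `ℝⁿ × 𝔻² × ℝⁿ⁺¹` of a tube
around the plastikstufe, with coordinates `(s, x, y)`, the structure `ξ` becomes the kernel of `r
sin r dϑ + cos r dy₀ + ∑ⱼ yⱼ₊₁ dsⱼ`. All constructions are invariant under the lattice `(2πℤ)ⁿ`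
acting on `s`, so they descend to the torus.

Given the normal form, choose a large `k` and small, rationally independent `δⱼ`, and map `(x, s,
t)` to the point with torus coordinate `k s`, with `y₀ = ∑ δⱼ sⱼ` and `yⱼ₊₁ = -(tⱼ + cos r δⱼ)/k`.
The two terms `cos r δⱼ dsⱼ` cancel and the form pulls back to `r sin r dϑ - ∑ tⱼ dsⱼ`
(`sigmaForm_eq`). A large `k` makes `yⱼ₊₁` small whatever `C` is, at the price that `k s` may wrap
around the torus many times. The slope `y₀ = ∑ δⱼ sⱼ` repairs this: two points over the same torus
point with the same `y₀` would give an integer relation among the `δⱼ` (`eq_of_sigmaMap_eq`). The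
closure of `Σ_C` is compact and lands in the thin tube where the chart is injective modulo the
lattice (`IsPlastikstufeTube.exists_thin`).

The normal form is reached in two stages. The first is linear, along the core. A local addition
thickens the lifted plastikstufe to a map from `ℝⁿ × ℝ² × F` that is submersive along the core
(`IsLiftedPlastikstufe.thicken`). Local forms that vanish on the preimage of `ξ` can be rescaled to
restrict to `r sin r dϑ` on the core: the conformal factor extends smoothly over the zeros `r = 0`
and `r = π` (`exists_conformal_factor`), and it is nonzero because a contact hyperplane in dimension
`2n + 3` has no isotropic subspace of dimension `n + 2`. Being affine, these conditions are glued by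
a partition of unity on the lattice quotient (`IsThickenedPlastikstufe.exists_form`). Transverse
directions are then chosen so that `da(Y₀, ∂_{sᵢ}) = 0`, `da(Yⱼ₊₁, ∂_{sᵢ}) = δᵢⱼ`, and the covector
`(sinc r + cos r) a + sinc r da(·, r∂_r)` kills every `Yⱼ₊₁`
(`IsThickenedPlastikstufe.exists_tube`).

The second stage is a Moser-free straightening, one transverse coordinate at a time
(`IsContactGerm.step`). On the symplectization with `Λ = e^σ a`, let `W` be defined by `dΛ(W, ·) =
dG` with `G = e^{κσ} g`. Then `Λ(W) = -κG`, and Cartan's formula gives `L_W Λ = (1 - κ) dG`,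
constant along the flow. Flowing from the hyperplane `yₖ = 0` therefore yields exactly the term `yₖ
(1 - κ) dg - κ g dyₖ`. The choice `κ = 1`, `g = -cos r` gives `cos r dy₀`; the choice `κ = 0`, `g =
sⱼ` gives `yⱼ₊₁ dsⱼ`. The first-stage normalization makes each `W` transverse to its hyperplane
along the core (`IsContactGerm.exists_normal_form`). -/

noncomputable section

/-! ### Superposition operators and smooth flows -/

section Superposition

universe u

variable {X : Type*} [TopologicalSpace X] [CompactSpace X]

/-- The pointwise application of a continuous family of operators to a continuous map. -/
def ContinuousMap.clmApplyL (X : Type*) [TopologicalSpace X] [CompactSpace X]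
    (E F : Type*) [NormedAddCommGroup E] [NormedSpace ℝ E]
    [NormedAddCommGroup F] [NormedSpace ℝ F] :
    C(X, E →L[ℝ] F) →L[ℝ] C(X, E) →L[ℝ] C(X, F) :=
  LinearMap.mkContinuous₂
    (LinearMap.mk₂ ℝ (fun (A : C(X, E →L[ℝ] F)) (h : C(X, E)) => (⟨fun x => A x (h x), A.continuous.clm_apply h.continuous⟩ : C(X, F)))
      (fun A B h => by ext x; simp) (fun c A h => by ext x; simp)
      (fun A h k => by ext x; simp) (fun c A h => by ext x; simp)) 1
    (fun A h => by
      rw [one_mul, ContinuousMap.norm_le _ (by positivity)]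
      intro x
      exact (A x).le_of_opNorm_le_of_le (A.norm_coe_le_norm x) (h.norm_coe_le_norm x))

@[simp]
theorem ContinuousMap.clmApplyL_apply {E F : Type*} [NormedAddCommGroup E] [NormedSpace ℝ E]
    [NormedAddCommGroup F] [NormedSpace ℝ F] (A : C(X, E →L[ℝ] F)) (h : C(X, E)) (x : X) :
    ContinuousMap.clmApplyL X E F A h x = A x (h x) := rfl

/-- The superposition operator `γ ↦ f ∘ γ` on spaces of continuous maps. -/
def superposition (X : Type*) [TopologicalSpace X] {E F : Type*} [TopologicalSpace E]
    [TopologicalSpace F] {f : E → F} (hf : Continuous f) (γ : C(X, E)) : C(X, F) :=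
  (⟨f, hf⟩ : C(E, F)).comp γ

@[simp]
theorem superposition_apply {X : Type*} [TopologicalSpace X] {E F : Type*} [TopologicalSpace E]
    [TopologicalSpace F] {f : E → F} (hf : Continuous f) (γ : C(X, E)) (x : X) :
    superposition X hf γ x = f (γ x) := rfl

/-- The range of `γ` is compact, so the derivative of `f` is uniformly close to its value at `γ x`
for all `x` at once. The pointwise mean value inequality then becomes an estimate in the sup norm.
-/
theorem hasFDerivAt_superposition {E F : Type*} [NormedAddCommGroup E] [NormedSpace ℝ E]
    [NormedAddCommGroup F] [NormedSpace ℝ F] {f : E → F} (hf : ContDiff ℝ 1 f) (γ : C(X, E)) :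
    HasFDerivAt (superposition X hf.continuous)
      (ContinuousMap.clmApplyL X E F
        (superposition X (hf.continuous_fderiv one_ne_zero) γ)) γ := by
  rw [hasFDerivAt_iff_isLittleO, Asymptotics.isLittleO_iff]
  intro ε hε
  have hK : IsCompact (Set.range γ) := isCompact_range γ.continuous
  have hc := hf.continuous_fderiv one_ne_zero
  have hu := hK.uniformContinuousAt_of_continuousAt (fderiv ℝ f)
    (fun a _ => hc.continuousAt) (Metric.dist_mem_uniformity hε)
  obtain ⟨δ, hδ, hδ'⟩ := Metric.mem_uniformity_dist.1 hu
  filter_upwards [Metric.ball_mem_nhds γ hδ] with η hη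
  rw [ContinuousMap.norm_le _ (by positivity)]
  intro x
  have hx : dist (η x) (γ x) < δ := lt_of_le_of_lt (ContinuousMap.dist_apply_le_dist x) hη
  have key : ‖f (η x) - f (γ x) - fderiv ℝ f (γ x) (η x - γ x)‖ ≤ ε * ‖η x - γ x‖ := by
    refine (convex_ball (γ x) δ).norm_image_sub_le_of_norm_fderiv_le' (𝕜 := ℝ)
      (fun z _ => (hf.differentiable one_ne_zero) z) (fun z hz => ?_)
      (Metric.mem_ball_self hδ) hx
    have := hδ' (a := γ x) (b := z) (by rw [dist_comm]; exact hz) ⟨x, rfl⟩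
    simp only [Set.mem_ofPred_eq] at this
    rw [← dist_eq_norm, dist_comm]
    exact le_of_lt this
  have h2 : ‖η x - γ x‖ ≤ ‖η - γ‖ := (η - γ).norm_coe_le_norm x
  simp only [ContinuousMap.sub_apply, superposition_apply, ContinuousMap.clmApplyL_apply]
  exact key.trans (by gcongr)

/-- The derivative of the operator is the superposition operator of `fderiv ℝ f` followed by a fixed
continuous linear map. Each order of smoothness thus follows from the previous one for a different
target, which is why `F` stays universally quantified in the induction. -/
theorem contDiff_superposition_nat {E : Type u} [NormedAddCommGroup E] [NormedSpace ℝ E] (k : ℕ) :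
    ∀ {F : Type u} [NormedAddCommGroup F] [NormedSpace ℝ F] {f : E → F} (hf : ContDiff ℝ ∞ f),
      ContDiff ℝ k (superposition X hf.continuous) := by
  induction k with
  | zero =>
    intro F _ _ f hf
    rw [Nat.cast_zero, contDiff_zero]
    exact ContinuousMap.continuous_postcomp _
  | succ k ih =>
    intro F _ _ f hf
    have h1 : ContDiff ℝ 1 f := hf.of_le (by exact_mod_cast le_top)
    have hd : ContDiff ℝ ∞ (fderiv ℝ f) := hf.fderiv_right (by simp)
    rw [show ((k + 1 : ℕ) : WithTop ℕ∞) = (k : WithTop ℕ∞) + 1 by norm_cast,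
      contDiff_succ_iff_fderiv]
    refine ⟨fun γ => (hasFDerivAt_superposition h1 γ).differentiableAt, by simp, ?_⟩
    have : fderiv ℝ (superposition X hf.continuous) = fun γ =>
        ContinuousMap.clmApplyL X E F (superposition X hd.continuous γ) := by
      ext1 γ
      exact (hasFDerivAt_superposition h1 γ).fderiv
    rw [this]
    exact (ContinuousMap.clmApplyL X E F).contDiff.comp (ih hd)

theorem contDiff_superposition {E F : Type u} [NormedAddCommGroup E] [NormedSpace ℝ E]
    [NormedAddCommGroup F] [NormedSpace ℝ F] {f : E → F} (hf : ContDiff ℝ ∞ f) :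
    ContDiff ℝ ∞ (superposition X hf.continuous) :=
  contDiff_infty.2 fun k => contDiff_superposition_nat k hf

end Superposition

/-! ### Smooth dependence of flows and of integrals on parameters -/

section Flow

universe u

open Set

variable {E : Type u} [NormedAddCommGroup E] [NormedSpace ℝ E]

/-- The interval on which trajectories are parametrized. -/
abbrev TimeInterval : Type := Icc (-1 : ℝ) 1

/-- Integration from `0` of continuous paths. -/
def pathIntegral (E : Type*) [NormedAddCommGroup E] [NormedSpace ℝ E] [CompleteSpace E] :
    C(TimeInterval, E) →L[ℝ] C(TimeInterval, E) :=
  LinearMap.mkContinuous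
    { toFun := fun γ => ⟨fun t => ∫ u in (0 : ℝ)..t, γ (projIcc (-1) 1 (by norm_num) u),
        (intervalIntegral.continuous_primitive
          (fun a b => (γ.continuous.comp continuous_projIcc).intervalIntegrable a b) 0).comp
          continuous_subtype_val⟩
      map_add' := fun γ η => by
        ext t
        exact intervalIntegral.integral_add
          ((γ.continuous.comp continuous_projIcc).intervalIntegrable _ _)
          ((η.continuous.comp continuous_projIcc).intervalIntegrable _ _)
      map_smul' := fun c γ => by
        ext t
        exact intervalIntegral.integral_smul _ _ } 1
    (fun γ => by
      rw [one_mul, ContinuousMap.norm_le _ (norm_nonneg _)]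
      intro t
      refine (intervalIntegral.norm_integral_le_of_norm_le_const
        (C := ‖γ‖) fun u _ => γ.norm_coe_le_norm _).trans ?_
      have : |(t : ℝ) - 0| ≤ 1 := by rw [sub_zero, abs_le]; exact t.2
      exact mul_le_of_le_one_right (norm_nonneg _) this)

variable [CompleteSpace E]

theorem pathIntegral_apply (γ : C(TimeInterval, E)) (t : TimeInterval) :
    pathIntegral E γ t = ∫ u in (0 : ℝ)..t, γ (projIcc (-1) 1 (by norm_num) u) := rfl

theorem norm_pathIntegral_le (γ : C(TimeInterval, E)) : ‖pathIntegral E γ‖ ≤ ‖γ‖ := by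
  simpa using (pathIntegral E).le_of_opNorm_le (LinearMap.mkContinuous_norm_le _ zero_le_one _) γ

/-- The Picard operator of the autonomous vector field `V`, for trajectories that start at `x` and
are run at speed `τ`. -/
def picardMap {V : E → E} (hV : Continuous V) (τ : ℝ) (x : E) (γ : C(TimeInterval, E)) :
    C(TimeInterval, E) :=
  ContinuousMap.const _ x + τ • pathIntegral E (superposition _ hV γ)

theorem picardMap_apply {V : E → E} (hV : Continuous V) (τ : ℝ) (x : E) (γ : C(TimeInterval, E))
    (t : TimeInterval) : picardMap hV τ x γ t =
      x + τ • ∫ u in (0 : ℝ)..t, V (γ (projIcc (-1) 1 (by norm_num) u)) := rfl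

open scoped NNReal

theorem contractingWith_picardMap {V : E → E} {K : ℝ≥0} (hK : LipschitzWith K V) {τ : ℝ}
    (hτ : |τ| * K < 1) (x : E) :
    ContractingWith (‖τ‖₊ * K) (picardMap hK.continuous τ x) := by
  refine ⟨?_, LipschitzWith.of_dist_le_mul fun γ η => ?_⟩
  · rw [← NNReal.coe_lt_coe]
    simpa using hτ
  · have h1 : dist (superposition _ hK.continuous γ) (superposition _ hK.continuous η)
        ≤ K * dist γ η := by
      rw [ContinuousMap.dist_le (by positivity)]
      intro t
      exact (hK.dist_le_mul _ _).trans (by gcongr; exact ContinuousMap.dist_apply_le_dist t)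
    rw [picardMap, picardMap, dist_add_left, dist_eq_norm, ← smul_sub, ← map_sub, norm_smul]
    push_cast
    rw [mul_assoc]
    gcongr
    exact (norm_pathIntegral_le _).trans (by rwa [← dist_eq_norm])

/-- The trajectory of `V` that starts at `x`, run at speed `τ`. -/
def trajectory {V : E → E} {K : ℝ≥0} (hK : LipschitzWith K V) (τ : ℝ) (x : E) :
    C(TimeInterval, E) :=
  open scoped Classical in
  if hτ : |τ| * K < 1 then (contractingWith_picardMap hK hτ x).fixedPoint else 0

theorem picardMap_trajectory {V : E → E} {K : ℝ≥0} (hK : LipschitzWith K V) {τ : ℝ}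
    (hτ : |τ| * K < 1) (x : E) :
    picardMap hK.continuous τ x (trajectory hK τ x) = trajectory hK τ x := by
  rw [trajectory, dif_pos hτ]
  exact (contractingWith_picardMap hK hτ x).fixedPoint_isFixedPt

theorem eq_trajectory {V : E → E} {K : ℝ≥0} (hK : LipschitzWith K V) {τ : ℝ}
    (hτ : |τ| * K < 1) {x : E} {γ : C(TimeInterval, E)}
    (hγ : picardMap hK.continuous τ x γ = γ) : γ = trajectory hK τ x := by
  rw [trajectory, dif_pos hτ]
  exact (contractingWith_picardMap hK hτ x).fixedPoint_unique hγ

/-- The trajectory solves `γ - picardMap γ = 0`. The partial derivative in `γ` is `1 - A` with `‖A‖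
≤ |τ| K < 1`, hence invertible, and the implicit function theorem applies in the Banach space of
paths. Uniqueness of the fixed point identifies the implicit function with the trajectory. -/
theorem contDiffAt_trajectory {V : E → E} (hV : ContDiff ℝ ∞ V) {K : ℝ≥0} (hK : LipschitzWith K V)
    {τ : ℝ} (hτ : |τ| * K < 1) (x : E) :
    ContDiffAt ℝ ∞ (fun z : ℝ × E => trajectory hK z.1 z.2) (τ, x) := by
  set R : (ℝ × E) × C(TimeInterval, E) → C(TimeInterval, E) :=
    fun z => z.2 - picardMap hK.continuous z.1.1 z.1.2 z.2 with hR
  have hconst : ContDiff ℝ ∞ (fun x : E => (ContinuousMap.const TimeInterval x)) :=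
    (LinearMap.mkContinuous (𝕜 := ℝ)
      { toFun := fun x : E => ContinuousMap.const TimeInterval x
        map_add' := fun _ _ => rfl
        map_smul' := fun _ _ => rfl } 1 (fun x => by
          rw [one_mul, ContinuousMap.norm_le _ (norm_nonneg _)]
          intro t; rfl)).contDiff
  have hN : ContDiff ℝ ∞ (superposition TimeInterval hK.continuous) := contDiff_superposition hV
  have hRs : ContDiff ℝ ∞ R := by
    refine contDiff_snd.sub ((hconst.comp (contDiff_snd.comp contDiff_fst)).add ?_)
    exact (contDiff_fst.comp contDiff_fst).smul
      ((pathIntegral E).contDiff.comp (hN.comp contDiff_snd))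
  set γ := trajectory hK τ x with hγ
  have hinv : (fderiv ℝ R ((τ, x), γ) ∘L .inr ℝ (ℝ × E) C(TimeInterval, E)).IsInvertible := by
    set A : C(TimeInterval, E) →L[ℝ] C(TimeInterval, E) :=
      τ • (pathIntegral E ∘L ContinuousMap.clmApplyL TimeInterval E E
        (superposition TimeInterval (hV.continuous_fderiv (by simp)) γ)) with hA
    have hd : fderiv ℝ R ((τ, x), γ) ∘L .inr ℝ (ℝ × E) C(TimeInterval, E) =
        ContinuousLinearMap.id ℝ _ - A := by
      have h1 : HasFDerivAt (fun η => R ((τ, x), η))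
          (fderiv ℝ R ((τ, x), γ) ∘L .inr ℝ (ℝ × E) C(TimeInterval, E)) γ :=
        ((hRs.differentiable (by simp)) _).hasFDerivAt.comp γ (hasFDerivAt_prodMk_right (τ, x) γ)
      have h2 : HasFDerivAt (fun η => R ((τ, x), η)) (ContinuousLinearMap.id ℝ _ - A) γ := by
        have h3 := ((pathIntegral E).hasFDerivAt.comp γ
          (hasFDerivAt_superposition (hV.of_le (by exact_mod_cast le_top)) γ)).const_smul τ
        exact (hasFDerivAt_id γ).sub (h3.const_add (ContinuousMap.const TimeInterval x))
      exact h1.unique h2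
    have hn : ‖A‖ < 1 := by
      refine lt_of_le_of_lt ?_ hτ
      refine ContinuousLinearMap.opNorm_le_bound _ (by positivity) fun η => ?_
      rw [hA, smul_apply, norm_smul, mul_assoc, Real.norm_eq_abs]
      gcongr
      refine (norm_pathIntegral_le _).trans ?_
      rw [ContinuousMap.norm_le _ (by positivity)]
      intro t
      exact (fderiv ℝ V (γ t)).le_of_opNorm_le_of_le
        (norm_fderiv_le_of_lipschitz ℝ hK) (η.norm_coe_le_norm t)
    rw [hd]
    obtain ⟨u, hu⟩ := isUnit_one_sub_of_norm_lt_one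
      (R := C(TimeInterval, E) →L[ℝ] C(TimeInterval, E)) hn
    exact ⟨ContinuousLinearEquiv.ofUnit u, hu⟩
  have hRat : ContDiffAt ℝ ∞ R ((τ, x), γ) := hRs.contDiffAt
  have hzero : R ((τ, x), γ) = 0 := by
    simp only [hR, hγ]
    rw [picardMap_trajectory hK hτ, sub_self]
  refine (hRat.contDiffAt_implicitFunction (by simp) hinv).congr_of_eventuallyEq ?_
  have hopen : ∀ᶠ z : ℝ × E in 𝓝 (τ, x), |z.1| * K < 1 :=
    (isOpen_lt (by fun_prop) continuous_const).mem_nhds hτ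
  filter_upwards [hRat.eventually_apply_implicitFunction (by simp) hinv, hopen] with z hz hz'
  rw [hzero] at hz
  exact (eq_trajectory hK hz' (sub_eq_zero.1 hz).symm).symm

/-- The trajectories for different speeds are reparametrizations of each other. -/
theorem trajectory_mul {V : E → E} {K : ℝ≥0} (hK : LipschitzWith K V)
    {τ : ℝ} (hτ : |τ| * K < 1) (x : E) (c : TimeInterval) :
    trajectory hK (τ * c) x ⟨1, by norm_num⟩ = trajectory hK τ x c := by
  have hc : |(c : ℝ)| ≤ 1 := abs_le.2 c.2
  have hτ' : |τ * c| * K < 1 := by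
    rw [abs_mul]
    refine lt_of_le_of_lt ?_ hτ
    gcongr
    exact mul_le_of_le_one_right (abs_nonneg _) hc
  have hmem : ∀ t : TimeInterval, (c : ℝ) * t ∈ Icc (-1 : ℝ) 1 := fun t => by
    refine abs_le.1 ?_
    rw [abs_mul]
    exact mul_le_one₀ hc (abs_nonneg _) (abs_le.2 t.2)
  -- The path `t ↦ trajectory(c t)` is a fixed point of the Picard operator at speed `τ c`, by the
  -- substitution `u ↦ c u` in the integral.
  set γ : C(TimeInterval, E) := (trajectory hK τ x).comp
    ⟨fun t => ⟨c * t, hmem t⟩, by fun_prop⟩ with hγ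
  have hfix : picardMap hK.continuous (τ * c) x γ = γ := by
    ext t
    have h0 : γ t = trajectory hK τ x ⟨c * t, hmem t⟩ := rfl
    rw [h0, ← picardMap_trajectory hK hτ x, picardMap_apply, picardMap_apply]
    rw [mul_smul]
    congr 2
    set g : ℝ → E := fun u => V (trajectory hK τ x (projIcc (-1) 1 (by norm_num) u)) with hg
    have h1 : ∫ u in (0 : ℝ)..t, V (γ (projIcc (-1) 1 (by norm_num) u)) =
        ∫ u in (0 : ℝ)..t, g (c * u) := by
      refine intervalIntegral.integral_congr fun u hu => ?_
      have hu' : u ∈ Icc (-1 : ℝ) 1 := by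
        rcases le_total 0 (t : ℝ) with h | h
        · rw [uIcc_of_le h] at hu
          exact ⟨by linarith [hu.1], hu.2.trans t.2.2⟩
        · rw [uIcc_of_ge h] at hu
          exact ⟨t.2.1.trans hu.1, by linarith [hu.2]⟩
      simp only [hg, hγ, ContinuousMap.comp_apply, ContinuousMap.coe_mk]
      rw [projIcc_of_mem _ hu', projIcc_of_mem _ (hmem ⟨u, hu'⟩)]
    rw [h1]
    have h2 := intervalIntegral.smul_integral_comp_mul_left (a := 0) (b := (t : ℝ)) g (c : ℝ)
    rw [h2, mul_zero]
  have := eq_trajectory hK hτ' hfix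
  rw [← this]
  simp [hγ]

/-- The local flow of a smooth, globally Lipschitz vector field exists for a uniform time, is
smooth in all variables, and commutes with the translations that preserve the field. -/
theorem exists_smooth_flow {V : E → E} (hV : ContDiff ℝ ∞ V) {K : ℝ≥0} (hK : LipschitzWith K V) :
    ∃ ε > 0, ∃ φ : ℝ × E → E, ContDiffOn ℝ ∞ φ (Ioo (-ε) ε ×ˢ univ) ∧ (∀ x, φ (0, x) = x) ∧
      (∀ τ ∈ Ioo (-ε) ε, ∀ x, HasDerivAt (fun σ => φ (σ, x)) (V (φ (τ, x))) τ) ∧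
      ∀ c : E, (∀ x, V (x + c) = V x) → ∀ τ ∈ Ioo (-ε) ε, ∀ x, φ (τ, x + c) = φ (τ, x) + c := by
  have hε : (0 : ℝ) < 1 / (K + 1) := by positivity
  have hb : ∀ τ ∈ Ioo (-(1 / (K + 1) : ℝ)) (1 / (K + 1)), |τ| * K < 1 := fun τ hτ => by
    have h1 : |τ| < 1 / (K + 1) := abs_lt.2 hτ
    rw [lt_div_iff₀ (by positivity)] at h1
    nlinarith [abs_nonneg τ]
  set one : TimeInterval := ⟨1, by norm_num⟩
  -- The time-`τ` flow is the endpoint at parameter `1` of the trajectory run at speed `τ`; this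
  -- turns the time variable into a parameter of the fixed-point equation.
  refine ⟨1 / (K + 1), hε, fun z => trajectory hK z.1 z.2 one, ?_, ?_, ?_, ?_⟩
  · rintro ⟨τ, x⟩ ⟨hτ, -⟩
    exact (((ContinuousMap.evalCLM ℝ one).contDiff.contDiffAt).comp (τ, x)
      (contDiffAt_trajectory hV hK (hb τ hτ) x)).contDiffWithinAt
  · intro x
    have := congrArg (fun γ => γ one) (picardMap_trajectory hK (τ := 0) (by simp) x)
    simpa [picardMap_apply] using this.symm
  · intro τ hτ x
    -- One trajectory of slightly larger speed `T` contains the flow for all times in `(-T, T)`, so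
    -- the derivative in time is the fundamental theorem of calculus for that trajectory.
    obtain ⟨T, hT1, hT2⟩ := exists_between (abs_lt.2 hτ)
    have hT0 : 0 < T := (abs_nonneg τ).trans_lt hT1
    have hTb : |T| * K < 1 := hb T ⟨by linarith, hT2⟩
    set g : ℝ → E := fun u => V (trajectory hK T x (projIcc (-1) 1 (by norm_num) u)) with hg
    have hgc : Continuous g := hK.continuous.comp
      ((trajectory hK T x).continuous.comp continuous_projIcc)
    have hform : ∀ σ ∈ Ioo (-T) T,
        trajectory hK σ x one = x + T • ∫ u in (0 : ℝ)..(σ / T), g u := fun σ hσ => by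
      have hc : σ / T ∈ Icc (-1 : ℝ) 1 := by
        rw [mem_Icc, le_div_iff₀ hT0, div_le_iff₀ hT0]
        constructor <;> linarith [hσ.1, hσ.2]
      have h1 := trajectory_mul hK hTb x ⟨σ / T, hc⟩
      rw [show T * ((⟨σ / T, hc⟩ : TimeInterval) : ℝ) = σ by simp; field_simp] at h1
      rw [h1, ← picardMap_trajectory hK hTb x, picardMap_apply]
    have hτ' : τ ∈ Ioo (-T) T := abs_lt.1 hT1
    have hval : V (trajectory hK τ x one) = g (τ / T) := by
      have hc : τ / T ∈ Icc (-1 : ℝ) 1 := by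
        rw [mem_Icc, le_div_iff₀ hT0, div_le_iff₀ hT0]
        constructor <;> linarith [hτ'.1, hτ'.2]
      have h1 := trajectory_mul hK hTb x ⟨τ / T, hc⟩
      rw [show T * ((⟨τ / T, hc⟩ : TimeInterval) : ℝ) = τ by simp; field_simp] at h1
      simp only [hg]
      rw [h1, projIcc_of_mem _ hc]
    have hder : HasDerivAt (fun σ => x + T • ∫ u in (0 : ℝ)..(σ / T), g u)
        (T • ((1 / T) • g (τ / T))) τ := by
      refine HasDerivAt.const_add _ (HasDerivAt.const_smul _ ?_)
      exact (hgc.integral_hasStrictDerivAt 0 (τ / T)).hasDerivAt.scomp τ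
        ((hasDerivAt_id τ).div_const T)
    rw [smul_smul, mul_one_div_cancel hT0.ne', one_smul, ← hval] at hder
    exact hder.congr_of_eventuallyEq
      (Filter.eventually_of_mem (isOpen_Ioo.mem_nhds hτ') fun σ hσ => hform σ hσ)
  · intro c hc τ hτ x
    have hfix : picardMap hK.continuous τ (x + c)
        (trajectory hK τ x + ContinuousMap.const _ c) =
        trajectory hK τ x + ContinuousMap.const _ c := by
      ext t
      have h1 := congrArg (fun γ => γ t) (picardMap_trajectory hK (hb τ hτ) x)
      simp only [picardMap_apply, ContinuousMap.add_apply, ContinuousMap.const_apply, hc] at h1 ⊢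
      rw [← h1]
      abel
    have := eq_trajectory hK (hb τ hτ) hfix
    simp only [← this, ContinuousMap.add_apply, ContinuousMap.const_apply]

/-- Integrals over `[0, 1]` depend smoothly on parameters. -/
theorem contDiff_integral_of_contDiff {Z : Type u} [NormedAddCommGroup Z] [NormedSpace ℝ Z]
    {g : Z × ℝ → E} {h : ℝ → Z → E} (hg : ContDiff ℝ ∞ g) (hh : ∀ τ z, h τ z = g (z, τ)) :
    ContDiff ℝ ∞ (fun z => ∫ τ in (0 : ℝ)..1, h τ z) := by
  set one : TimeInterval := ⟨1, by norm_num⟩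
  set ι : Z → C(TimeInterval, Z × ULift.{u} ℝ) :=
    fun z => ⟨fun t => (z, ⟨t⟩), by fun_prop⟩ with hι
  have hιs : ContDiff ℝ ∞ ι := by
    set lin : Z →L[ℝ] C(TimeInterval, Z × ULift.{u} ℝ) := LinearMap.mkContinuous
      { toFun := fun x : Z => (⟨fun _ => (x, 0), by fun_prop⟩ : C(TimeInterval, Z × ULift.{u} ℝ))
        map_add' := fun _ _ => by ext t <;> simp
        map_smul' := fun _ _ => by ext t <;> simp } 1 (fun x => by
          rw [one_mul, ContinuousMap.norm_le _ (norm_nonneg _)]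
          intro t
          simp) with hlin
    -- The family of paths `t ↦ (z, t)` is affine in `z`, hence smooth.
    have h1 : ι = fun z => lin z + ι 0 := by
      ext1 z
      ext t <;> simp [hι, hlin]
    rw [h1]
    exact lin.contDiff.add contDiff_const
  have hg' : ContDiff ℝ ∞ (fun z : Z × ULift.{u} ℝ => g (z.1, z.2.down)) := by
    refine hg.comp (contDiff_fst.prodMk ?_)
    exact (ContinuousLinearEquiv.ulift (R₁ := ℝ) (M₁ := ℝ)).contDiff.comp contDiff_snd
  have h2 : (fun z => ∫ τ in (0 : ℝ)..1, h τ z) = fun z =>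
      pathIntegral E (superposition TimeInterval hg'.continuous (ι z)) one := by
    ext1 z
    rw [pathIntegral_apply]
    refine intervalIntegral.integral_congr fun u hu => ?_
    rw [uIcc_of_le zero_le_one] at hu
    simp only [superposition_apply, hι, ContinuousMap.coe_mk, hh]
    rw [projIcc_of_mem _ ⟨by linarith [hu.1], hu.2⟩]
  rw [h2]
  exact (ContinuousMap.evalCLM ℝ one).contDiff.comp ((pathIntegral E).contDiff.comp
    ((contDiff_superposition hg').comp hιs))

end Flow

/-! ### Calculus of one-forms -/

theorem two_le_infty : (2 : WithTop ℕ∞) ≤ ∞ := by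
  rw [show (2 : WithTop ℕ∞) = ((2 : ℕ∞) : WithTop ℕ∞) from rfl]
  exact WithTop.coe_le_coe.2 le_top

theorem one_add_one_le_infty : (1 : WithTop ℕ∞) + 1 ≤ ∞ := by
  rw [one_add_one_eq_two]
  exact two_le_infty

section Forms

variable {E F : Type*} [NormedAddCommGroup E] [NormedSpace ℝ E]
  [NormedAddCommGroup F] [NormedSpace ℝ F]

/-- The exterior derivative of a `1`-form. -/
def dForm (a : E → E →L[ℝ] ℝ) (x u v : E) : ℝ := fderiv ℝ a x u v - fderiv ℝ a x v u

/-- The pullback of a `1`-form. -/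
def pullForm (Φ : E → F) (a : F → F →L[ℝ] ℝ) (x : E) : E →L[ℝ] ℝ := (a (Φ x)).comp (fderiv ℝ Φ x)

@[simp]
theorem pullForm_apply (Φ : E → F) (a : F → F →L[ℝ] ℝ) (x v : E) :
    pullForm Φ a x v = a (Φ x) (fderiv ℝ Φ x v) := rfl

theorem dForm_congr {a b : E → E →L[ℝ] ℝ} {x : E} (h : a =ᶠ[𝓝 x] b) (u v : E) :
    dForm a x u v = dForm b x u v := by
  rw [dForm, dForm, h.fderiv_eq]

theorem dForm_swap (a : E → E →L[ℝ] ℝ) (x u v : E) : dForm a x u v = -dForm a x v u := by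
  simp [dForm]

theorem dForm_self (a : E → E →L[ℝ] ℝ) (x u : E) : dForm a x u u = 0 := by
  simp [dForm]

theorem dForm_add_left (a : E → E →L[ℝ] ℝ) (x u u' v : E) :
    dForm a x (u + u') v = dForm a x u v + dForm a x u' v := by
  simp [dForm]; ring

theorem dForm_add_right (a : E → E →L[ℝ] ℝ) (x u v v' : E) :
    dForm a x u (v + v') = dForm a x u v + dForm a x u v' := by
  simp [dForm]; ring

theorem dForm_smul_left (a : E → E →L[ℝ] ℝ) (x : E) (c : ℝ) (u v : E) :
    dForm a x (c • u) v = c * dForm a x u v := by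
  simp [dForm]; ring

theorem dForm_smul_right (a : E → E →L[ℝ] ℝ) (x : E) (c : ℝ) (u v : E) :
    dForm a x u (c • v) = c * dForm a x u v := by
  simp [dForm]; ring

/-- The terms containing the second derivative of `Φ` cancel by its symmetry. -/
theorem dForm_pullForm {Φ : E → F} {a : F → F →L[ℝ] ℝ} {x : E} (hΦ : ContDiffAt ℝ 2 Φ x)
    (ha : DifferentiableAt ℝ a (Φ x)) (u v : E) :
    dForm (pullForm Φ a) x u v = dForm a (Φ x) (fderiv ℝ Φ x u) (fderiv ℝ Φ x v) := by
  have hd : HasFDerivAt (fderiv ℝ Φ) (fderiv ℝ (fderiv ℝ Φ) x) x :=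
    ((hΦ.fderiv_right (m := 1) (by norm_num)).differentiableAt one_ne_zero).hasFDerivAt
  have ha' : HasFDerivAt (fun y => a (Φ y)) ((fderiv ℝ a (Φ x)).comp (fderiv ℝ Φ x)) x :=
    ha.hasFDerivAt.comp x (hΦ.differentiableAt two_ne_zero).hasFDerivAt
  have h := (ha'.clm_comp hd).fderiv
  have hsymm : IsSymmSndFDerivAt ℝ Φ x := hΦ.isSymmSndFDerivAt (by simp)
  have key : ∀ w w' : E, fderiv ℝ (pullForm Φ a) x w w' =
      a (Φ x) (fderiv ℝ (fderiv ℝ Φ) x w w') +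
        fderiv ℝ a (Φ x) (fderiv ℝ Φ x w) (fderiv ℝ Φ x w') := by
    intro w w'
    have : pullForm Φ a = fun y => (a (Φ y)).comp (fderiv ℝ Φ y) := rfl
    rw [this, h]
    simp
  rw [dForm, dForm, key, key, hsymm.eq u v]
  ring

theorem dForm_smul {ρ : E → ℝ} {a : E → E →L[ℝ] ℝ} {x : E} (hρ : DifferentiableAt ℝ ρ x)
    (ha : DifferentiableAt ℝ a x) (u v : E) :
    dForm (fun y => ρ y • a y) x u v =
      ρ x * dForm a x u v + fderiv ℝ ρ x u * a x v - fderiv ℝ ρ x v * a x u := by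
  have h := (hρ.hasFDerivAt.smul ha.hasFDerivAt).fderiv
  have h' : fderiv ℝ (fun y => ρ y • a y) x = ρ x • fderiv ℝ a x + (fderiv ℝ ρ x).smulRight (a x) :=
    h
  simp only [dForm, h']
  simp
  ring

theorem ContDiffOn.pullForm {Φ : E → F} {a : F → F →L[ℝ] ℝ} {U : Set E} {W : Set F}
    (hU : IsOpen U) (hΦ : ContDiffOn ℝ ∞ Φ U) (ha : ContDiffOn ℝ ∞ a W)
    (hUW : Set.MapsTo Φ U W) : ContDiffOn ℝ ∞ (pullForm Φ a) U :=
  (ha.comp hΦ hUW).clm_comp (hΦ.fderiv_of_isOpen hU (by simp))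

/-- A `1`-form is contact at a point if it does not vanish there and its exterior derivative is
nondegenerate on its kernel. -/
def ContactAt (a : E → E →L[ℝ] ℝ) (x : E) : Prop :=
  a x ≠ 0 ∧ ∀ u, a x u = 0 → (∀ v, a x v = 0 → dForm a x u v = 0) → u = 0

/-- The Liouville form `e^σ a` on the symplectization of `a`. -/
def liouville (a : E → E →L[ℝ] ℝ) (z : E × ℝ) : E × ℝ →L[ℝ] ℝ :=
  Real.exp z.2 • (a z.1).comp (ContinuousLinearMap.fst ℝ E ℝ)

theorem liouville_apply (a : E → E →L[ℝ] ℝ) (z w : E × ℝ) :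
    liouville a z w = Real.exp z.2 * a z.1 w.1 := rfl

theorem contDiffOn_liouville {a : E → E →L[ℝ] ℝ} {Ω : Set E} (ha : ContDiffOn ℝ ∞ a Ω) :
    ContDiffOn ℝ ∞ (liouville a) (Ω ×ˢ Set.univ) := by
  refine (Real.contDiff_exp.comp contDiff_snd).contDiffOn.smul ?_
  exact (ha.comp contDiffOn_fst fun z hz => hz.1).clm_comp contDiffOn_const

theorem dForm_liouville {a : E → E →L[ℝ] ℝ} {z : E × ℝ} (ha : DifferentiableAt ℝ a z.1)
    (u v : E × ℝ) : dForm (liouville a) z u v =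
      Real.exp z.2 * (dForm a z.1 u.1 v.1 + u.2 * a z.1 v.1 - v.2 * a z.1 u.1) := by
  have h1 : liouville a = fun y : E × ℝ => Real.exp y.2 • pullForm Prod.fst a y := by
    ext1 y
    simp [liouville, pullForm, fderiv_fst]
  have h2 : DifferentiableAt ℝ (pullForm (Prod.fst : E × ℝ → E) a) z := by
    have : pullForm (Prod.fst : E × ℝ → E) a =
        fun y => (a y.1).comp (ContinuousLinearMap.fst ℝ E ℝ) := by
      ext1 y; simp [pullForm, fderiv_fst]
    rw [this]
    have h3 : DifferentiableAt ℝ (fun y : E × ℝ => a y.1) z := ha.comp z differentiableAt_fst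
    exact h3.clm_comp (differentiableAt_const _)
  have h4 : HasFDerivAt (fun y : E × ℝ => Real.exp y.2)
      (Real.exp z.2 • ContinuousLinearMap.snd ℝ E ℝ) z :=
    hasFDerivAt_snd.exp
  rw [h1, dForm_smul h4.differentiableAt h2, dForm_pullForm contDiffAt_fst ha, h4.fderiv]
  simp [pullForm, fderiv_fst]
  ring

/-- The `2`-form `da` as a map to the dual space. -/
def dFormL (a : E → E →L[ℝ] ℝ) (x : E) : E →L[ℝ] E →L[ℝ] ℝ := fderiv ℝ a x - (fderiv ℝ a x).flip

theorem dFormL_apply (a : E → E →L[ℝ] ℝ) (x u v : E) : dFormL a x u v = dForm a x u v := rfl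

theorem contDiffOn_dFormL {a : E → E →L[ℝ] ℝ} {Ω : Set E} (hΩ : IsOpen Ω)
    (ha : ContDiffOn ℝ ∞ a Ω) : ContDiffOn ℝ ∞ (dFormL a) Ω := by
  have h1 : ContDiffOn ℝ ∞ (fderiv ℝ a) Ω := ha.fderiv_of_isOpen hΩ (by simp)
  have h2 : IsBoundedLinearMap ℝ (fun B : E →L[ℝ] E →L[ℝ] ℝ => B.flip) :=
    { map_add := fun _ _ => rfl
      map_smul := fun _ _ => rfl
      bound := ⟨1, one_pos, fun B => by rw [ContinuousLinearMap.opNorm_flip, one_mul]⟩ }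
  have h3 : ContDiff ℝ ∞ (fun B : E →L[ℝ] E →L[ℝ] ℝ => B.flip) :=
    IsBoundedLinearMap.contDiff (E := E →L[ℝ] E →L[ℝ] ℝ) (F := E →L[ℝ] E →L[ℝ] ℝ) h2
  exact h1.sub (h3.comp_contDiffOn h1)

theorem isInvertible_of_injective [FiniteDimensional ℝ E] {B : E →L[ℝ] E →L[ℝ] ℝ}
    (hB : Function.Injective B) : B.IsInvertible := by
  have hd : Module.finrank ℝ E = Module.finrank ℝ (E →L[ℝ] ℝ) := by
    rw [← (LinearMap.toContinuousLinearMap (𝕜 := ℝ) (E := E) (F' := ℝ)).finrank_eq]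
    exact (Subspace.dual_finrank_eq (K := ℝ) (V := E)).symm
  let e : E ≃ₗ[ℝ] (E →L[ℝ] ℝ) := LinearEquiv.ofInjectiveOfFinrankEq (B : E →ₗ[ℝ] _) hB hd
  refine ⟨e.toContinuousLinearEquiv, ?_⟩
  ext u v
  rfl

/-- The symplectization of a contact form is symplectic. For `(u, μ)` in the kernel of `d(e^σ a)`,
pairing with `∂_σ` gives `a(u) = 0`, pairing with `ker a` gives `u = 0` by nondegeneracy, and any
vector with `a ≠ 0` then gives `μ = 0`. -/
theorem ContactAt.isInvertible_dFormL_liouville [FiniteDimensional ℝ E] {a : E → E →L[ℝ] ℝ} {x : E}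
    (h : ContactAt a x) (ha : DifferentiableAt ℝ a x) (σ : ℝ) :
    (dFormL (liouville a) (x, σ)).IsInvertible := by
  refine isInvertible_of_injective ((injective_iff_map_eq_zero _).2 ?_)
  rintro ⟨u, μ⟩ hu
  have key : ∀ v ν, dForm a x u v + μ * a x v - ν * a x u = 0 := fun v ν => by
    have h1 := DFunLike.congr_fun hu (v, ν)
    rw [dFormL_apply, dForm_liouville ha] at h1
    simpa [Real.exp_ne_zero] using h1
  have hau : a x u = 0 := by simpa [dForm] using key 0 1
  have hu0 : u = 0 := h.2 u hau fun v hv => by simpa [hv] using key v 0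
  subst hu0
  obtain ⟨v, hv⟩ : ∃ v, a x v ≠ 0 := by
    by_contra! hcon
    exact h.1 (ContinuousLinearMap.ext hcon)
  have : μ = 0 := by simpa [dForm, hv] using key v 0
  rw [this]
  rfl

end Forms

/-! ### Transport of a one-form along a flow -/

section Transport

open Set

variable {E : Type*} [NormedAddCommGroup E] [NormedSpace ℝ E]

/-- The variational equation along a smooth flow. -/
theorem hasDerivAt_fderiv_flow {φ : ℝ × E → E} {V : E → E} {ε : ℝ}
    (hφ : ContDiffOn ℝ ∞ φ (Ioo (-ε) ε ×ˢ univ))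
    (hφV : ∀ τ ∈ Ioo (-ε) ε, ∀ x, HasDerivAt (fun σ => φ (σ, x)) (V (φ (τ, x))) τ)
    {τ : ℝ} (hτ : τ ∈ Ioo (-ε) ε) (x w : E) (hV : DifferentiableAt ℝ V (φ (τ, x))) :
    HasDerivAt (fun σ => fderiv ℝ φ (σ, x) (0, w))
      (fderiv ℝ V (φ (τ, x)) (fderiv ℝ φ (τ, x) (0, w))) τ := by
  have hopen : IsOpen (Ioo (-ε) ε ×ˢ (univ : Set E)) := isOpen_Ioo.prod isOpen_univ
  have hat : ∀ z ∈ Ioo (-ε) ε ×ˢ (univ : Set E), ContDiffAt ℝ ∞ φ z := fun z hz =>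
    hφ.contDiffAt (hopen.mem_nhds hz)
  have hz : (τ, x) ∈ Ioo (-ε) ε ×ˢ (univ : Set E) := ⟨hτ, mem_univ _⟩
  have hd : HasFDerivAt (fderiv ℝ φ) (fderiv ℝ (fderiv ℝ φ) (τ, x)) (τ, x) :=
    (((hat _ hz).fderiv_right (m := 1) one_add_one_le_infty).differentiableAt one_ne_zero).hasFDerivAt
  have hline : HasDerivAt (fun σ : ℝ => (σ, x)) ((1 : ℝ), (0 : E)) τ :=
    (hasDerivAt_id τ).prodMk (hasDerivAt_const τ x)
  have h1 : HasDerivAt (fun σ => fderiv ℝ φ (σ, x)) (fderiv ℝ (fderiv ℝ φ) (τ, x) (1, 0)) τ :=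
    hd.comp_hasDerivAt τ hline
  have h2 := h1.clm_apply (hasDerivAt_const τ ((0 : ℝ), w))
  have h3 : ∀ z ∈ Ioo (-ε) ε ×ˢ (univ : Set E), fderiv ℝ φ z (1, 0) = V (φ z) := by
    rintro ⟨σ, y⟩ hz
    have h4 : HasDerivAt (fun σ => φ (σ, y)) (fderiv ℝ φ (σ, y) (1, 0)) σ :=
      ((hat _ hz).differentiableAt (by simp)).hasFDerivAt.comp_hasDerivAt σ
        ((hasDerivAt_id σ).prodMk (hasDerivAt_const σ y))
    exact h4.unique (hφV σ hz.1 y)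
  have h5 : HasFDerivAt (fun z => fderiv ℝ φ z (1, 0))
      ((fderiv ℝ (fderiv ℝ φ) (τ, x)).flip (1, 0)) (τ, x) := by
    simpa using hd.clm_apply (hasFDerivAt_const ((1 : ℝ), (0 : E)) (τ, x))
  have h6 : HasFDerivAt (fun z => V (φ z))
      ((fderiv ℝ V (φ (τ, x))).comp (fderiv ℝ φ (τ, x))) (τ, x) :=
    hV.hasFDerivAt.comp (τ, x) ((hat _ hz).differentiableAt (by simp)).hasFDerivAt
  -- Both sides are derivatives of `∂_τ φ = V ∘ φ`; the symmetry of the second derivative then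
  -- exchanges the time and space derivatives.
  have h7 := (h6.congr_of_eventuallyEq
    (Filter.eventually_of_mem (hopen.mem_nhds hz) h3)).unique h5
  have h8 := DFunLike.congr_fun h7 (0, w)
  have hsymm : IsSymmSndFDerivAt ℝ φ (τ, x) := (hat _ hz).isSymmSndFDerivAt
    (by rw [minSmoothness_of_isRCLikeNormedField]; exact two_le_infty)
  have h9 : fderiv ℝ (fderiv ℝ φ) (τ, x) (1, 0) (0, w) =
      fderiv ℝ V (φ (τ, x)) (fderiv ℝ φ (τ, x) (0, w)) := by
    rw [hsymm.eq (1, 0) (0, w)]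
    exact h8.symm
  simpa [h9] using h2

/-- Along trajectories of the Hamiltonian field `W` of `G`, `G` is constant, and if
`Λ (W) = - κ G`, then `Λ` evaluated on solutions of the variational equation is affine in time. -/
theorem transport_along_curve {U : Set E} (hU : IsOpen U) {W : E → E} (hW : ContDiffOn ℝ ∞ W U)
    {Λ : E → E →L[ℝ] ℝ} (hΛ : ContDiffOn ℝ ∞ Λ U) {G : E → ℝ} (hG : ContDiffOn ℝ ∞ G U) {κ : ℝ}
    (hdΛ : ∀ z ∈ U, ∀ w, dForm Λ z (W z) w = fderiv ℝ G z w)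
    (hΛW : ∀ z ∈ U, Λ z (W z) = -κ * G z) {y : ℝ} {γ J : ℝ → E}
    (hx : ∀ r ∈ Icc (0 : ℝ) 1, γ r ∈ U)
    (hγ : ∀ r ∈ Icc (0 : ℝ) 1, HasDerivAt γ (y • W (γ r)) r)
    (hJ : ∀ r ∈ Icc (0 : ℝ) 1, HasDerivAt J (y • fderiv ℝ W (γ r) (J r)) r) :
    G (γ 1) = G (γ 0) ∧
      Λ (γ 1) (J 1) = Λ (γ 0) (J 0) + y * ((1 - κ) * fderiv ℝ G (γ 0) (J 0)) := by
  have hWat : ∀ z ∈ U, HasFDerivAt W (fderiv ℝ W z) z := fun z hz =>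
    ((hW.contDiffAt (hU.mem_nhds hz)).differentiableAt (by simp)).hasFDerivAt
  have hΛat : ∀ z ∈ U, HasFDerivAt Λ (fderiv ℝ Λ z) z := fun z hz =>
    ((hΛ.contDiffAt (hU.mem_nhds hz)).differentiableAt (by simp)).hasFDerivAt
  have hGat : ∀ z ∈ U, HasFDerivAt G (fderiv ℝ G z) z := fun z hz =>
    ((hG.contDiffAt (hU.mem_nhds hz)).differentiableAt (by simp)).hasFDerivAt
  have hG2 : ∀ z ∈ U, HasFDerivAt (fderiv ℝ G) (fderiv ℝ (fderiv ℝ G) z) z := fun z hz =>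
    (((hG.contDiffAt (hU.mem_nhds hz)).fderiv_right (m := 1)
      one_add_one_le_infty).differentiableAt one_ne_zero).hasFDerivAt
  have hGsymm : ∀ z ∈ U, IsSymmSndFDerivAt ℝ G z := fun z hz =>
    (hG.contDiffAt (hU.mem_nhds hz)).isSymmSndFDerivAt
      (by rw [minSmoothness_of_isRCLikeNormedField]; exact two_le_infty)
  have hGW : ∀ z ∈ U, fderiv ℝ G z (W z) = 0 := fun z hz => by
    rw [← hdΛ z hz, dForm_self]
  have const : ∀ f : ℝ → ℝ, (∀ r ∈ Icc (0 : ℝ) 1, HasDerivAt f 0 r) →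
      ∀ r ∈ Icc (0 : ℝ) 1, f r = f 0 := fun f hf =>
    constant_of_has_deriv_right_zero (fun r hr => (hf r hr).continuousAt.continuousWithinAt)
      (fun r hr => (hf r ⟨hr.1, hr.2.le⟩).hasDerivWithinAt)
  have h01 : (1 : ℝ) ∈ Icc (0 : ℝ) 1 := right_mem_Icc.2 zero_le_one
  -- `dG(J)` is constant: differentiating the identity `dG(W) = 0` in the direction `J` cancels the
  -- two terms of its time derivative, by the symmetry of the second derivative of `G`.
  have hB : ∀ r ∈ Icc (0 : ℝ) 1, HasDerivAt (fun r => fderiv ℝ G (γ r) (J r)) 0 r :=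
    fun r hr => by
    have hz := hx r hr
    have h1 := HasDerivAt.clm_apply (c := fun r => fderiv ℝ G (γ r))
      ((hG2 _ hz).comp_hasDerivAt r (hγ r hr)) (hJ r hr)
    have h2 : HasFDerivAt (fun z => fderiv ℝ G z (W z)) (0 : E →L[ℝ] ℝ) (γ r) :=
      (hasFDerivAt_const (0 : ℝ) (γ r)).congr_of_eventuallyEq
        (Filter.eventually_of_mem (hU.mem_nhds hz) hGW)
    have h3 : fderiv ℝ G (γ r) (fderiv ℝ W (γ r) (J r)) +
        fderiv ℝ (fderiv ℝ G) (γ r) (J r) (W (γ r)) = 0 :=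
      DFunLike.congr_fun (((hG2 _ hz).clm_apply (hWat _ hz)).unique h2) (J r)
    have h4 : fderiv ℝ (fderiv ℝ G) (γ r) (y • W (γ r)) (J r) =
        y * fderiv ℝ (fderiv ℝ G) (γ r) (J r) (W (γ r)) := by
      rw [(hGsymm _ hz).eq, map_smul, smul_eq_mul]
    rw [h4, map_smul, smul_eq_mul] at h1
    refine HasDerivAt.congr_deriv h1 ?_
    linear_combination y * h3
  have hBconst : ∀ r ∈ Icc (0 : ℝ) 1, fderiv ℝ G (γ r) (J r) = fderiv ℝ G (γ 0) (J 0) :=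
    const _ hB
  -- Cartan's formula along the curve: the derivative of `Λ(J)` is `y (dΛ(W, J) + d(Λ(W))(J)) = y (1
  -- - κ) dG(J)`, whose last factor has just been shown to be constant.
  have hA : ∀ r ∈ Icc (0 : ℝ) 1, HasDerivAt
      (fun r => Λ (γ r) (J r) - r * (y * ((1 - κ) * fderiv ℝ G (γ 0) (J 0)))) 0 r :=
    fun r hr => by
    have hz := hx r hr
    have h1 := HasDerivAt.clm_apply (c := fun r => Λ (γ r))
      ((hΛat _ hz).comp_hasDerivAt r (hγ r hr)) (hJ r hr)
    have h2 : HasFDerivAt (fun z => Λ z (W z)) (-κ • fderiv ℝ G (γ r)) (γ r) :=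
      ((hGat _ hz).const_smul (-κ)).congr_of_eventuallyEq
        (Filter.eventually_of_mem (hU.mem_nhds hz) hΛW)
    have h3 : Λ (γ r) (fderiv ℝ W (γ r) (J r)) + fderiv ℝ Λ (γ r) (J r) (W (γ r)) =
        -κ * fderiv ℝ G (γ r) (J r) :=
      DFunLike.congr_fun (((hΛat _ hz).clm_apply (hWat _ hz)).unique h2) (J r)
    have h4 := hdΛ _ hz (J r)
    rw [dForm, hBconst r hr] at h4
    rw [hBconst r hr] at h3
    have h6 : fderiv ℝ Λ (γ r) (y • W (γ r)) (J r) =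
        y * fderiv ℝ Λ (γ r) (W (γ r)) (J r) := by
      rw [map_smul]; rfl
    rw [h6, map_smul, smul_eq_mul] at h1
    have h5 := h1.sub ((hasDerivAt_id r).mul_const (y * ((1 - κ) * fderiv ℝ G (γ 0) (J 0))))
    refine HasDerivAt.congr_deriv h5 ?_
    linear_combination y * h3 + y * h4
  have hGc : ∀ r ∈ Icc (0 : ℝ) 1, HasDerivAt (fun r => G (γ r)) 0 r := fun r hr => by
    have h1 := (hGat _ (hx r hr)).comp_hasDerivAt r (hγ r hr)
    rw [map_smul, hGW _ (hx r hr), smul_zero] at h1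
    exact h1
  refine ⟨const _ hGc 1 h01, ?_⟩
  have e2 := const _ hA 1 h01
  linarith

/-- Along the Hamiltonian flow of `G`, `G` is constant, and if `Λ (V) = - κ G`, the form `Λ` changes
linearly in time by multiples of `dG`. -/
theorem transport_along_flow {φ : ℝ × E → E} {V W : E → E} {ε : ℝ}
    (hφ : ContDiffOn ℝ ∞ φ (Ioo (-ε) ε ×ˢ univ)) (hφ0 : ∀ x, φ (0, x) = x)
    (hφV : ∀ τ ∈ Ioo (-ε) ε, ∀ x, HasDerivAt (fun σ => φ (σ, x)) (V (φ (τ, x))) τ)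
    {U : Set E} (hU : IsOpen U) (hVW : EqOn V W U) (hW : ContDiffOn ℝ ∞ W U)
    {Λ : E → E →L[ℝ] ℝ} (hΛ : ContDiffOn ℝ ∞ Λ U) {G : E → ℝ} (hG : ContDiffOn ℝ ∞ G U) {κ : ℝ}
    (hdΛ : ∀ z ∈ U, ∀ w, dForm Λ z (W z) w = fderiv ℝ G z w)
    (hΛW : ∀ z ∈ U, Λ z (W z) = -κ * G z) {x : E} {y : ℝ} (hy : y ∈ Ioo (-ε) ε)
    (hx : ∀ r ∈ Icc (0 : ℝ) 1, φ (r * y, x) ∈ U) (w : E) :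
    G (φ (y, x)) = G x ∧
      Λ (φ (y, x)) (fderiv ℝ φ (y, x) (0, w)) = Λ x w + y * ((1 - κ) * fderiv ℝ G x w) := by
  have hr : ∀ r ∈ Icc (0 : ℝ) 1, r * y ∈ Ioo (-ε) ε := fun r hr => by
    refine abs_lt.1 ?_
    rw [abs_mul, abs_of_nonneg hr.1]
    exact (mul_le_of_le_one_left (abs_nonneg _) hr.2).trans_lt (abs_lt.2 hy)
  have hVd : ∀ z ∈ U, HasFDerivAt V (fderiv ℝ W z) z := fun z hz =>
    ((hW.contDiffAt (hU.mem_nhds hz)).differentiableAt (by simp)).hasFDerivAt.congr_of_eventuallyEq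
      (Filter.eventually_of_mem (hU.mem_nhds hz) hVW)
  have hγ : ∀ r ∈ Icc (0 : ℝ) 1,
      HasDerivAt (fun r => φ (r * y, x)) (y • W (φ (r * y, x))) r := fun r hr' => by
    have h1 := HasDerivAt.scomp (g₁ := fun σ => φ (σ, x)) (h := fun r => r * y) r
      (hφV _ (hr r hr') x) (hasDerivAt_mul_const y)
    rw [hVW (hx r hr')] at h1
    exact h1
  have hJ : ∀ r ∈ Icc (0 : ℝ) 1, HasDerivAt (fun r => fderiv ℝ φ (r * y, x) (0, w))
      (y • fderiv ℝ W (φ (r * y, x)) (fderiv ℝ φ (r * y, x) (0, w))) r := fun r hr' => by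
    have h1 := HasDerivAt.scomp (g₁ := fun σ => fderiv ℝ φ (σ, x) (0, w)) (h := fun r => r * y) r
      (hasDerivAt_fderiv_flow hφ hφV (hr r hr') x w (hVd _ (hx r hr')).differentiableAt)
      (hasDerivAt_mul_const y)
    rw [(hVd _ (hx r hr')).fderiv] at h1
    exact h1
  have hJ0 : fderiv ℝ φ (0, x) (0, w) = w := by
    have h0 : (0 : ℝ) ∈ Ioo (-ε) ε := by simpa using hr 0 (left_mem_Icc.2 zero_le_one)
    have h1 : HasFDerivAt (fun z => φ ((0 : ℝ), z))
        ((fderiv ℝ φ (0, x)).comp (ContinuousLinearMap.inr ℝ ℝ E)) x :=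
      ((hφ.contDiffAt ((isOpen_Ioo.prod isOpen_univ).mem_nhds ⟨h0, mem_univ x⟩)).differentiableAt
        (by simp)).hasFDerivAt.comp x (hasFDerivAt_prodMk_right (0 : ℝ) x)
    simp only [hφ0] at h1
    exact DFunLike.congr_fun (h1.unique (hasFDerivAt_id x)) w
  have key := transport_along_curve hU hW hΛ hG hdΛ hΛW hx hγ hJ
  simpa only [one_mul, zero_mul, hφ0, hJ0] using key

end Transport

/-! ### Smoothness of `cos r`, `sin r / r` and the form `r sin r dϑ` -/

section Trig

/-- The entire function `w ↦ cos √w`. -/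
def cosSq (w : ℝ) : ℝ :=
  FormalMultilinearSeries.ofScalarsSum (E := ℝ) (fun k => (-1 : ℝ) ^ k / (2 * k).factorial) w

/-- The norm is not smooth at the origin, but `cos` is even, so it is a convergent power series in
the square of its argument. This gives smoothness of `cos ‖x‖`, and through the derivative also that
of `sinc ‖x‖`. -/
theorem contDiff_cosSq : ContDiff ℝ ∞ cosSq := by
  set c : ℕ → ℝ := fun k => (-1 : ℝ) ^ k / (2 * k).factorial with hc
  have hr : (FormalMultilinearSeries.ofScalars ℝ c).radius = ⊤ := by
    refine FormalMultilinearSeries.ofScalars_radius_eq_top_of_tendsto ℝ c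
      (Filter.Eventually.of_forall fun k => by simp [hc, Nat.factorial_ne_zero]) ?_
    have h1 : ∀ k : ℕ, ‖c k.succ‖ / ‖c k‖ = 1 / ((2 * k + 2) * (2 * k + 1) : ℝ) := fun k => by
      have : ((2 * (k + 1)).factorial : ℝ) = (2 * k + 2) * ((2 * k + 1) * (2 * k).factorial) := by
        rw [show 2 * (k + 1) = 2 * k + 1 + 1 by ring, Nat.factorial_succ, Nat.factorial_succ]
        push_cast
        ring
      simp only [hc, norm_div, norm_pow, norm_neg, norm_one, one_pow, Nat.succ_eq_add_one, this]
      have h2 : ((2 * k).factorial : ℝ) ≠ 0 := by exact_mod_cast Nat.factorial_ne_zero _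
      rw [Real.norm_of_nonneg (by positivity), Real.norm_of_nonneg (by positivity)]
      field_simp
    simp only [h1]
    refine squeeze_zero (fun k => by positivity) (fun k => ?_)
      tendsto_one_div_add_atTop_nhds_zero_nat
    gcongr
    nlinarith [(Nat.cast_nonneg k : (0 : ℝ) ≤ k)]
  have h := (FormalMultilinearSeries.ofScalars ℝ c).hasFPowerSeriesOnBall (by rw [hr]; simp)
  rw [hr] at h
  have h2 : AnalyticOnNhd ℝ cosSq (Metric.eball 0 ⊤) := h.analyticOnNhd
  rw [contDiff_iff_contDiffAt]
  intro x
  exact (h2 x (by simp)).contDiffAt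

theorem cosSq_sq (r : ℝ) : cosSq (r ^ 2) = Real.cos r := by
  rw [cosSq, FormalMultilinearSeries.ofScalarsSum_eq_tsum, Real.cos_eq_tsum]
  refine tsum_congr fun k => ?_
  rw [smul_eq_mul, ← pow_mul]
  ring

/-- The entire function `w ↦ sin √w / √w`. -/
def sincSq (w : ℝ) : ℝ := -2 * deriv cosSq w

theorem contDiff_sincSq : ContDiff ℝ ∞ sincSq :=
  contDiff_const.mul (contDiff_infty_iff_deriv.1 contDiff_cosSq).2

theorem sincSq_sq (r : ℝ) : sincSq (r ^ 2) = Real.sinc r := by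
  have h : ∀ r : ℝ, r ≠ 0 → sincSq (r ^ 2) = Real.sinc r := fun r hr => by
    have h1 : HasDerivAt (fun r : ℝ => cosSq (r ^ 2)) (deriv cosSq (r ^ 2) * (2 * r)) r := by
      have := ((contDiff_cosSq.differentiable (by simp)) (r ^ 2)).hasDerivAt.comp r
        (hasDerivAt_pow 2 r)
      simpa [Function.comp_def] using this
    have h2 : HasDerivAt (fun r : ℝ => cosSq (r ^ 2)) (-Real.sin r) r := by
      simp only [cosSq_sq]
      exact Real.hasDerivAt_cos r
    have h3 := h1.unique h2
    rw [Real.sinc_of_ne_zero hr, sincSq, eq_div_iff hr]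
    linear_combination -h3
  have hc : Continuous fun r : ℝ => sincSq (r ^ 2) := contDiff_sincSq.continuous.comp (by fun_prop)
  have := Continuous.ext_on (dense_compl_singleton (0 : ℝ)) hc Real.continuous_sinc
    (fun r hr => h r hr)
  exact congrFun this r

/-- Differentiate `r * sincSq (r ^ 2) = sin r`. -/
theorem sincSq_eq (r : ℝ) :
    2 * r ^ 2 * deriv sincSq (r ^ 2) = Real.cos r - Real.sinc r := by
  have h1 : HasDerivAt (fun r : ℝ => r * sincSq (r ^ 2))
      (1 * sincSq (r ^ 2) + r * (deriv sincSq (r ^ 2) * (2 * r))) r := by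
    have := ((contDiff_sincSq.differentiable (by simp)) (r ^ 2)).hasDerivAt.comp r
      (hasDerivAt_pow 2 r)
    exact (hasDerivAt_id r).mul (by simpa [Function.comp_def] using this)
  have h2 : (fun r : ℝ => r * sincSq (r ^ 2)) = Real.sin := by
    ext r
    rw [sincSq_sq]
    rcases eq_or_ne r 0 with rfl | hr
    · simp
    · rw [Real.sinc_of_ne_zero hr]; field_simp
  rw [h2] at h1
  have := h1.unique (Real.hasDerivAt_sin r)
  rw [sincSq_sq] at this
  linear_combination this

theorem Real.sinc_pos_of_lt_pi {r : ℝ} (h0 : 0 ≤ r) (h : r < Real.pi) : 0 < Real.sinc r := by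
  rcases h0.eq_or_lt with rfl | h0
  · simp
  · rw [Real.sinc_of_ne_zero h0.ne']
    exact div_pos (Real.sin_pos_of_pos_of_lt_pi h0 h) h0

/-- The number `1 + sinc r cos r = (sinc r + cos r) cos r + sin² r` is what forces the Hamiltonian
field of `-cos r` to be transverse to `y₀ = 0` along the core. -/
theorem Real.one_add_sinc_mul_cos_pos {r : ℝ} (h0 : 0 ≤ r) :
    0 < 1 + Real.sinc r * Real.cos r := by
  rcases h0.eq_or_lt with rfl | h0
  · simp
  · have h1 : |Real.sinc r| < 1 := by
      rw [Real.sinc_of_ne_zero h0.ne', abs_div, div_lt_one (abs_pos.2 h0.ne')]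
      exact Real.abs_sin_lt_abs h0.ne'
    have h2 : |Real.sinc r * Real.cos r| < 1 := by
      rw [abs_mul]
      exact (mul_le_of_le_one_right (abs_nonneg _) (Real.abs_cos_le_one r)).trans_lt h1
    linarith [(abs_lt.1 h2).1]

/-- `cos r` on the plane. -/
def cosNorm (x : Plane) : ℝ := Real.cos ‖x‖

/-- `sin r / r` on the plane. -/
def sincNorm (x : Plane) : ℝ := Real.sinc ‖x‖

theorem cosNorm_eq (x : Plane) : cosNorm x = cosSq (‖x‖ ^ 2) := (cosSq_sq _).symm

theorem sincNorm_eq (x : Plane) : sincNorm x = sincSq (‖x‖ ^ 2) := (sincSq_sq _).symm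

theorem contDiff_cosNorm : ContDiff ℝ ∞ cosNorm := by
  rw [funext cosNorm_eq]
  exact contDiff_cosSq.comp (contDiff_norm_sq ℝ)

theorem contDiff_sincNorm : ContDiff ℝ ∞ sincNorm := by
  rw [funext sincNorm_eq]
  exact contDiff_sincSq.comp (contDiff_norm_sq ℝ)

theorem fderiv_cosNorm (x w : Plane) : fderiv ℝ cosNorm x w = -(sincNorm x * inner ℝ x w) := by
  have h1 : HasFDerivAt cosNorm (deriv cosSq (‖x‖ ^ 2) • (2 • (innerSL ℝ x))) x := by
    rw [funext cosNorm_eq]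
    exact ((contDiff_cosSq.differentiable (by simp)) _).hasDerivAt.comp_hasFDerivAt x
      (hasStrictFDerivAt_norm_sq x).hasFDerivAt
  rw [h1.fderiv, sincNorm_eq, sincSq]
  simp
  ring

theorem fderiv_sincNorm (x w : Plane) :
    fderiv ℝ sincNorm x w = 2 * deriv sincSq (‖x‖ ^ 2) * inner ℝ x w := by
  have h1 : HasFDerivAt sincNorm (deriv sincSq (‖x‖ ^ 2) • (2 • (innerSL ℝ x))) x := by
    rw [funext sincNorm_eq]
    exact ((contDiff_sincSq.differentiable (by simp)) _).hasDerivAt.comp_hasFDerivAt x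
      (hasStrictFDerivAt_norm_sq x).hasFDerivAt
  rw [h1.fderiv]
  simp
  ring

/-- The area form of the plane. -/
def wedge (u v : Plane) : ℝ := u 0 * v 1 - u 1 * v 0

/-- The area form of the plane as a bilinear map. -/
def wedgeL : Plane →L[ℝ] Plane →L[ℝ] ℝ :=
  (EuclideanSpace.proj (0 : Fin 2) : Plane →L[ℝ] ℝ).smulRight (EuclideanSpace.proj (1 : Fin 2)) -
    (EuclideanSpace.proj (1 : Fin 2) : Plane →L[ℝ] ℝ).smulRight (EuclideanSpace.proj (0 : Fin 2))

@[simp]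
theorem wedgeL_apply (u v : Plane) : wedgeL u v = wedge u v := by
  simp [wedgeL, wedge]

/-- The form `r sin r dϑ` as a continuous linear form. -/
def otFormL (x : Plane) : Plane →L[ℝ] ℝ := sincNorm x • wedgeL x

@[simp]
theorem otFormL_apply (x v : Plane) : otFormL x v = otForm x v := by
  simp [otFormL, otForm, sincNorm, wedge]

theorem contDiff_otFormL : ContDiff ℝ ∞ otFormL :=
  contDiff_sincNorm.smul wedgeL.contDiff

theorem fderiv_otFormL (x u v : Plane) : fderiv ℝ otFormL x u v =
    sincNorm x * wedge u v + fderiv ℝ sincNorm x u * wedge x v := by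
  have h := (((contDiff_sincNorm.differentiable (by simp)) x).hasFDerivAt.smul
    wedgeL.hasFDerivAt).fderiv
  have h' : fderiv ℝ otFormL x = sincNorm x • wedgeL +
    (fderiv ℝ sincNorm x).smulRight (wedgeL x) := h
  simp [h']

theorem inner_plane (u v : Plane) : inner ℝ u v = u 0 * v 0 + u 1 * v 1 := by
  simp [PiLp.inner_apply, Fin.sum_univ_two]
  ring

theorem norm_sq_plane (u : Plane) : ‖u‖ ^ 2 = u 0 ^ 2 + u 1 ^ 2 := by
  rw [EuclideanSpace.norm_sq_eq, Fin.sum_univ_two]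
  simp

/-- In polar coordinates `d(r sin r dϑ) = (sin r + r cos r) dr ∧ dϑ`, and the area form is `r dr ∧
dϑ`. -/
theorem dForm_otFormL (x u v : Plane) :
    dForm otFormL x u v = (sincNorm x + cosNorm x) * wedge u v := by
  have h := sincSq_eq ‖x‖
  have h2 : cosNorm x - sincNorm x = 2 * ‖x‖ ^ 2 * deriv sincSq (‖x‖ ^ 2) := h.symm
  rw [dForm, fderiv_otFormL, fderiv_otFormL, fderiv_sincNorm, fderiv_sincNorm, inner_plane,
    inner_plane]
  set m := deriv sincSq (‖x‖ ^ 2)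
  rw [norm_sq_plane] at h2
  simp only [wedge]
  linear_combination -(u 0 * v 1 - u 1 * v 0) * h2

end Trig

/-! ### Lattice periodicity -/

section Lattice

open Set

variable {n : ℕ}

/-- The element of the lattice `(2πℤ)ⁿ` with coordinates `l`. -/
def latticeVec (l : Fin n → ℤ) : Fin n → ℝ := fun j => 2 * Real.pi * l j

theorem exists_add_latticeVec_mem (s : Fin n → ℝ) :
    ∃ l : Fin n → ℤ, s + latticeVec l ∈ Icc (0 : Fin n → ℝ) fun _ => 2 * Real.pi := by
  have hp : (0 : ℝ) < 2 * Real.pi := by positivity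
  refine ⟨fun j => -⌊s j / (2 * Real.pi)⌋, fun j => ?_, fun j => ?_⟩
  · have := Int.floor_le (s j / (2 * Real.pi))
    rw [le_div_iff₀ hp] at this
    simp only [Pi.zero_apply, Pi.add_apply, latticeVec]
    push_cast
    linarith
  · have := (Int.lt_floor_add_one (s j / (2 * Real.pi))).le
    rw [div_le_iff₀ hp] at this
    simp only [Pi.add_apply, latticeVec]
    push_cast
    linarith

theorem latticeVec_neg (l : Fin n → ℤ) : latticeVec (-l) = -latticeVec l := by
  ext j
  simp [latticeVec]

/-- The tube lemma over the compact period cell gives a neighbourhood that is uniform over the cell;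
periodicity carries it to every `s`. -/
theorem exists_uniform_nhds {B : Type*} [TopologicalSpace B] {U : Set ((Fin n → ℝ) × B)}
    (hU : IsOpen U) (hper : ∀ (l : Fin n → ℤ) s b, (s, b) ∈ U → (s + latticeVec l, b) ∈ U)
    {K : Set B} (hK : IsCompact K) (hKU : ∀ s, ∀ b ∈ K, (s, b) ∈ U) :
    ∃ W, IsOpen W ∧ K ⊆ W ∧ ∀ s, ∀ b ∈ W, (s, b) ∈ U := by
  obtain ⟨u, v, -, hv, hu, hKv, huv⟩ := generalized_tube_lemma
    (isCompact_Icc (a := (0 : Fin n → ℝ)) (b := fun _ => 2 * Real.pi)) hK hU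
    (fun z hz => hKU z.1 z.2 hz.2)
  refine ⟨v, hv, hKv, fun s b hb => ?_⟩
  obtain ⟨l, hl⟩ := exists_add_latticeVec_mem s
  have := hper (-l) _ _ (huv (⟨hu hl, hb⟩ : (s + latticeVec l, b) ∈ u ×ˢ v))
  rwa [latticeVec_neg, add_neg_cancel_right] at this

/-- Up to lattice translations the derivative is supported in a compact set, so it is bounded. -/
theorem exists_lipschitzWith_of_periodic {B F : Type*} [NormedAddCommGroup B] [NormedSpace ℝ B]
    [NormedAddCommGroup F] [NormedSpace ℝ F]
    {f : (Fin n → ℝ) × B → F} (hf : ContDiff ℝ ∞ f)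
    (hper : ∀ (l : Fin n → ℤ) s b, f (s + latticeVec l, b) = f (s, b))
    {K : Set B} (hK : IsCompact K) (hfK : ∀ s, ∀ b ∉ K, f (s, b) = 0) :
    ∃ C, LipschitzWith C f := by
  have hc : Continuous (fderiv ℝ f) := hf.continuous_fderiv (by simp)
  have hcomp : IsCompact (Icc (0 : Fin n → ℝ) (fun _ => 2 * Real.pi) ×ˢ K) := isCompact_Icc.prod hK
  obtain ⟨C, hC⟩ := hcomp.exists_bound_of_continuousOn hc.continuousOn
  have hbound : ∀ z, ‖fderiv ℝ f z‖ ≤ max C 0 := by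
    rintro ⟨s, b⟩
    by_cases hb : b ∈ K
    · obtain ⟨l, hl⟩ := exists_add_latticeVec_mem s
      have h1 : fderiv ℝ f (s, b) = fderiv ℝ f ((s, b) + (latticeVec l, 0)) := by
        rw [← fderiv_comp_add_right]
        congr 1
        ext1 z
        have h2 : z + (latticeVec l, (0 : B)) = (z.1 + latticeVec l, z.2) := by
          ext1 <;> simp
        rw [h2]
        exact (hper l z.1 z.2).symm
      rw [h1]
      refine (hC _ ⟨?_, ?_⟩).trans (le_max_left _ _)
      · exact hl
      · simpa using hb
    · have h1 : f =ᶠ[𝓝 (s, b)] fun _ => 0 := by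
        have : IsOpen {z : (Fin n → ℝ) × B | z.2 ∉ K} :=
          hK.isClosed.isOpen_compl.preimage continuous_snd
        exact Filter.eventually_of_mem (this.mem_nhds hb) fun z hz => hfK z.1 z.2 hz
      rw [h1.fderiv_eq]
      simp
  refine ⟨⟨max C 0, le_max_right _ _⟩, lipschitzWith_of_nnnorm_fderiv_le
    (hf.differentiable (by simp)) fun z => hbound z⟩

/-- A periodic vector field near a compact set of parameters can be cut off to a globally Lipschitz
periodic one. -/
theorem exists_cutoff_field {B F : Type*} [NormedAddCommGroup B] [NormedSpace ℝ B]
    [FiniteDimensional ℝ B] [NormedAddCommGroup F] [NormedSpace ℝ F]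
    {U : Set ((Fin n → ℝ) × B)} (hU : IsOpen U)
    (hper : ∀ (l : Fin n → ℤ) s b, (s, b) ∈ U → (s + latticeVec l, b) ∈ U)
    {K : Set B} (hK : IsCompact K) (hKU : ∀ s, ∀ b ∈ K, (s, b) ∈ U)
    {V : (Fin n → ℝ) × B → F} (hV : ContDiffOn ℝ ∞ V U)
    (hVper : ∀ (l : Fin n → ℤ) s b, (s, b) ∈ U → V (s + latticeVec l, b) = V (s, b)) :
    ∃ (V' : (Fin n → ℝ) × B → F) (W : Set B), ContDiff ℝ ∞ V' ∧ (∃ C, LipschitzWith C V') ∧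
      (∀ (l : Fin n → ℤ) s b, V' (s + latticeVec l, b) = V' (s, b)) ∧ IsOpen W ∧ K ⊆ W ∧
      ∀ s, ∀ b ∈ W, (s, b) ∈ U ∧ V' (s, b) = V (s, b) := by
  obtain ⟨W₁, hW₁, hKW₁, hW₁U⟩ := exists_uniform_nhds hU hper hK hKU
  obtain ⟨L, hL, hKL, hLW⟩ := exists_compact_between hK hW₁ hKW₁
  obtain ⟨χ, hχ1, hχ0, -⟩ := exists_contMDiffMap_one_nhds_of_subset_interior (n := ⊤)
    𝓘(ℝ, B) hK.isClosed hKL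
  have hχs : ContDiff ℝ ∞ χ := χ.contMDiff.contDiff
  obtain ⟨W, hW, hKW, hWχ⟩ := mem_nhdsSet_iff_exists.1 hχ1
  set V' : (Fin n → ℝ) × B → F := fun z => χ z.2 • V z with hV'
  have hV's : ContDiff ℝ ∞ V' := by
    rw [contDiff_iff_contDiffAt]
    rintro ⟨s, b⟩
    by_cases hb : b ∈ L
    · exact (hχs.contDiffAt.comp (s, b) contDiffAt_snd).smul
        (hV.contDiffAt (hU.mem_nhds (hW₁U s b (hLW hb))))
    · have h1 : V' =ᶠ[𝓝 (s, b)] fun _ => 0 := by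
        have : IsOpen {z : (Fin n → ℝ) × B | z.2 ∉ L} :=
          hL.isClosed.isOpen_compl.preimage continuous_snd
        refine Filter.eventually_of_mem (this.mem_nhds hb) fun z hz => ?_
        simp [hV', hχ0 z.2 hz]
      exact contDiffAt_const.congr_of_eventuallyEq h1
  have hV'per : ∀ (l : Fin n → ℤ) s b, V' (s + latticeVec l, b) = V' (s, b) := fun l s b => by
    by_cases hb : b ∈ L
    · simp [hV', hVper l s b (hW₁U s b (hLW hb))]
    · simp [hV', hχ0 b hb]
  refine ⟨V', W ∩ W₁, hV's, exists_lipschitzWith_of_periodic hV's hV'per hL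
    (fun s b hb => by simp [hV', hχ0 b hb]), hV'per, hW.inter hW₁, subset_inter hKW hKW₁,
    fun s b hb => ⟨hW₁U s b hb.2, ?_⟩⟩
  have : χ b = 1 := hWχ hb.1
  simp [hV', this]

end Lattice

/-! ### Contact germs along the core and Hamiltonian steps -/

section Step

open Set

variable {n : ℕ}

/-- The universal covering `ℝⁿ × ℝ²` of the space that contains the plastikstufe. -/
abbrev Cover (n : ℕ) : Type := (Fin n → ℝ) × Plane

/-- The translation of the covering by a lattice element. -/
def shiftCover (l : Fin n → ℤ) : Cover n := (latticeVec l, 0)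

/-- The space `ℝⁿ × ℝ² × ℝⁿ⁺¹` that contains a tubular neighbourhood of the covering. -/
abbrev Tube (n : ℕ) : Type := Cover n × (Fin (n + 1) → ℝ)

/-- The translation of the tube by a lattice element. -/
def shiftTube (l : Fin n → ℤ) : Tube n := (shiftCover l, 0)

/-- `a` is a periodic `1`-form on a periodic neighbourhood `Ω` of `ℝⁿ × 𝔻² × 0`, and it is contact
at the points of `ℝⁿ × 𝔻² × 0`. -/
structure IsContactGerm (a : Tube n → Tube n →L[ℝ] ℝ) (Ω : Set (Tube n)) : Prop where
  isOpen : IsOpen Ω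
  shift_mem : ∀ (l : Fin n → ℤ), ∀ q ∈ Ω, q + shiftTube l ∈ Ω
  core_mem : ∀ p : Cover n, p.2 ∈ diskPi → (p, 0) ∈ Ω
  contDiffOn : ContDiffOn ℝ ∞ a Ω
  periodic : ∀ (l : Fin n → ℤ), ∀ q ∈ Ω, a (q + shiftTube l) = a q
  contact : ∀ p : Cover n, p.2 ∈ diskPi → ContactAt a (p, 0)

theorem isCompact_diskPi : IsCompact diskPi := isCompact_closedBall _ _

theorem fderiv_add_right_eq {E F : Type*} [NormedAddCommGroup E] [NormedSpace ℝ E]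
    [NormedAddCommGroup F] [NormedSpace ℝ F] {f : E → F} {c x : E}
    (h : ∀ᶠ z in 𝓝 x, f (z + c) = f z) : fderiv ℝ f (x + c) = fderiv ℝ f x := by
  rw [← fderiv_comp_add_right]
  exact Filter.EventuallyEq.fderiv_eq h

/-- Solves `dΛ(W, ·) = dG` on the symplectization and integrates `W` near the core. The cut-off
field `V` agrees with `W` on `U` and is globally Lipschitz because `W` is periodic and the core is
compact modulo the lattice; hence the flow exists for a uniform time. Only `dG` has to be periodic,
which admits the Hamiltonian `sⱼ`. -/
theorem IsContactGerm.exists_hamiltonian_flow {a : Tube n → Tube n →L[ℝ] ℝ} {Ω : Set (Tube n)}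
    (h : IsContactGerm a Ω) {G : Tube n × ℝ → ℝ} (hG : ContDiff ℝ ∞ G)
    (hGper : ∀ (l : Fin n → ℤ) z, fderiv ℝ G (z + (shiftTube l, 0)) = fderiv ℝ G z) :
    ∃ (U : Set (Tube n × ℝ)) (W V : Tube n × ℝ → Tube n × ℝ) (ε : ℝ)
      (φ : ℝ × Tube n × ℝ → Tube n × ℝ), IsOpen U ∧ U ⊆ Ω ×ˢ univ ∧
      (∀ p : Cover n, p.2 ∈ diskPi → ((p, 0), 0) ∈ U) ∧
      (∀ (l : Fin n → ℤ), ∀ z ∈ U, z + (shiftTube l, 0) ∈ U) ∧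
      ContDiffOn ℝ ∞ W U ∧ EqOn V W U ∧
      (∀ z ∈ U, ∀ w, dForm (liouville a) z (W z) w = fderiv ℝ G z w) ∧
      0 < ε ∧ ContDiffOn ℝ ∞ φ (Ioo (-ε) ε ×ˢ univ) ∧ (∀ x, φ (0, x) = x) ∧
      (∀ τ ∈ Ioo (-ε) ε, ∀ x, HasDerivAt (fun σ => φ (σ, x)) (V (φ (τ, x))) τ) ∧
      ∀ (l : Fin n → ℤ), ∀ τ ∈ Ioo (-ε) ε, ∀ x,
        φ (τ, x + (shiftTube l, 0)) = φ (τ, x) + (shiftTube l, 0) := by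
  set Λ := liouville a with hΛ
  have hΩ' : IsOpen (Ω ×ˢ (univ : Set ℝ)) := h.isOpen.prod isOpen_univ
  have hΛs : ContDiffOn ℝ ∞ Λ (Ω ×ˢ univ) := contDiffOn_liouville h.contDiffOn
  have hBs := contDiffOn_dFormL hΩ' hΛs
  have hΛper : ∀ (l : Fin n → ℤ), ∀ z ∈ Ω ×ˢ (univ : Set ℝ), Λ (z + (shiftTube l, 0)) = Λ z :=
    fun l z hz => by
      simp only [hΛ, liouville, Prod.fst_add, Prod.snd_add, add_zero, h.periodic l z.1 hz.1]
  have hBper : ∀ (l : Fin n → ℤ), ∀ z ∈ Ω ×ˢ (univ : Set ℝ),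
      dFormL Λ (z + (shiftTube l, 0)) = dFormL Λ z := fun l z hz => by
    rw [dFormL, dFormL, fderiv_add_right_eq
      (Filter.eventually_of_mem (hΩ'.mem_nhds hz) fun y hy => hΛper l y hy)]
  -- The contact condition is assumed only on the core; `dΛ` stays invertible on the open set `U₁`
  -- around it.
  set U₁ : Set (Tube n × ℝ) := (Ω ×ˢ univ) ∩ dFormL Λ ⁻¹'
    range ((↑) : ((Tube n × ℝ) ≃L[ℝ] (Tube n × ℝ →L[ℝ] ℝ)) → _) with hU₁
  have hU₁o : IsOpen U₁ :=
    hBs.continuousOn.isOpen_inter_preimage hΩ' ContinuousLinearEquiv.isOpen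
  have hU₁per : ∀ (l : Fin n → ℤ), ∀ z ∈ U₁, z + (shiftTube l, 0) ∈ U₁ := fun l z hz => by
    refine ⟨⟨h.shift_mem l z.1 hz.1.1, mem_univ _⟩, ?_⟩
    rw [mem_preimage, hBper l z hz.1]
    exact hz.2
  set W : Tube n × ℝ → Tube n × ℝ := fun z => (dFormL Λ z).inverse (fderiv ℝ G z) with hW
  have hWs : ContDiffOn ℝ ∞ W U₁ := by
    intro z hz
    obtain ⟨e, he⟩ := hz.2
    have h1 : ContDiffAt ℝ ∞ ContinuousLinearMap.inverse (dFormL Λ z) := by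
      rw [← he]
      exact contDiffAt_map_inverse e
    have h2 : ContDiffAt ℝ ∞ (fun z => (dFormL Λ z).inverse) z :=
      h1.comp z (hBs.contDiffAt (hΩ'.mem_nhds hz.1))
    exact (h2.clm_apply (hG.fderiv_right (m := ∞) (by simp)).contDiffAt).contDiffWithinAt
  have hWper : ∀ (l : Fin n → ℤ), ∀ z ∈ U₁, W (z + (shiftTube l, 0)) = W z := fun l z hz => by
    simp only [hW, hBper l z hz.1, hGper]
  have hWeq : ∀ z ∈ U₁, ∀ w, dForm Λ z (W z) w = fderiv ℝ G z w := fun z hz w => by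
    obtain ⟨e, he⟩ := hz.2
    rw [← dFormL_apply]
    simp only [hW, ← he, ContinuousLinearMap.inverse_equiv]
    simp
  -- separate the periodic coordinates
  let e : (Tube n × ℝ) ≃L[ℝ] (Fin n → ℝ) × (Plane × (Fin (n + 1) → ℝ) × ℝ) :=
    { toFun := fun z => (z.1.1.1, z.1.1.2, z.1.2, z.2)
      invFun := fun w => (((w.1, w.2.1), w.2.2.1), w.2.2.2)
      map_add' := fun _ _ => rfl
      map_smul' := fun _ _ => rfl
      left_inv := fun _ => rfl
      right_inv := fun _ => rfl
      continuous_toFun := by fun_prop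
      continuous_invFun := by fun_prop }
  have hesymm : ∀ (l : Fin n → ℤ) s b, e.symm (s + latticeVec l, b) =
      e.symm (s, b) + (shiftTube l, 0) := fun l s b => by
    have : (s + latticeVec l, b) = (s, b) + (latticeVec l, 0) := by simp
    rw [this, map_add]
    rfl
  have hKc : IsCompact (diskPi ×ˢ ({0} : Set ((Fin (n + 1) → ℝ) × ℝ))) :=
    isCompact_diskPi.prod isCompact_singleton
  obtain ⟨V', W', hV's, ⟨C, hC⟩, hV'per, hW'o, hKW', hW'U⟩ := exists_cutoff_field
    (U := e.symm ⁻¹' U₁) (hU₁o.preimage e.symm.continuous)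
    (fun l s b hb => by
      rw [mem_preimage, hesymm]
      exact hU₁per l _ hb) hKc
    (fun s b hb => by
      obtain ⟨x, y, σ⟩ := b
      obtain ⟨hx, hy⟩ := hb
      obtain ⟨rfl, rfl⟩ : y = 0 ∧ σ = 0 := by simpa using hy
      have hm := h.core_mem (s, x) hx
      refine ⟨⟨hm, mem_univ _⟩, ?_⟩
      obtain ⟨E, hE⟩ := (h.contact (s, x) hx).isInvertible_dFormL_liouville
        ((h.contDiffOn.contDiffAt (h.isOpen.mem_nhds hm)).differentiableAt (by simp)) 0
      exact ⟨E, hE⟩)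
    (V := W ∘ e.symm) (hWs.comp e.symm.contDiff.contDiffOn fun z hz => hz)
    (fun l s b hb => by
      simp only [Function.comp_apply, hesymm]
      exact hWper l _ hb)
  set V : Tube n × ℝ → Tube n × ℝ := V' ∘ e with hV
  have hVs : ContDiff ℝ ∞ V := hV's.comp e.contDiff
  have hVlip := hC.comp e.lipschitz
  obtain ⟨ε, hε, φ, hφ, hφ0, hφV, hφper⟩ := exists_smooth_flow hVs hVlip
  refine ⟨e ⁻¹' (univ ×ˢ W'), W, V, ε, φ, (isOpen_univ.prod hW'o).preimage e.continuous,
    fun z hz => ?_, fun p hp => ⟨mem_univ _, hKW' ⟨hp, by simp [e]⟩⟩, fun l z hz => ?_,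
    hWs.mono fun z hz => ?_, fun z hz => ?_, fun z hz w => hWeq z ?_ w, hε, hφ, hφ0, hφV,
    fun l τ hτ x => hφper _ (fun x => ?_) τ hτ x⟩
  · exact (hW'U z.1.1.1 _ hz.2).1.1
  · refine ⟨mem_univ _, ?_⟩
    have : (e (z + (shiftTube l, 0))).2 = (e z).2 := by simp [e, shiftTube, shiftCover]
    rw [this]
    exact hz.2
  · exact (hW'U z.1.1.1 _ hz.2).1
  · exact (hW'U z.1.1.1 _ hz.2).2
  · exact (hW'U z.1.1.1 _ hz.2).1
  · have : e (x + (shiftTube l, 0)) = ((e x).1 + latticeVec l, (e x).2) := by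
      simp [e, shiftTube, shiftCover]
    simp only [hV, Function.comp_apply, this, hV'per]

end Step

/-! ### Straightening the transverse coordinates one at a time -/

section HamiltonianStep

open Set

variable {n : ℕ}

/-- A transverse coordinate of the tube. -/
def tubeCoord (k : Fin (n + 1)) : Tube n →L[ℝ] ℝ :=
  (ContinuousLinearMap.proj k).comp (ContinuousLinearMap.snd ℝ (Cover n) (Fin (n + 1) → ℝ))

@[simp]
theorem tubeCoord_apply (k : Fin (n + 1)) (q : Tube n) : tubeCoord k q = q.2 k := rfl

/-- A transverse coordinate vector of the tube. -/
def tubeVec (k : Fin (n + 1)) : Tube n := (0, Pi.single k 1)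

/-- The projection of the tube that sets one transverse coordinate to zero. -/
def kill (k : Fin (n + 1)) : Tube n →L[ℝ] Tube n :=
  ContinuousLinearMap.id ℝ _ - (tubeCoord k).smulRight (tubeVec k)

theorem kill_apply (k : Fin (n + 1)) (q : Tube n) : kill k q = q - q.2 k • tubeVec k := rfl

@[simp]
theorem kill_fst (k : Fin (n + 1)) (q : Tube n) : (kill k q).1 = q.1 := by
  simp [kill_apply, tubeVec]

theorem kill_snd_self (k : Fin (n + 1)) (q : Tube n) : (kill k q).2 k = 0 := by
  simp [kill_apply, tubeVec]

theorem kill_snd_of_ne {k j : Fin (n + 1)} (hjk : j ≠ k) (q : Tube n) :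
    (kill k q).2 j = q.2 j := by
  simp [kill_apply, tubeVec, hjk]

theorem kill_of_eq_zero {k : Fin (n + 1)} {q : Tube n} (hq : q.2 k = 0) : kill k q = q := by
  simp [kill_apply, hq]

theorem kill_tubeVec (k : Fin (n + 1)) : kill k (tubeVec k : Tube n) = 0 := by
  simp [kill_apply, tubeVec]

theorem kill_add_shift (k : Fin (n + 1)) (q : Tube n) (l : Fin n → ℤ) :
    kill k (q + shiftTube l) = kill k q + shiftTube l := by
  rw [map_add, kill_of_eq_zero (q := shiftTube l) (by simp [shiftTube])]

/-- `Ψ` is a periodic change of coordinates from `Ω'` to `Ω` that fixes the core and that relates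
the forms `a'` and `a` up to a positive factor. -/
structure IsReparam (a : Tube n → Tube n →L[ℝ] ℝ) (Ω : Set (Tube n))
    (a' : Tube n → Tube n →L[ℝ] ℝ) (Ω' : Set (Tube n)) (Ψ : Tube n → Tube n) : Prop where
  contDiffOn : ContDiffOn ℝ ∞ Ψ Ω'
  mapsTo : MapsTo Ψ Ω' Ω
  shift : ∀ (l : Fin n → ℤ), ∀ q ∈ Ω', Ψ (q + shiftTube l) = Ψ q + shiftTube l
  core : ∀ p : Cover n, Ψ (p, 0) = (p, 0)
  injective : ∀ p : Cover n, p.2 ∈ diskPi → Function.Injective (fderiv ℝ Ψ (p, 0))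
  scale : ∀ q ∈ Ω', ∃ ρ > 0, ∀ v, a' q v = ρ * a (Ψ q) (fderiv ℝ Ψ q v)

theorem IsReparam.refl (a : Tube n → Tube n →L[ℝ] ℝ) (Ω : Set (Tube n)) :
    IsReparam a Ω a Ω id where
  contDiffOn := contDiffOn_id
  mapsTo := mapsTo_id Ω
  shift _ _ _ := rfl
  core _ := rfl
  injective p hp := by simpa using Function.injective_id
  scale q hq := ⟨1, one_pos, fun v => by simp⟩

theorem IsReparam.trans {a a' a'' : Tube n → Tube n →L[ℝ] ℝ} {Ω Ω' Ω'' : Set (Tube n)}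
    {Ψ Φ : Tube n → Tube n} (h : IsReparam a Ω a' Ω' Ψ) (h' : IsReparam a' Ω' a'' Ω'' Φ)
    (ho : IsOpen Ω') (ho' : IsOpen Ω'')
    (hc : ∀ p : Cover n, p.2 ∈ diskPi → ((p, 0) : Tube n) ∈ Ω'') :
    IsReparam a Ω a'' Ω'' (Ψ ∘ Φ) := by
  have hd : ∀ q ∈ Ω'', fderiv ℝ (Ψ ∘ Φ) q = (fderiv ℝ Ψ (Φ q)).comp (fderiv ℝ Φ q) := fun q hq =>
    fderiv_comp q
      ((h.contDiffOn.contDiffAt (ho.mem_nhds (h'.mapsTo hq))).differentiableAt (by simp))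
      ((h'.contDiffOn.contDiffAt (ho'.mem_nhds hq)).differentiableAt (by simp))
  refine ⟨h.contDiffOn.comp h'.contDiffOn h'.mapsTo, h.mapsTo.comp h'.mapsTo, fun l q hq => ?_,
    fun p => ?_, fun p hp => ?_, fun q hq => ?_⟩
  · simp [h'.shift l q hq, h.shift l _ (h'.mapsTo hq)]
  · simp [h'.core, h.core]
  · rw [hd _ (hc p hp), h'.core]
    exact (h.injective p hp).comp (h'.injective p hp)
  · obtain ⟨ρ', hρ', h1⟩ := h'.scale q hq
    obtain ⟨ρ, hρ, h2⟩ := h.scale _ (h'.mapsTo hq)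
    refine ⟨ρ' * ρ, mul_pos hρ' hρ, fun v => ?_⟩
    rw [h1, h2, hd q hq, mul_assoc]
    rfl

/-- Flowing along the Hamiltonian field of `e^{κσ} g` on the symplectization, for `κ = 0` or `κ = 1`,
from the hyperplane on which the coordinate `k` vanishes yields new coordinates in which the
contact form is normalized in the direction of that coordinate. -/
theorem IsContactGerm.step {a : Tube n → Tube n →L[ℝ] ℝ} {Ω : Set (Tube n)}
    (h : IsContactGerm a Ω) (k : Fin (n + 1)) {κ : ℝ} {g : Tube n → ℝ} (hg : ContDiff ℝ ∞ g)
    (hgper : ∀ (l : Fin n → ℤ) q, fderiv ℝ g (q + shiftTube l) = fderiv ℝ g q)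
    (hgκ : ∀ (l : Fin n → ℤ) q, κ * g (q + shiftTube l) = κ * g q)
    (hX : ∀ p : Cover n, p.2 ∈ diskPi → ∀ X μ,
      (∀ v, dForm a (p, 0) X v + μ * a (p, 0) v = fderiv ℝ g (p, 0) v) →
      a (p, 0) X = -κ * g (p, 0) → X.2 k ≠ 0) :
    ∃ (Ω' : Set (Tube n)) (Ψ : Tube n → Tube n) (a' : Tube n → Tube n →L[ℝ] ℝ),
      IsContactGerm a' Ω' ∧ IsReparam a Ω a' Ω' Ψ ∧
      (∀ q ∈ Ω', kill k q ∈ Ω ∧ ∀ v, a' q v = a (kill k q) (kill k v) +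
        q.2 k * ((1 - κ) * fderiv ℝ g (kill k q) (kill k v)) - κ * g (kill k q) * v.2 k) ∧
      (∀ p : Cover n, p.2 ∈ diskPi → ∀ u v,
        dForm a' (p, 0) (kill k u) (kill k v) = dForm a (p, 0) (kill k u) (kill k v)) ∧
      ∀ p : Cover n, p.2 ∈ diskPi → ∀ v,
        dForm a' (p, 0) (tubeVec k) (kill k v) = fderiv ℝ g (p, 0) (kill k v) := by
  set G : Tube n × ℝ → ℝ := fun z => Real.exp (κ * z.2) * g z.1 with hGdef
  have hGs : ContDiff ℝ ∞ G :=
    (Real.contDiff_exp.comp (contDiff_const.mul contDiff_snd)).mul (hg.comp contDiff_fst)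
  have hGd : ∀ z w, fderiv ℝ G z w =
      Real.exp (κ * z.2) * (fderiv ℝ g z.1 w.1 + κ * g z.1 * w.2) := fun z w => by
    have h1 : HasFDerivAt (fun z : Tube n × ℝ => Real.exp (κ * z.2))
        (Real.exp (κ * z.2) • κ • ContinuousLinearMap.snd ℝ (Tube n) ℝ) z :=
      (hasFDerivAt_snd.const_mul κ).exp
    have h2 : HasFDerivAt (fun z : Tube n × ℝ => g z.1)
        ((fderiv ℝ g z.1).comp (ContinuousLinearMap.fst ℝ (Tube n) ℝ)) z :=
      ((hg.differentiable (by simp)) z.1).hasFDerivAt.comp z hasFDerivAt_fst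
    have h3 := (h1.mul h2).fderiv
    have h4 : fderiv ℝ G z = _ := h3
    rw [h4]
    simp
    ring
  have hGper : ∀ (l : Fin n → ℤ) z, fderiv ℝ G (z + (shiftTube l, 0)) = fderiv ℝ G z :=
    fun l z => by
    refine ContinuousLinearMap.ext fun w => ?_
    rw [hGd, hGd]
    simp [hgper, hgκ]
  obtain ⟨U, W, V, ε, φ, hU, hUΩ, hUcore, hUper, hWs, hVW, hWeq, hε, hφ, hφ0, hφV, hφper⟩ :=
    h.exists_hamiltonian_flow hGs hGper
  set Λ := liouville a with hΛ
  have hΛs : ContDiffOn ℝ ∞ Λ U := (contDiffOn_liouville h.contDiffOn).mono hUΩ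
  have had : ∀ q ∈ Ω, DifferentiableAt ℝ a q := fun q hq =>
    (h.contDiffOn.contDiffAt (h.isOpen.mem_nhds hq)).differentiableAt (by simp)
  -- Pairing the Hamiltonian equation with `∂_σ` gives `-Λ(W) = κ G`.
  have hΛW : ∀ z ∈ U, Λ z (W z) = -κ * G z := fun z hz => by
    have h1 := hWeq z hz (0, 1)
    rw [hGd, dForm_liouville (had _ (hUΩ hz).1)] at h1
    rw [hΛ, liouville_apply]
    simp only [dForm, map_zero, zero_apply, sub_self, mul_zero, zero_sub,
      one_mul, zero_add, mul_one] at h1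
    simp only [hGdef]
    linear_combination -h1
  -- the new coordinates
  set ι : Tube n → Tube n × ℝ := fun q => (kill k q, 0) with hι
  set Ψ' : Tube n → Tube n × ℝ := fun q => φ (q.2 k, ι q) with hΨ'
  -- The whole flow segment from the hyperplane to the point has to stay in `U`, since the transport
  -- formula is integrated along it.
  set Ω' : Set (Tube n) :=
    {q | ∀ r ∈ Icc (0 : ℝ) 1, r * q.2 k ∈ Ioo (-ε) ε ∧ φ (r * q.2 k, ι q) ∈ U} with hΩ'
  have hm1 : ∀ q ∈ Ω', q.2 k ∈ Ioo (-ε) ε ∧ Ψ' q ∈ U := fun q hq => by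
    simpa using hq 1 (right_mem_Icc.2 zero_le_one)
  have hm0 : ∀ q ∈ Ω', ι q ∈ U := fun q hq => by
    have := (hq 0 (left_mem_Icc.2 zero_le_one)).2
    rwa [zero_mul, hφ0] at this
  have hflow_open : IsOpen (Ioo (-ε) ε ×ˢ (univ : Set (Tube n × ℝ))) :=
    isOpen_Ioo.prod isOpen_univ
  have hΩ'o : IsOpen Ω' := by
    set O : Set (ℝ × Tube n) := (fun z : ℝ × Tube n => (z.1 * z.2.2 k, ι z.2)) ⁻¹'
      ((Ioo (-ε) ε ×ˢ univ) ∩ φ ⁻¹' U) with hO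
    have hOo : IsOpen O :=
      (hφ.continuousOn.isOpen_inter_preimage hflow_open hU).preimage (by fun_prop)
    rw [isOpen_iff_mem_nhds]
    intro q hq
    obtain ⟨u, v, -, hv, hu, hqv, huv⟩ := generalized_tube_lemma
      (isCompact_Icc (a := (0 : ℝ)) (b := 1)) (isCompact_singleton (x := q)) hOo (by
        rintro ⟨r, q'⟩ ⟨hr, rfl⟩
        exact ⟨⟨(hq r hr).1, mem_univ _⟩, (hq r hr).2⟩)
    refine Filter.mem_of_superset (hv.mem_nhds (hqv rfl)) fun q' hq' r hr => ?_
    have := huv (⟨hu hr, hq'⟩ : (r, q') ∈ u ×ˢ v)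
    exact ⟨this.1.1, this.2⟩
  have hιcore : ∀ p : Cover n, ι (p, 0) = ((p, 0), 0) := fun p => by
    simp only [hι]
    rw [kill_of_eq_zero rfl]
  have hΨ'core : ∀ p : Cover n, Ψ' (p, 0) = ((p, 0), 0) := fun p => by
    simp [hΨ', hφ0, hιcore]
  have hcore : ∀ p : Cover n, p.2 ∈ diskPi → ((p, 0) : Tube n) ∈ Ω' := fun p hp r hr => by
    simp only [Pi.zero_apply, mul_zero, hφ0, hιcore]
    exact ⟨⟨by linarith, hε⟩, hUcore p hp⟩
  have hιshift : ∀ (l : Fin n → ℤ) q, ι (q + shiftTube l) = ι q + (shiftTube l, 0) :=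
    fun l q => by simp [hι, kill_add_shift]
  have hyshift : ∀ (l : Fin n → ℤ) (q : Tube n), (q + shiftTube l).2 k = q.2 k :=
    fun l q => by simp [shiftTube]
  have hΩ'shift : ∀ (l : Fin n → ℤ), ∀ q ∈ Ω', q + shiftTube l ∈ Ω' := fun l q hq r hr => by
    rw [hyshift, hιshift, hφper l _ (hq r hr).1]
    exact ⟨(hq r hr).1, hUper l _ (hq r hr).2⟩
  have hΨ'shift : ∀ (l : Fin n → ℤ), ∀ q ∈ Ω', Ψ' (q + shiftTube l) = Ψ' q + (shiftTube l, 0) :=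
    fun l q hq => by
      simp only [hΨ']
      rw [hyshift, hιshift, hφper l _ (hm1 q hq).1]
  have hιs : ContDiff ℝ ∞ ι := (kill k).contDiff.prodMk contDiff_const
  have hyιs : ContDiff ℝ ∞ (fun q : Tube n => (q.2 k, ι q)) :=
    (tubeCoord k).contDiff.prodMk hιs
  have hΨ's : ContDiffOn ℝ ∞ Ψ' Ω' := hφ.comp hyιs.contDiffOn fun q hq =>
    ⟨(hm1 q hq).1, mem_univ _⟩
  have hφat : ∀ q ∈ Ω', HasFDerivAt φ (fderiv ℝ φ (q.2 k, ι q)) (q.2 k, ι q) := fun q hq =>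
    ((hφ.contDiffAt (hflow_open.mem_nhds ⟨(hm1 q hq).1, mem_univ _⟩)).differentiableAt
      (by simp)).hasFDerivAt
  have hΨ'd : ∀ q ∈ Ω', ∀ v, fderiv ℝ Ψ' q v =
      v.2 k • W (Ψ' q) + fderiv ℝ φ (q.2 k, ι q) (0, (kill k v, 0)) := fun q hq v => by
    have h1 : HasFDerivAt (fun q : Tube n => (q.2 k, ι q))
        ((tubeCoord k).prod ((kill k).prod 0)) q :=
      (tubeCoord k).hasFDerivAt.prodMk ((kill k).hasFDerivAt.prodMk (hasFDerivAt_const (0 : ℝ) q))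
    have h2 : HasFDerivAt Ψ' _ q := (hφat q hq).comp q h1
    rw [h2.fderiv]
    have h3 : fderiv ℝ φ (q.2 k, ι q) (1, 0) = W (Ψ' q) := by
      have h4 : HasDerivAt (fun σ => φ (σ, ι q)) (fderiv ℝ φ (q.2 k, ι q) (1, 0)) (q.2 k) :=
        (hφat q hq).comp_hasDerivAt (q.2 k)
          ((hasDerivAt_id (q.2 k)).prodMk (hasDerivAt_const (q.2 k) (ι q)))
      rw [h4.unique (hφV _ (hm1 q hq).1 (ι q))]
      exact hVW (hm1 q hq).2
    rw [← h3, ← map_smul, ← map_add]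
    simp
  set a' := pullForm Ψ' Λ with ha'
  have ha's : ContDiffOn ℝ ∞ a' Ω' := hΨ's.pullForm hΩ'o hΛs fun q hq => (hm1 q hq).2
  -- the normal form
  have hform : ∀ q ∈ Ω', ∀ v, a' q v = a (kill k q) (kill k v) +
      q.2 k * ((1 - κ) * fderiv ℝ g (kill k q) (kill k v)) - κ * g (kill k q) * v.2 k :=
    fun q hq v => by
    -- The flow adds `yₖ (1 - κ) dg` to the form on the hyperplane. The direction `∂_{yₖ}` is sent
    -- to `W`, on which `Λ` equals `-κ G`, and `G` keeps its initial value.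
    obtain ⟨e1, e2⟩ := transport_along_flow hφ hφ0 hφV hU hVW hWs hΛs hGs.contDiffOn hWeq hΛW
      (hm1 q hq).1 (fun r hr => (hq r hr).2) (kill k v, 0)
    rw [ha', pullForm_apply, hΨ'd q hq v, map_add, map_smul, hΛW _ (hm1 q hq).2]
    have e3 : G (Ψ' q) = g (kill k q) := by
      rw [show G (Ψ' q) = G (ι q) from e1]
      simp [hGdef, hι]
    have e4 : Λ (ι q) (kill k v, 0) = a (kill k q) (kill k v) := by
      rw [hΛ, liouville_apply]
      simp [hι]
    have e5 : fderiv ℝ G (ι q) (kill k v, 0) = fderiv ℝ g (kill k q) (kill k v) := by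
      rw [hGd]
      simp [hι]
    rw [e4, e5] at e2
    rw [e3]
    simp only [hΨ'] at e2 ⊢
    rw [e2, smul_eq_mul]
    ring
  -- first-order data at the core
  have hφcore : ∀ p : Cover n, p.2 ∈ diskPi → ∀ w,
      fderiv ℝ φ ((0 : ℝ), ((p, 0), 0)) (0, w) = w := fun p hp w => by
    have h1 := hφat _ (hcore p hp)
    rw [hιcore] at h1
    have h2 : HasFDerivAt (fun z => φ ((0 : ℝ), z)) _ (((p, 0), 0) : Tube n × ℝ) :=
      h1.comp _ (hasFDerivAt_prodMk_right (0 : ℝ) _)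
    simp only [hφ0] at h2
    exact DFunLike.congr_fun (h2.unique (hasFDerivAt_id _)) w
  have hΨ'dcore : ∀ p : Cover n, p.2 ∈ diskPi → ∀ v, fderiv ℝ Ψ' (p, 0) v =
      v.2 k • W ((p, 0), 0) + (kill k v, 0) := fun p hp v => by
    rw [hΨ'd _ (hcore p hp), hΨ'core, hιcore]
    congr 1
    exact hφcore p hp _
  have hWcore : ∀ p : Cover n, p.2 ∈ diskPi → (∀ v, dForm a (p, 0) (W ((p, 0), 0)).1 v +
      (W ((p, 0), 0)).2 * a (p, 0) v = fderiv ℝ g (p, 0) v) ∧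
      a (p, 0) (W ((p, 0), 0)).1 = -κ * g (p, 0) := fun p hp => by
    refine ⟨fun v => ?_, ?_⟩
    · have h1 := hWeq _ (hUcore p hp) (v, 0)
      rw [hGd, dForm_liouville (had _ (h.core_mem p hp))] at h1
      simpa using h1
    · have h1 := hΛW _ (hUcore p hp)
      rw [hΛ, liouville_apply] at h1
      simpa [hGdef] using h1
  have hWk : ∀ p : Cover n, p.2 ∈ diskPi → (W ((p, 0), 0)).1.2 k ≠ 0 := fun p hp =>
    hX p hp _ _ (hWcore p hp).1 (hWcore p hp).2
  set Ψ : Tube n → Tube n := fun q => (Ψ' q).1 with hΨ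
  have hΨd : ∀ q ∈ Ω', ∀ v, fderiv ℝ Ψ q v = (fderiv ℝ Ψ' q v).1 := fun q hq v => by
    have h1 := ((hΨ's.contDiffAt (hΩ'o.mem_nhds hq)).differentiableAt (by simp)).hasFDerivAt
    have h2 : HasFDerivAt Ψ _ q := h1.fst
    rw [h2.fderiv]
    rfl
  have hΨdcore : ∀ p : Cover n, p.2 ∈ diskPi → ∀ v, fderiv ℝ Ψ (p, 0) v =
      v.2 k • (W ((p, 0), 0)).1 + kill k v := fun p hp v => by
    rw [hΨd _ (hcore p hp), hΨ'dcore p hp]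
    rfl
  -- Along the core the differential of `Ψ` is the identity on the hyperplane and sends `∂_{yₖ}` to
  -- the projected field, whose `k`-th component is nonzero by `hX`.
  have hinj : ∀ p : Cover n, p.2 ∈ diskPi → Function.Injective (fderiv ℝ Ψ (p, 0)) :=
    fun p hp => by
    rw [injective_iff_map_eq_zero]
    intro v hv
    rw [hΨdcore p hp] at hv
    have h1 : v.2 k = 0 := by
      have := congrArg (fun w : Tube n => w.2 k) hv
      simpa [kill_snd_self, hWk p hp] using this
    rw [h1, zero_smul, zero_add, kill_of_eq_zero h1] at hv
    exact hv
  have hsurj : ∀ p : Cover n, p.2 ∈ diskPi → Function.Surjective (fderiv ℝ Ψ (p, 0)) :=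
    fun p hp => (LinearMap.injective_iff_surjective (f := (fderiv ℝ Ψ (p, 0)).toLinearMap)).1
      (hinj p hp)
  have hscale : ∀ q ∈ Ω', ∀ v,
      a' q v = Real.exp (Ψ' q).2 * a (Ψ q) (fderiv ℝ Ψ q v) := fun q hq v => by
    rw [ha', pullForm_apply, hΛ, liouville_apply, hΨd q hq]
  have hda' : ∀ p : Cover n, p.2 ∈ diskPi → ∀ u v, dForm a' (p, 0) u v =
      dForm a (p, 0) (fderiv ℝ Ψ' (p, 0) u).1 (fderiv ℝ Ψ' (p, 0) v).1 +
        (fderiv ℝ Ψ' (p, 0) u).2 * a (p, 0) (fderiv ℝ Ψ' (p, 0) v).1 -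
        (fderiv ℝ Ψ' (p, 0) v).2 * a (p, 0) (fderiv ℝ Ψ' (p, 0) u).1 := fun p hp u v => by
    have hΛd : DifferentiableAt ℝ Λ (Ψ' (p, 0)) := by
      rw [hΨ'core]
      exact (hΛs.contDiffAt (hU.mem_nhds (hUcore p hp))).differentiableAt (by simp)
    rw [ha', dForm_pullForm ((hΨ's.contDiffAt (hΩ'o.mem_nhds (hcore p hp))).of_le two_le_infty)
      hΛd, hΨ'core, hΛ, dForm_liouville (had _ (h.core_mem p hp))]
    simp
  refine ⟨Ω', Ψ, a', ?_, ⟨contDiff_fst.comp_contDiffOn hΨ's,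
    fun q hq => (hUΩ (hm1 q hq).2).1, fun l q hq => ?_, fun p => ?_, hinj,
    fun q hq => ⟨_, Real.exp_pos _, hscale q hq⟩⟩,
    fun q hq => ⟨(hUΩ (hm0 q hq)).1, hform q hq⟩, fun p hp u v => ?_, fun p hp v => ?_⟩
  · refine ⟨hΩ'o, hΩ'shift, hcore, ha's, fun l q hq => ?_, fun p hp => ⟨?_, fun u hu huv => ?_⟩⟩
    · refine ContinuousLinearMap.ext fun v => ?_
      rw [hform _ hq, hform _ (hΩ'shift l q hq), kill_add_shift,
        h.periodic l _ (hUΩ (hm0 q hq)).1, hgper, hgκ, hyshift]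
    · intro h0
      refine (h.contact p hp).1 (ContinuousLinearMap.ext fun v => ?_)
      obtain ⟨w, hw⟩ := hsurj p hp v
      have h1 := hscale _ (hcore p hp) w
      rw [h0, hΨ'core, hw] at h1
      simpa [hΨ, hΨ'core] using h1.symm
    -- At the core `σ = 0`, so the conformal factor is `1`. Its derivative contributes nothing to
    -- `da'` on pairs of kernel vectors, and nondegeneracy is inherited from `a`.
    · have hker : ∀ w, a' (p, 0) w = a (p, 0) (fderiv ℝ Ψ' (p, 0) w).1 := fun w => by
        rw [hscale _ (hcore p hp) w, hΨd _ (hcore p hp)]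
        simp [hΨ, hΨ'core]
      refine hinj p hp ?_
      rw [map_zero, hΨd _ (hcore p hp)]
      refine (h.contact p hp).2 _ (by rw [← hker, hu]) fun v hv => ?_
      obtain ⟨w, hw⟩ := hsurj p hp v
      rw [hΨd _ (hcore p hp)] at hw
      have h1 := huv w (by rw [hker, hw, hv])
      rw [hda' p hp, hw, hv, ← hker u, hu] at h1
      simpa using h1
  · simp [hΨ, hΨ'shift l q hq]
  · simp [hΨ, hΨ'core]
  · rw [hda' p hp, hΨ'dcore p hp, hΨ'dcore p hp]
    simp only [kill_snd_self, zero_smul, zero_add, zero_mul, add_zero, sub_zero]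
    rw [kill_of_eq_zero (kill_snd_self k u), kill_of_eq_zero (kill_snd_self k v)]
  · rw [hda' p hp, hΨ'dcore p hp, hΨ'dcore p hp, ← (hWcore p hp).1 (kill k v)]
    rw [kill_of_eq_zero (kill_snd_self k v), kill_tubeVec, kill_snd_self]
    simp [tubeVec]

/-- The coordinate vector of a periodic coordinate. -/
def periodVec (i : Fin n) : Tube n := ((Pi.single i 1, 0), 0)

/-- The radial vector field of the disk. -/
def radialVec (p : Cover n) : Tube n := ((0, p.2), 0)

/-- The first-order normalization of a contact form along the core. -/
structure IsCoreNormalized (a : Tube n → Tube n →L[ℝ] ℝ) : Prop where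
  core : ∀ p : Cover n, p.2 ∈ diskPi → ∀ w : Cover n, a (p, 0) (w, 0) = otForm p.2 w.2
  dForm_core : ∀ p : Cover n, p.2 ∈ diskPi → ∀ w w' : Cover n,
    dForm a (p, 0) (w, 0) (w', 0) = (sincNorm p.2 + cosNorm p.2) * wedge w.2 w'.2
  dForm_zero : ∀ p : Cover n, p.2 ∈ diskPi → ∀ i, dForm a (p, 0) (tubeVec 0) (periodVec i) = 0
  dForm_succ : ∀ p : Cover n, p.2 ∈ diskPi → ∀ j i : Fin n,
    dForm a (p, 0) (tubeVec j.succ) (periodVec i) = if i = j then 1 else 0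
  radial : ∀ p : Cover n, p.2 ∈ diskPi → ∀ j : Fin n,
    (sincNorm p.2 + cosNorm p.2) * a (p, 0) (tubeVec j.succ) +
      sincNorm p.2 * dForm a (p, 0) (tubeVec j.succ) (radialVec p) = 0

theorem tube_eq_sum (X : Tube n) : X = (X.1, 0) + ∑ j, X.2 j • tubeVec j := by
  refine Prod.ext ?_ ?_
  · simp [tubeVec, Prod.fst_sum]
  · ext i
    simp [tubeVec, Prod.snd_sum, Pi.single_apply]

theorem dForm_sum_left {E ι : Type*} [NormedAddCommGroup E] [NormedSpace ℝ E]
    (a : E → E →L[ℝ] ℝ) (x v : E) (s : Finset ι) (f : ι → E) :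
    dForm a x (∑ j ∈ s, f j) v = ∑ j ∈ s, dForm a x (f j) v := by
  simp [dForm, Finset.sum_sub_distrib]

/-- The coordinate `s_i` on the tube. -/
def periodCoord (i : Fin n) : Tube n →L[ℝ] ℝ :=
  (ContinuousLinearMap.proj i).comp ((ContinuousLinearMap.fst ℝ (Fin n → ℝ) Plane).comp
    (ContinuousLinearMap.fst ℝ (Cover n) (Fin (n + 1) → ℝ)))

theorem periodCoord_apply (i : Fin n) (v : Tube n) : periodCoord i v = v.1.1 i := rfl

theorem hasFDerivAt_periodCoord (i : Fin n) (q : Tube n) :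
    HasFDerivAt (fun q : Tube n => q.1.1 i) (periodCoord i) q :=
  (periodCoord i).hasFDerivAt

theorem fderiv_neg_cosNorm_tube (q v : Tube n) :
    fderiv ℝ (fun q : Tube n => -cosNorm q.1.2) q v = sincNorm q.1.2 * inner ℝ q.1.2 v.1.2 := by
  have e0 : HasFDerivAt (fun q : Tube n => q.1.2)
      ((ContinuousLinearMap.snd ℝ (Fin n → ℝ) Plane).comp
        (ContinuousLinearMap.fst ℝ (Cover n) (Fin (n + 1) → ℝ))) q :=
    ((ContinuousLinearMap.snd ℝ (Fin n → ℝ) Plane).comp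
        (ContinuousLinearMap.fst ℝ (Cover n) (Fin (n + 1) → ℝ))).hasFDerivAt
  have e1 := HasFDerivAt.comp (g := cosNorm) (f := fun q : Tube n => q.1.2) q
    ((contDiff_cosNorm.differentiable (by simp)) q.1.2).hasFDerivAt e0
  have e2 : fderiv ℝ (fun q : Tube n => -cosNorm q.1.2) q = _ := e1.neg.fderiv
  rw [e2]
  simp [fderiv_cosNorm]

/-- A normalized contact germ is, in suitable coordinates, the germ of the form
`r sin r dϑ + cos r dy₀ + ∑ⱼ yⱼ₊₁ dsⱼ`. -/
theorem IsContactGerm.exists_normal_form {a : Tube n → Tube n →L[ℝ] ℝ} {Ω : Set (Tube n)}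
    (h : IsContactGerm a Ω) (hN : IsCoreNormalized a) :
    ∃ (Ω' : Set (Tube n)) (Ψ : Tube n → Tube n) (a' : Tube n → Tube n →L[ℝ] ℝ),
      IsContactGerm a' Ω' ∧ IsReparam a Ω a' Ω' Ψ ∧
      ∀ q ∈ Ω', q.1.2 ∈ diskPi → ∀ v, a' q v =
        otForm q.1.2 v.1.2 + cosNorm q.1.2 * v.2 0 + ∑ j : Fin n, q.2 j.succ * v.1.1 j := by
  -- After `m` steps the normal form holds on the slice where the coordinates with index at least
  -- `m` vanish. The values of `da'` against `∂_{sᵢ}` on the core are carried along, as later steps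
  -- need them. The radial condition matters only for the first step, hence the clause `m = 0 → a' =
  -- a`.
  suffices H : ∀ m : ℕ, m ≤ n + 1 → ∃ (Ω' : Set (Tube n)) (Ψ : Tube n → Tube n)
      (a' : Tube n → Tube n →L[ℝ] ℝ), IsContactGerm a' Ω' ∧ IsReparam a Ω a' Ω' Ψ ∧
      (∀ q ∈ Ω', q.1.2 ∈ diskPi → (∀ j : Fin (n + 1), m ≤ j → q.2 j = 0) →
        ∀ v : Tube n, (∀ j : Fin (n + 1), m ≤ j → v.2 j = 0) → a' q v =
        otForm q.1.2 v.1.2 + cosNorm q.1.2 * v.2 0 + ∑ j : Fin n, q.2 j.succ * v.1.1 j) ∧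
      (∀ p : Cover n, p.2 ∈ diskPi → ∀ i w, dForm a' (p, 0) (w, 0) (periodVec i) = 0) ∧
      (∀ p : Cover n, p.2 ∈ diskPi → ∀ i, dForm a' (p, 0) (tubeVec 0) (periodVec i) = 0) ∧
      (∀ p : Cover n, p.2 ∈ diskPi → ∀ j i : Fin n,
        dForm a' (p, 0) (tubeVec j.succ) (periodVec i) = if i = j then 1 else 0) ∧
      (m = 0 → a' = a) by
    obtain ⟨Ω', Ψ, a', h1, h2, h3, -⟩ := H (n + 1) le_rfl
    exact ⟨Ω', Ψ, a', h1, h2, fun q hq hqD v => h3 q hq hqD (fun j hj => by omega) v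
      (fun j hj => by omega)⟩
  intro m
  induction m with
  | zero =>
    intro _
    refine ⟨Ω, id, a, h, IsReparam.refl a Ω, fun q hq hqD hq0 v hv0 => ?_, fun p hp i w => ?_,
      hN.dForm_zero, hN.dForm_succ, fun _ => rfl⟩
    · obtain ⟨p, y⟩ := q
      obtain ⟨w, z⟩ := v
      obtain rfl : y = 0 := funext fun j => hq0 j (Nat.zero_le _)
      obtain rfl : z = 0 := funext fun j => hv0 j (Nat.zero_le _)
      simpa using hN.core p hqD w
    · rw [periodVec, hN.dForm_core p hp]
      simp [wedge]
  | succ m ih =>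
    intro hm
    obtain ⟨Ω₁, Ψ₁, a₁, hg₁, hr₁, hf₁, hs₁, hz₁, ht₁, he₁⟩ := ih (by omega)
    set k : Fin (n + 1) := ⟨m, by omega⟩ with hk
    have hperiod : ∀ i, kill k (periodVec i : Tube n) = periodVec i := fun i =>
      kill_of_eq_zero (by simp [periodVec])
    have hcorevec : ∀ w : Cover n, kill k ((w, 0) : Tube n) = (w, 0) := fun w =>
      kill_of_eq_zero (by simp)
    have hvec : ∀ j, j ≠ k → kill k (tubeVec j : Tube n) = tubeVec j := fun j hj =>
      kill_of_eq_zero (by simp [tubeVec, hj.symm])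
    -- The Hamiltonian is `-e^σ cos r` for `y₀` and `sⱼ` for `yⱼ₊₁`; the content is the
    -- transversality `hX`.
    obtain ⟨κ, g, hgs, hgper, hgκ, hX, hgk0, hgks⟩ : ∃ (κ : ℝ) (g : Tube n → ℝ), ContDiff ℝ ∞ g ∧
        (∀ (l : Fin n → ℤ) q, fderiv ℝ g (q + shiftTube l) = fderiv ℝ g q) ∧
        (∀ (l : Fin n → ℤ) q, κ * g (q + shiftTube l) = κ * g q) ∧
        (∀ p : Cover n, p.2 ∈ diskPi → ∀ X μ,
          (∀ v, dForm a₁ (p, 0) X v + μ * a₁ (p, 0) v = fderiv ℝ g (p, 0) v) →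
          a₁ (p, 0) X = -κ * g (p, 0) → X.2 k ≠ 0) ∧
        (k = 0 → κ = 1 ∧ g = fun q => -cosNorm q.1.2) ∧
        (∀ j : Fin n, k = j.succ → κ = 0 ∧ g = fun q => q.1.1 j) := by
      rcases Fin.eq_zero_or_eq_succ k with hk0 | ⟨i, hi⟩
      · have hm0 : m = 0 := by simpa [hk] using congrArg Fin.val hk0
        obtain rfl := he₁ hm0
        have hgs : ContDiff ℝ ∞ (fun q : Tube n => -cosNorm q.1.2) :=
          (contDiff_cosNorm.comp (contDiff_snd.comp contDiff_fst)).neg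
        refine ⟨1, fun q => -cosNorm q.1.2, hgs, fun l q => fderiv_add_right_eq
          (Filter.Eventually.of_forall fun z => by simp [shiftTube, shiftCover]),
          fun l q => by simp [shiftTube, shiftCover], fun p hp X μ h1 h2 h3 => ?_,
          fun _ => ⟨rfl, rfl⟩, fun j hj => absurd (hk0.symm.trans hj) (Fin.succ_ne_zero j).symm⟩
        have hd : ∀ v : Tube n, fderiv ℝ (fun q : Tube n => -cosNorm q.1.2) (p, 0) v =
            sincNorm p.2 * inner ℝ p.2 v.1.2 := fun v => fderiv_neg_cosNorm_tube _ v
        set c := sincNorm p.2 with hc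
        set d := cosNorm p.2 with hd'
        have e1 := h1 (radialVec p)
        have e2 : a₁ (p, 0) (radialVec p) = 0 := by
          rw [radialVec, hN.core p hp]
          simp [otForm]
          right; ring
        rw [e2, hd, mul_zero, add_zero] at e1
        -- With `c = sinc r` and `d = cos r`, the Hamiltonian equations give `a(X) = d` and `da(X,
        -- r∂_r) = c r²`, and `c r = sin r`.
        have e3 : (c + d) * a₁ (p, 0) X + c * dForm a₁ (p, 0) X (radialVec p) =
            1 + c * d := by
          rw [e1, h2]
          simp only [radialVec, real_inner_self_eq_norm_sq]
          have hcr : c * ‖p.2‖ = Real.sin ‖p.2‖ := by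
            rw [hc, sincNorm]
            rcases eq_or_ne ‖p.2‖ 0 with h0 | h0
            · simp [h0]
            · rw [Real.sinc_of_ne_zero h0]; field_simp
          have := Real.sin_sq_add_cos_sq ‖p.2‖
          rw [← hcr] at this
          have hdc : d = Real.cos ‖p.2‖ := rfl
          rw [← hdc] at this
          linear_combination this
        -- The same covector vanishes on vectors tangent to the core and, by `hN.radial`, on all
        -- `∂_{yⱼ₊₁}`. If `X` had no `y₀`-component, the positive number `1 + c d` would be zero.
        have e4 : (c + d) * a₁ (p, 0) X + c * dForm a₁ (p, 0) X (radialVec p) = 0 := by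
          rw [tube_eq_sum X, map_add, dForm_add_left, map_sum, dForm_sum_left, Fin.sum_univ_succ,
            Fin.sum_univ_succ]
          rw [hk0] at h3
          rw [h3]
          simp only [zero_smul, map_zero, zero_add, map_smul, smul_eq_mul, dForm_smul_left]
          rw [hN.core p hp]
          have e5 : dForm a₁ (p, 0) 0 (radialVec p) = 0 := by simp [dForm]
          have e6 := hN.dForm_core p hp X.1 (0, p.2)
          rw [show (((0, p.2), 0) : Tube n) = radialVec p from rfl] at e6
          have e7 : ∑ x : Fin n, X.2 x.succ * ((c + d) * a₁ (p, 0) (tubeVec x.succ) +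
              c * dForm a₁ (p, 0) (tubeVec x.succ) (radialVec p)) = 0 :=
            Finset.sum_eq_zero fun j _ => by rw [hN.radial p hp j, mul_zero]
          rw [e6]
          simp only [mul_add, Finset.sum_add_distrib] at e7
          have e8 : ∀ f : Fin n → ℝ, ∀ t : ℝ, t * ∑ x : Fin n, X.2 x.succ * f x =
              ∑ x : Fin n, X.2 x.succ * (t * f x) := fun f t => by
            rw [Finset.mul_sum]
            exact Finset.sum_congr rfl fun _ _ => by ring
          rw [← e8, ← e8] at e7
          have e9 : otForm p.2 X.1.2 = c * (p.2 0 * X.1.2 1 - p.2 1 * X.1.2 0) := rfl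
          rw [e9]
          simp only [wedge]
          linear_combination e7 + c * e5
        have := Real.one_add_sinc_mul_cos_pos (norm_nonneg p.2)
        have h4 : 1 + c * d = 0 := e3.symm.trans e4
        exact this.ne' h4
      · refine ⟨0, fun q => q.1.1 i, ?_, fun l q => ?_, fun l q => by simp,
          fun p hp X μ h1 _ => ?_, fun h0 => absurd (h0.symm.trans hi) (Fin.succ_ne_zero i).symm,
          fun j hj => ⟨rfl, ?_⟩⟩
        · fun_prop
        · have := hasFDerivAt_periodCoord (n := n) i
          rw [(this _).fderiv, (this _).fderiv]
        · have hd := hasFDerivAt_periodCoord (n := n) i (p, 0)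
          have e1 := h1 (periodVec i)
          rw [hd.fderiv] at e1
          have e2 : a₁ (p, 0) (periodVec i) = 0 := by
            rw [hf₁ _ (hg₁.core_mem p hp) hp (fun _ _ => rfl) _ (fun _ _ => rfl)]
            simp [periodVec, otForm]
          -- By the normalization, `da(·, ∂_{sᵢ})` reads off the `yᵢ₊₁`-component. Since `a(∂_{sᵢ})
          -- = 0` on the core, the Hamiltonian equation shows that this component is `dsᵢ(∂_{sᵢ}) =
          -- 1`.
          have e3 : dForm a₁ (p, 0) X (periodVec i) = X.2 i.succ := by
            conv_lhs => rw [tube_eq_sum X]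
            rw [dForm_add_left, hs₁ p hp, dForm_sum_left, Fin.sum_univ_succ]
            simp [dForm_smul_left, hz₁ p hp, ht₁ p hp]
          rw [e2, e3] at e1
          rw [hi]
          simp only [mul_zero, add_zero] at e1
          rw [e1]
          simp [periodVec, periodCoord_apply]
        · rw [Fin.succ_inj.1 (hi.symm.trans hj)]
    obtain ⟨Ω₂, Φ, a₂, hg₂, hr₂, hf₂, hd₂, hv₂⟩ := hg₁.step k hgs hgper hgκ hX
    have hd₂' : ∀ p : Cover n, p.2 ∈ diskPi → ∀ i u, kill k u = u →
        dForm a₂ (p, 0) u (periodVec i) = dForm a₁ (p, 0) u (periodVec i) := fun p hp i u hu => by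
      have := hd₂ p hp u (periodVec i)
      rwa [hu, hperiod] at this
    refine ⟨Ω₂, Ψ₁ ∘ Φ, a₂, hg₂, hr₁.trans hr₂ hg₁.isOpen hg₂.isOpen hg₂.core_mem,
      fun q hq hqD hq0 v hv0 => ?_, fun p hp i w => ?_, fun p hp i => ?_, fun p hp j i => ?_,
      fun h0 => absurd h0 (Nat.succ_ne_zero m)⟩
    · have hkill : ∀ u : Tube n, (∀ j : Fin (n + 1), m + 1 ≤ j → u.2 j = 0) →
          ∀ j : Fin (n + 1), m ≤ j → (kill k u).2 j = 0 := fun u hu j hj => by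
        rcases eq_or_ne j k with rfl | hjk
        · exact kill_snd_self _ u
        · rw [kill_snd_of_ne hjk]
          refine hu j (lt_of_le_of_ne hj fun hmj => hjk (Fin.ext hmj.symm))
      obtain ⟨hq1, hq2⟩ := hf₂ q hq
      rw [hq2, hf₁ _ hq1 (by simpa using hqD) (hkill q hq0) _ (hkill v hv0)]
      rcases Fin.eq_zero_or_eq_succ k with hk0 | ⟨i, hi⟩
      · obtain ⟨rfl, rfl⟩ := hgk0 hk0
        rw [hk0, kill_snd_self]
        simp only [kill_fst, kill_snd_of_ne (Fin.succ_ne_zero _)]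
        ring
      · obtain ⟨rfl, rfl⟩ := hgks i hi
        have hd := hasFDerivAt_periodCoord (n := n) i (kill k q)
        rw [hd.fderiv, hi, kill_snd_of_ne (Fin.succ_ne_zero i).symm]
        simp only [kill_fst]
        have e1 : ∀ j : Fin n, q.2 j.succ * v.1.1 j = (kill i.succ q).2 j.succ * v.1.1 j +
            if j = i then q.2 i.succ * v.1.1 i else 0 := fun j => by
          by_cases hji : j = i
          · subst hji
            simp [kill_snd_self]
          · rw [kill_snd_of_ne (fun hh => hji (Fin.succ_inj.1 hh))]
            simp [hji]
        rw [Finset.sum_congr rfl fun j _ => e1 j, Finset.sum_add_distrib, Finset.sum_ite_eq']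
        simp [periodCoord_apply]
        ring
    · rw [hd₂' p hp i _ (hcorevec w), hs₁ p hp]
    -- For the direction just straightened, `da₂(∂_{yₖ}, ∂_{sᵢ}) = dg(∂_{sᵢ})`: zero for `g = -cos
    -- r` here, and the Kronecker symbol for `g = sⱼ` in the next case. The normalization thus
    -- persists.
    · by_cases hk0 : 0 = k
      · have := hv₂ p hp (periodVec i)
        obtain ⟨-, rfl⟩ := hgk0 hk0.symm
        rw [hperiod, ← hk0] at this
        rw [this]
        rw [fderiv_neg_cosNorm_tube]
        simp [periodVec]
      · rw [hd₂' p hp i _ (hvec 0 hk0), hz₁ p hp]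
    · by_cases hj : j.succ = k
      · have := hv₂ p hp (periodVec i)
        obtain ⟨-, rfl⟩ := hgks j hj.symm
        rw [hperiod, ← hj] at this
        have hd := hasFDerivAt_periodCoord (n := n) j (p, 0)
        rw [this, hd.fderiv]
        simp [periodCoord_apply, periodVec, Pi.single_apply, eq_comm]
      · rw [hd₂' p hp i _ (hvec _ hj), ht₁ p hp]

end HamiltonianStep

/-! ### Local additions -/

section LocalAddition

open Set

variable {d : ℕ} {M : Type*} [TopologicalSpace M] [ChartedSpace (EuclideanSpace ℝ (Fin d)) M]

/-- `Θ` is a smooth family of self-maps of `M` parametrised by the vector space `F`, equal to the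
identity for the parameter `0`, whose velocities at the parameter `0` span the tangent spaces of `M`
at the points of `K`. -/
structure IsLocalAddition {F : Type*} [NormedAddCommGroup F] [NormedSpace ℝ F]
    (Θ : M × F → M) (K : Set M) : Prop where
  contMDiff : ContMDiff ((𝓡 d).prod 𝓘(ℝ, F)) (𝓡 d) ∞ Θ
  zero : ∀ p, Θ (p, 0) = p
  surjective : ∀ p ∈ K, Function.Surjective (mfderiv 𝓘(ℝ, F) (𝓡 d) (fun u => Θ (p, u)) 0)

theorem IsLocalAddition.mono {F : Type*} [NormedAddCommGroup F] [NormedSpace ℝ F]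
    {Θ : M × F → M} {K K' : Set M} (h : IsLocalAddition (d := d) Θ K) (hK : K' ⊆ K) :
    IsLocalAddition (d := d) Θ K' :=
  ⟨h.contMDiff, h.zero, fun p hp => h.surjective p (hK hp)⟩

/-- Composing the two families works because each is the identity at parameter `0`: the partial
velocities of the composite at `0` are those of `Θ₁` and of `Θ₂`, so each family spans over its own
set. -/
theorem IsLocalAddition.union {F₁ F₂ : Type*} [NormedAddCommGroup F₁] [NormedSpace ℝ F₁]
    [NormedAddCommGroup F₂] [NormedSpace ℝ F₂] {Θ₁ : M × F₁ → M} {Θ₂ : M × F₂ → M} {K₁ K₂ : Set M}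
    (h₁ : IsLocalAddition (d := d) Θ₁ K₁) (h₂ : IsLocalAddition (d := d) Θ₂ K₂) :
    IsLocalAddition (d := d) (fun z : M × F₁ × F₂ => Θ₂ (Θ₁ (z.1, z.2.1), z.2.2)) (K₁ ∪ K₂) := by
  have hs : ContMDiff ((𝓡 d).prod 𝓘(ℝ, F₁ × F₂)) (𝓡 d) ∞
      (fun z : M × F₁ × F₂ => Θ₂ (Θ₁ (z.1, z.2.1), z.2.2)) := by
    have hf : ContMDiff ((𝓡 d).prod 𝓘(ℝ, F₁ × F₂)) 𝓘(ℝ, F₁) ∞ (fun z : M × F₁ × F₂ => z.2.1) :=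
      (contDiff_fst (𝕜 := ℝ) (E := F₁) (F := F₂) (n := ∞)).contMDiff.comp contMDiff_snd
    have hg : ContMDiff ((𝓡 d).prod 𝓘(ℝ, F₁ × F₂)) 𝓘(ℝ, F₂) ∞ (fun z : M × F₁ × F₂ => z.2.2) :=
      (contDiff_snd (𝕜 := ℝ) (E := F₁) (F := F₂) (n := ∞)).contMDiff.comp contMDiff_snd
    exact h₂.contMDiff.comp ((h₁.contMDiff.comp (contMDiff_fst.prodMk hf)).prodMk hg)
  refine ⟨hs, fun p => ?_, fun p hp => ?_⟩
  · simp only [Prod.fst_zero, Prod.snd_zero, h₁.zero, h₂.zero]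
  have hd : MDifferentiableAt 𝓘(ℝ, F₁ × F₂) (𝓡 d)
      (fun u : F₁ × F₂ => Θ₂ (Θ₁ (p, u.1), u.2)) 0 :=
    (hs.comp (contMDiff_const.prodMk contMDiff_id)).mdifferentiableAt (by simp)
  rcases hp with hp | hp
  · have e1 : (fun u : F₁ => Θ₁ (p, u)) =
        (fun u : F₁ × F₂ => Θ₂ (Θ₁ (p, u.1), u.2)) ∘ ContinuousLinearMap.inl ℝ F₁ F₂ := by
      ext u; simp [h₂.zero]
    have e2 := h₁.surjective p hp
    have e3 : HasMFDerivAt 𝓘(ℝ, F₁) 𝓘(ℝ, F₁ × F₂) (ContinuousLinearMap.inl ℝ F₁ F₂) 0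
        (ContinuousLinearMap.inl ℝ F₁ F₂) := (ContinuousLinearMap.hasFDerivAt _).hasMFDerivAt
    rw [e1, (HasMFDerivAt.comp (0 : F₁) (by rw [map_zero]; exact hd.hasMFDerivAt) e3).mfderiv] at e2
    exact Function.Surjective.of_comp e2
  · have e1 : (fun u : F₂ => Θ₂ (p, u)) =
        (fun u : F₁ × F₂ => Θ₂ (Θ₁ (p, u.1), u.2)) ∘ ContinuousLinearMap.inr ℝ F₁ F₂ := by
      ext u; simp [h₁.zero]
    have e2 := h₂.surjective p hp
    have e3 : HasMFDerivAt 𝓘(ℝ, F₂) 𝓘(ℝ, F₁ × F₂) (ContinuousLinearMap.inr ℝ F₁ F₂) 0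
        (ContinuousLinearMap.inr ℝ F₁ F₂) := (ContinuousLinearMap.hasFDerivAt _).hasMFDerivAt
    rw [e1, (HasMFDerivAt.comp (0 : F₂) (by rw [map_zero]; exact hd.hasMFDerivAt) e3).mfderiv] at e2
    exact Function.Surjective.of_comp e2

/-- Translate in a chart by a vector damped by a bump function, and by the identity outside its
support. On the set where the bump equals `1` the velocities are those of all translations of the
chart. -/
theorem exists_isLocalAddition_nhds [T2Space M] [IsManifold (𝓡 d) ∞ M] (p₀ : M) :
    ∃ Θ : M × EuclideanSpace ℝ (Fin d) → M, ∃ K ∈ 𝓝 p₀, IsLocalAddition (d := d) Θ K := by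
  set E := EuclideanSpace ℝ (Fin d)
  set φ := extChartAt (𝓡 d) p₀ with hφ
  let χ : SmoothBumpFunction (𝓡 d) p₀ := Classical.arbitrary _
  have hsupp : tsupport χ ⊆ φ.source := by
    rw [hφ, extChartAt_source]; exact χ.tsupport_subset_chartAt_source
  have hcomp : IsCompact (φ '' tsupport χ) :=
    χ.hasCompactSupport.isCompact.image_of_continuousOn
      ((continuousOn_extChartAt p₀).mono hsupp)
  have htar : IsOpen φ.target := isOpen_extChartAt_target p₀
  obtain ⟨ε, hε, hεt⟩ := hcomp.exists_thickening_subset_open htar (by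
    rintro _ ⟨q, hq, rfl⟩; exact φ.map_source (hsupp hq))
  let ψ : ContDiffBump (0 : E) := ⟨ε / 2, ε, by positivity, by linarith⟩
  -- A bounded truncation of the identity: `‖β u‖ < ε` keeps the translated points inside the chart
  -- target, and `β` agrees with the identity near `0`.
  let β : E → E := fun u => ψ u • u
  have hβs : ContDiff ℝ ∞ β := ψ.contDiff.smul contDiff_id
  have hβ : ∀ u, ‖β u‖ < ε := fun u => by
    by_cases hu : u ∈ Metric.ball (0 : E) ε
    · refine lt_of_le_of_lt ?_ (mem_ball_zero_iff.1 hu)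
      rw [norm_smul, Real.norm_of_nonneg ψ.nonneg]
      exact mul_le_of_le_one_left (norm_nonneg _) ψ.le_one
    · have : ψ u = 0 := by
        rw [← Function.notMem_support, ψ.support_eq]; exact hu
      simp [β, this, hε]
  have hβid : β =ᶠ[𝓝 0] id := by
    filter_upwards [ψ.eventuallyEq_one] with u hu
    simp only [β, hu, Pi.one_apply, one_smul, id]
  have hχ0 : ∀ q, q ∉ tsupport χ → χ q = 0 := fun q hq => image_eq_zero_of_notMem_tsupport hq
  have hmem : ∀ q ∈ φ.source, ∀ u, φ q + χ q • β u ∈ φ.target := fun q hq u => by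
    by_cases hqs : q ∈ tsupport χ
    · refine hεt (Metric.mem_thickening_iff.2 ⟨φ q, mem_image_of_mem _ hqs, ?_⟩)
      rw [dist_eq_norm, add_sub_cancel_left, norm_smul, Real.norm_of_nonneg χ.nonneg]
      exact lt_of_le_of_lt (mul_le_of_le_one_left (norm_nonneg _) χ.le_one) (hβ u)
    · rw [hχ0 q hqs, zero_smul, add_zero]; exact φ.map_source hq
  classical
  let Θ : M × E → M := fun z => if z.1 ∈ φ.source then φ.symm (φ z.1 + χ z.1 • β z.2) else z.1
  have hΘ1 : ∀ z : M × E, z.1 ∈ φ.source → Θ z = φ.symm (φ z.1 + χ z.1 • β z.2) :=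
    fun z hz => if_pos hz
  have hΘ2 : ∀ z : M × E, z.1 ∉ tsupport χ → Θ z = z.1 := fun z hz => by
    by_cases hzs : z.1 ∈ φ.source
    · rw [hΘ1 z hzs, hχ0 _ hz, zero_smul, add_zero, φ.left_inv hzs]
    · exact if_neg hzs
  have hso : IsOpen φ.source := isOpen_extChartAt_source p₀
  have hΘs : ContMDiff ((𝓡 d).prod 𝓘(ℝ, E)) (𝓡 d) ∞ Θ := by
    intro z
    by_cases hz : z.1 ∈ tsupport χ
    · have hzs := hsupp hz
      have h1 : ContMDiffAt ((𝓡 d).prod 𝓘(ℝ, E)) 𝓘(ℝ, E) ∞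
          (fun z : M × E => φ z.1 + χ z.1 • β z.2) z := by
        have h2 : ContMDiffAt (𝓡 d) 𝓘(ℝ, E) ∞ φ z.1 :=
          contMDiffAt_extChartAt' (by rwa [hφ, extChartAt_source] at hzs)
        have h3 : ContMDiffAt ((𝓡 d).prod 𝓘(ℝ, E)) 𝓘(ℝ, E) ∞
          (fun z : M × E => φ z.1) z := h2.comp z contMDiffAt_fst
        have h4 : ContMDiffAt ((𝓡 d).prod 𝓘(ℝ, E)) 𝓘(ℝ, ℝ) ∞
          (fun z : M × E => χ z.1) z := (χ.contMDiffAt (x := z.1)).comp z contMDiffAt_fst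
        have h5 : ContMDiffAt ((𝓡 d).prod 𝓘(ℝ, E)) 𝓘(ℝ, E) ∞
          (fun z : M × E => β z.2) z := hβs.contMDiff.contMDiffAt.comp z contMDiffAt_snd
        exact h3.add (h4.smul h5)
      have h6 : ContMDiffAt 𝓘(ℝ, E) (𝓡 d) ∞ φ.symm (φ z.1 + χ z.1 • β z.2) :=
        (contMDiffOn_extChartAt_symm p₀).contMDiffAt (htar.mem_nhds (hmem z.1 hzs z.2))
      refine (h6.comp z h1).congr_of_eventuallyEq ?_
      filter_upwards [(hso.preimage continuous_fst).mem_nhds hzs] with y hy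
      exact hΘ1 y hy
    · refine contMDiffAt_fst.congr_of_eventuallyEq ?_
      have : IsOpen {z : M × E | z.1 ∉ tsupport χ} :=
        (isClosed_tsupport χ).isOpen_compl.preimage continuous_fst
      filter_upwards [this.mem_nhds hz] with y hy
      exact hΘ2 y hy
  refine ⟨Θ, {q | q ∈ φ.source ∧ χ q = 1}, ?_, hΘs, fun p => ?_, fun p hp => ?_⟩
  · filter_upwards [χ.eventuallyEq_one, extChartAt_source_mem_nhds (I := 𝓡 d) p₀] with q h1 h2
    exact ⟨h2, h1⟩
  · by_cases hp : p ∈ φ.source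
    · rw [hΘ1 _ hp]
      simp [β, φ.left_inv hp]
    · exact if_neg hp
  · have e1 : (fun u => Θ (p, u)) =ᶠ[𝓝 0] fun u => φ.symm (φ p + u) := by
      filter_upwards [hβid] with u hu
      rw [hΘ1 _ hp.1]
      simp only [hp.2, one_smul, hu, id]
    rw [e1.mfderiv_eq]
    have h6 : MDifferentiableAt 𝓘(ℝ, E) (𝓡 d) φ.symm (φ p + 0) := by
      rw [add_zero]
      exact ((contMDiffOn_extChartAt_symm (n := ∞) p₀).contMDiffAt
        (htar.mem_nhds (φ.map_source hp.1))).mdifferentiableAt (by simp)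
    have h7 : HasMFDerivAt 𝓘(ℝ, E) 𝓘(ℝ, E) (fun u : E => φ p + u) 0 (ContinuousLinearMap.id ℝ E) :=
      ((hasFDerivAt_id (0 : E)).const_add (φ p)).hasMFDerivAt
    have h8 := (h6.hasMFDerivAt.comp (0 : E) h7).mfderiv
    have h9 : mfderiv 𝓘(ℝ, E) (𝓡 d) (fun u => φ.symm (φ p + u)) 0 = _ := h8
    rw [h9, add_zero]
    have h10 := isInvertible_mfderivWithin_extChartAt_symm (I := 𝓡 d) (x := p₀)
      (φ.map_source hp.1)
    rw [ModelWithCorners.range_eq_univ, mfderivWithin_univ] at h10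
    exact h10.bijective.surjective

/-- Finitely many local families cover `K` and are composed. The result plays the role of an
exponential map in the construction of a tubular neighbourhood, with a parameter space that may be
larger than the tangent spaces. -/
theorem exists_isLocalAddition [T2Space M] [IsManifold (𝓡 d) ∞ M] {K : Set M} (hK : IsCompact K) :
    ∃ (F : Type) (_ : NormedAddCommGroup F) (_ : NormedSpace ℝ F) (_ : FiniteDimensional ℝ F)
      (Θ : M × F → M), IsLocalAddition (d := d) Θ K := by
  refine hK.induction_on (p := fun K => ∃ (F : Type) (_ : NormedAddCommGroup F)
    (_ : NormedSpace ℝ F) (_ : FiniteDimensional ℝ F) (Θ : M × F → M),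
    IsLocalAddition (d := d) Θ K) ?_ ?_ ?_ ?_
  · exact ⟨ℝ, inferInstance, inferInstance, inferInstance, fun z => z.1, contMDiff_fst,
      fun _ => rfl, fun p hp => absurd hp (notMem_empty p)⟩
  · rintro _ _ hst ⟨F, i₁, i₂, i₃, Θ, h⟩
    exact ⟨F, i₁, i₂, i₃, Θ, h.mono hst⟩
  · rintro _ _ ⟨F, i₁, i₂, i₃, Θ, h⟩ ⟨F', i₁', i₂', i₃', Θ', h'⟩
    exact ⟨F × F', inferInstance, inferInstance, inferInstance, _, h.union h'⟩
  · intro p _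
    obtain ⟨Θ, t, ht, h⟩ := exists_isLocalAddition_nhds (d := d) p
    exact ⟨t, mem_nhdsWithin_of_mem_nhds ht, _, inferInstance, inferInstance, inferInstance, Θ, h⟩

end LocalAddition

/-! ### The universal covering of the plastikstufe -/

section TorusCover

open Set

variable {n : ℕ}

/-- After composition with the inclusion into `ℂ` the derivative is multiplication by `i e^{it} ≠
0`. -/
theorem Circle.mfderiv_exp_injective (t : ℝ) :
    Function.Injective (mfderiv 𝓘(ℝ, ℝ) (𝓡 1) Circle.exp t) := by
  have h1 : HasMFDerivAt 𝓘(ℝ, ℝ) (𝓡 1) Circle.exp t _ :=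
    (contMDiff_circleExp (m := 1)).mdifferentiableAt one_ne_zero |>.hasMFDerivAt
  have : Fact (Module.finrank ℝ ℂ = 1 + 1) := finrank_real_complex_fact'
  have h2 : MDifferentiableAt (𝓡 1) 𝓘(ℝ, ℂ) (fun z : Circle => (z : ℂ)) (Circle.exp t) :=
    ContMDiff.mdifferentiableAt (n := 1) contMDiff_coe_sphere one_ne_zero
  have h3 := h2.hasMFDerivAt.comp t h1
  have h4 : HasDerivAt (fun s : ℝ => Complex.exp (s * Complex.I))
      (Complex.exp (t * Complex.I) * (1 * Complex.I)) t :=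
    (Complex.hasDerivAt_exp _).comp t ((Complex.ofRealCLM.hasDerivAt).mul_const _)
  have h5 := hasMFDerivAt_unique h3 h4.hasFDerivAt.hasMFDerivAt
  have h6 : Function.Injective
      ((mfderiv (𝓡 1) 𝓘(ℝ, ℂ) (fun z : Circle => (z : ℂ)) (Circle.exp t)) ∘
        (mfderiv 𝓘(ℝ, ℝ) (𝓡 1) Circle.exp t)) := by
    rw [← ContinuousLinearMap.coe_comp, h5]
    exact smul_left_injective ℝ (M := ℂ)
      (by simp [Complex.exp_ne_zero] : Complex.exp (t * Complex.I) * (1 * Complex.I) ≠ 0)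
  exact h6.of_comp

/-- The covering map `ℝⁿ → 𝕋ⁿ`. -/
def torusExp (s : Fin n → ℝ) : Torus n := fun j => Circle.exp (s j)

theorem continuous_torusExp : Continuous (torusExp : (Fin n → ℝ) → Torus n) :=
  continuous_pi fun j => Circle.exp.continuous.comp (continuous_apply j)

theorem torusExp_eq_iff {s s' : Fin n → ℝ} :
    torusExp s = torusExp s' ↔ ∃ l : Fin n → ℤ, s = s' + latticeVec l := by
  constructor
  · intro h
    have := fun j => Circle.exp_eq_exp.1 (congrFun h j)
    choose l hl using this
    refine ⟨l, funext fun j => ?_⟩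
    rw [hl j, Pi.add_apply, latticeVec]
    ring
  · rintro ⟨l, rfl⟩
    refine funext fun j => Circle.exp_eq_exp.2 ⟨l j, ?_⟩
    rw [Pi.add_apply, latticeVec]
    ring

theorem torusExp_add_latticeVec (s : Fin n → ℝ) (l : Fin n → ℤ) :
    torusExp (s + latticeVec l) = torusExp s := torusExp_eq_iff.2 ⟨l, rfl⟩

theorem contDiffAt_extChartAt_exp (t : ℝ) :
    ContDiffAt ℝ ∞ (fun r => extChartAt (𝓡 1) (Circle.exp t) (Circle.exp r)) t :=
  contMDiffAt_iff_contDiffAt.1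
    ((contMDiffAt_extChartAt (I := 𝓡 1) (n := ∞) (x := Circle.exp t)).comp t
      (contMDiff_circleExp (m := ∞) t))

theorem contDiffAt_torusExp_coord (s : Fin n → ℝ) (j : Fin n) :
    ContDiffAt ℝ ∞ (fun r : Fin n → ℝ => extChartAt (𝓡 1) (Circle.exp (s j)) (Circle.exp (r j))) s :=
  ContDiffAt.comp (g := fun r => extChartAt (𝓡 1) (Circle.exp (s j)) (Circle.exp r)) s
    (contDiffAt_extChartAt_exp (s j)) (contDiff_apply ℝ ℝ j).contDiffAt

theorem contMDiff_torusExp :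
    ContMDiff 𝓘(ℝ, Fin n → ℝ) (torusModel n) ∞ (torusExp : (Fin n → ℝ) → Torus n) := by
  intro s
  rw [contMDiffAt_iff]
  refine ⟨continuous_torusExp.continuousAt, contDiffWithinAt_pi.2 fun j => ?_⟩
  exact (contDiffAt_torusExp_coord s j).contDiffWithinAt

theorem mfderiv_torusExp_injective (s : Fin n → ℝ) :
    Function.Injective (mfderiv 𝓘(ℝ, Fin n → ℝ) (torusModel n) torusExp s) := by
  have h := (contMDiff_torusExp s).mdifferentiableAt (by simp) |>.hasMFDerivAt
  have h1 := (hasFDerivWithinAt_pi'.1 h.2)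
  refine (injective_iff_map_eq_zero _).2 fun v hv => funext fun j => ?_
  have h2 : HasFDerivWithinAt (fun r : Fin n → ℝ =>
      extChartAt (𝓡 1) (Circle.exp (s j)) (Circle.exp (r j))) _ (range 𝓘(ℝ, Fin n → ℝ)) s := h1 j
  rw [ModelWithCorners.range_eq_univ, hasFDerivWithinAt_univ] at h2
  have h3 := (contDiffAt_extChartAt_exp (s j)).differentiableAt (by simp) |>.hasFDerivAt
  have h4 := h2.unique (HasFDerivAt.comp (f := fun r : Fin n → ℝ => r j) s h3
    (ContinuousLinearMap.proj (R := ℝ) (φ := fun _ : Fin n => ℝ) j).hasFDerivAt)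
  have h5 := congrArg (fun L => L v) h4
  have h6 := ((mdifferentiableAt_extChartAt (I := 𝓡 1) (mem_chart_source _ _)).hasMFDerivAt.comp
    (s j) ((contMDiff_circleExp (m := ∞) (s j)).mdifferentiableAt (by simp)).hasMFDerivAt)
  have h7 := hasMFDerivAt_unique h6 h3.hasMFDerivAt
  have h8 := (isInvertible_mfderiv_extChartAt (I := 𝓡 1)
    (mem_extChartAt_source (I := 𝓡 1) (Circle.exp (s j)))).bijective.injective.comp
    (Circle.mfderiv_exp_injective (s j))
  rw [← ContinuousLinearMap.coe_comp, h7] at h8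
  refine (injective_iff_map_eq_zero _).1 h8 (v j) (h5.symm.trans ?_)
  exact congrFun hv j

variable {d : ℕ} {M : Type*} [TopologicalSpace M] [ChartedSpace (EuclideanSpace ℝ (Fin d)) M]

/-- `f` is the lift to `ℝⁿ × 𝔻²` of an embedding of `𝕋ⁿ × 𝔻²` on which `ξ` induces the singular
distribution `ker (r sin r dϑ)`. -/
structure IsLiftedPlastikstufe (ξ : (p : M) → Submodule ℝ (TangentSpace (𝓡 d) p))
    (f : Cover n → M) (U : Set (Cover n)) : Prop where
  isOpen : IsOpen U
  shift_mem : ∀ (l : Fin n → ℤ), ∀ p ∈ U, p + shiftCover l ∈ U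
  core_mem : ∀ p : Cover n, p.2 ∈ diskPi → p ∈ U
  contMDiffOn : ContMDiffOn 𝓘(ℝ, Cover n) (𝓡 d) ∞ f U
  periodic : ∀ (l : Fin n → ℤ) p, f (p + shiftCover l) = f p
  injective : ∀ p p' : Cover n, p.2 ∈ diskPi → p'.2 ∈ diskPi → f p = f p' →
    ∃ l : Fin n → ℤ, p = p' + shiftCover l
  immersive : ∀ p : Cover n, p.2 ∈ diskPi →
    Function.Injective (mfderiv 𝓘(ℝ, Cover n) (𝓡 d) f p)
  distribution : ∀ p : Cover n, p.2 ∈ diskPi → ∀ v : Cover n,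
    mfderiv 𝓘(ℝ, Cover n) (𝓡 d) f p v ∈ ξ (f p) ↔ otForm p.2 v.2 = 0

/-- Precompose with the covering `ℝⁿ → 𝕋ⁿ`, an immersion whose fibres are lattice orbits;
embeddedness becomes injectivity modulo the lattice. -/
theorem IsToricPlastikstufe.exists_lift {M : Type*} [TopologicalSpace M]
    [ChartedSpace (EuclideanSpace ℝ (Fin (2 * n + 3))) M]
    {ξ : (p : M) → Submodule ℝ (TangentSpace (𝓡 (2 * n + 3)) p)} {f : Plane × Torus n → M}
    (h : IsToricPlastikstufe ξ f) :
    ∃ (f' : Cover n → M) (U : Set (Cover n)), IsLiftedPlastikstufe ξ f' U := by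
  obtain ⟨W, hW, hKW, hf⟩ := h.embedding.smooth
  set c : Cover n → Plane × Torus n := fun p => (p.2, torusExp p.1) with hc
  have hfst : ContMDiff 𝓘(ℝ, Cover n) 𝓘(ℝ, Fin n → ℝ) ∞ (Prod.fst : Cover n → _) :=
    contDiff_fst.contMDiff
  have hsnd : ContMDiff 𝓘(ℝ, Cover n) 𝓘(ℝ, Plane) ∞ (Prod.snd : Cover n → _) :=
    contDiff_snd.contMDiff
  have hcs : ContMDiff 𝓘(ℝ, Cover n) (𝓘(ℝ, Plane).prod (torusModel n)) ∞ c :=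
    hsnd.prodMk (contMDiff_torusExp.comp hfst)
  have hcl : ∀ (l : Fin n → ℤ) p, c (p + shiftCover l) = c p := fun l p => by
    simp [hc, shiftCover, torusExp_add_latticeVec]
  have hcD : ∀ p : Cover n, p.2 ∈ diskPi → c p ∈ diskPi ×ˢ (univ : Set (Torus n)) := fun p hp =>
    ⟨hp, mem_univ _⟩
  have hcder : ∀ p v, mfderiv 𝓘(ℝ, Cover n) (𝓘(ℝ, Plane).prod (torusModel n)) c p v =
      (v.2, mfderiv 𝓘(ℝ, Fin n → ℝ) (torusModel n) torusExp p.1 v.1) := fun p v => by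
    have e1 : HasMFDerivAt 𝓘(ℝ, Cover n) 𝓘(ℝ, Plane) (Prod.snd : Cover n → _) p
      (ContinuousLinearMap.snd ℝ (Fin n → ℝ) Plane) := hasFDerivAt_snd.hasMFDerivAt
    have e2 : HasMFDerivAt 𝓘(ℝ, Cover n) 𝓘(ℝ, Fin n → ℝ) (Prod.fst : Cover n → _) p
      (ContinuousLinearMap.fst ℝ (Fin n → ℝ) Plane) := hasFDerivAt_fst.hasMFDerivAt
    have e3 := ((contMDiff_torusExp p.1).mdifferentiableAt (by simp)).hasMFDerivAt
    have e4 := (e1.prodMk (e3.comp p e2)).mfderiv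
    exact congrArg (fun L => L v) e4
  have hfd : ∀ p : Cover n, p.2 ∈ diskPi →
      mfderiv 𝓘(ℝ, Cover n) (𝓡 (2 * n + 3)) (f ∘ c) p =
      (mfderiv (𝓘(ℝ, Plane).prod (torusModel n)) (𝓡 (2 * n + 3)) f (c p)).comp
        (mfderiv 𝓘(ℝ, Cover n) (𝓘(ℝ, Plane).prod (torusModel n)) c p) := fun p hp =>
    mfderiv_comp p ((hf.contMDiffAt (hW.mem_nhds (hKW (hcD p hp)))).mdifferentiableAt (by simp))
      ((hcs p).mdifferentiableAt (by simp))
  refine ⟨f ∘ c, c ⁻¹' W, hW.preimage hcs.continuous, fun l p hp => ?_, fun p hp => hKW (hcD p hp),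
    hf.comp hcs.contMDiffOn fun p hp => hp, fun l p => ?_, fun p p' hp hp' hpp => ?_,
    fun p hp => ?_, fun p hp v => ?_⟩
  · rwa [mem_preimage, hcl]
  · rw [Function.comp_apply, hcl, Function.comp_apply]
  · have e1 := h.embedding.isEmbedding.injective
      (a₁ := ⟨c p, hcD p hp⟩) (a₂ := ⟨c p', hcD p' hp'⟩) hpp
    have e2 : c p = c p' := congrArg Subtype.val e1
    obtain ⟨l, hl⟩ := torusExp_eq_iff.1 (congrArg Prod.snd e2)
    refine ⟨l, Prod.ext hl ?_⟩
    simpa [shiftCover] using congrArg Prod.fst e2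
  · rw [hfd p hp, ContinuousLinearMap.coe_comp]
    refine (h.embedding.immersive _ (hcD p hp)).comp fun v v' hvv => ?_
    rw [hcder, hcder] at hvv
    exact Prod.ext (mfderiv_torusExp_injective _ (congrArg Prod.snd hvv)) (congrArg Prod.fst hvv)
  · have := h.distribution _ (hcD p hp)
      (mfderiv 𝓘(ℝ, Cover n) (𝓘(ℝ, Plane).prod (torusModel n)) c p v)
    rw [hfd p hp]
    have e1 := congrArg Prod.fst (hcder p v)
    exact this.trans (by rw [show Prod.fst (mfderiv 𝓘(ℝ, Cover n)
      (𝓘(ℝ, Plane).prod (torusModel n)) c p v) = v.2 from e1])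

end TorusCover

/-! ### Local contact forms -/

section LocalForms

open Set

/-- The form `dα` is nondegenerate on the hyperplane `ker α`, so a subspace contained in its own
orthogonal has at most half the dimension of that hyperplane. -/
theorem ContactAt.two_mul_finrank_lt {V W : Type*} [NormedAddCommGroup V] [NormedSpace ℝ V]
    [FiniteDimensional ℝ V] [AddCommGroup W] [Module ℝ W] {α : V → V →L[ℝ] ℝ} {y : V}
    (h : ContactAt α y) {j : W →ₗ[ℝ] V} (hj : Function.Injective j) (h0 : ∀ w, α y (j w) = 0)
    (h1 : ∀ w w', dForm α y (j w) (j w') = 0) :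
    2 * Module.finrank ℝ W < Module.finrank ℝ V := by
  set K : Submodule ℝ V := LinearMap.ker (α y : V →ₗ[ℝ] ℝ) with hK
  have hKd : Module.finrank ℝ K + 1 = Module.finrank ℝ V :=
    Module.Dual.finrank_ker_add_one_of_ne_zero
      (f := (α y : V →ₗ[ℝ] ℝ)) (fun h2 => h.1 (ContinuousLinearMap.coe_injective h2))
  let B : LinearMap.BilinForm ℝ K :=
    LinearMap.mk₂ ℝ (fun u v : K => dForm α y u v) (fun u u' v => dForm_add_left _ _ _ _ _)
      (fun c u v => dForm_smul_left _ _ _ _ _) (fun u v v' => dForm_add_right _ _ _ _ _)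
      (fun c u v => dForm_smul_right _ _ _ _ _)
  have hB : ∀ u v, B u v = dForm α y u v := fun _ _ => rfl
  have hrefl : B.IsRefl := fun u v huv => by
    rw [hB] at huv ⊢
    rw [dForm_swap, huv, neg_zero]
  have hnd : B.Nondegenerate := by
    refine hrefl.nondegenerate_iff_separatingLeft.2 fun u hu => ?_
    exact Subtype.ext (h.2 u u.2 fun v hv => hu ⟨v, hv⟩)
  let j' : W →ₗ[ℝ] K := j.codRestrict K h0
  have hj' : Function.Injective j' := fun w w' hw => hj (congrArg Subtype.val hw)
  have hle : LinearMap.range j' ≤ B.orthogonal (LinearMap.range j') := by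
    rintro _ ⟨w, rfl⟩ _ ⟨w', rfl⟩
    exact h1 w' w
  have h2 := Submodule.finrank_mono hle
  rw [LinearMap.BilinForm.finrank_orthogonal hnd, LinearMap.finrank_range_of_inj hj'] at h2
  have h3 := LinearMap.finrank_le_finrank_of_injective hj'
  omega

variable {d : ℕ} {M : Type*} [TopologicalSpace M] [ChartedSpace (EuclideanSpace ℝ (Fin d)) M]
  {E : Type*} [NormedAddCommGroup E] [NormedSpace ℝ E]

/-- In the open set `O` the field of subspaces `(DG)⁻¹(ξ)` is the kernel of the pullback by `Γ` of
the contact form `α`; the map `Γ` is `G` read in a chart of `M`. -/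
structure IsLocalContactModel (ξ : (p : M) → Submodule ℝ (TangentSpace (𝓡 d) p)) (G : E → M)
    (O : Set E) (Γ : E → EuclideanSpace ℝ (Fin d))
    (α : EuclideanSpace ℝ (Fin d) → EuclideanSpace ℝ (Fin d) →L[ℝ] ℝ) : Prop where
  isOpen : IsOpen O
  contDiffOn : ContDiffOn ℝ ∞ Γ O
  contDiffOn_pull : ContDiffOn ℝ ∞ (pullForm Γ α) O
  differentiableAt : ∀ q ∈ O, DifferentiableAt ℝ α (Γ q)
  contact : ∀ q ∈ O, ContactAt α (Γ q)
  mem_iff : ∀ q ∈ O, ∀ v : E, mfderiv 𝓘(ℝ, E) (𝓡 d) G q v ∈ ξ (G q) ↔ pullForm Γ α q v = 0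
  fderiv_eq_zero_iff : ∀ q ∈ O, ∀ v : E,
    fderiv ℝ Γ q v = 0 ↔ mfderiv 𝓘(ℝ, E) (𝓡 d) G q v = 0
  surjective : ∀ q ∈ O, Function.Surjective (mfderiv 𝓘(ℝ, E) (𝓡 d) G q) →
    Function.Surjective (fderiv ℝ Γ q)

/-- Read `G` in the chart at `G q₀` that carries the contact form. Chart differentials are
bijective, so kernel and surjectivity statements pass between `Γ` and `G`. -/
theorem IsContactStructure.exists_localContactModel [IsManifold (𝓡 d) ∞ M]
    {ξ : (p : M) → Submodule ℝ (TangentSpace (𝓡 d) p)} (hξ : IsContactStructure ξ) {G : E → M}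
    {U : Set E} (hU : IsOpen U) (hG : ContMDiffOn 𝓘(ℝ, E) (𝓡 d) ∞ G U) {q₀ : E} (hq₀ : q₀ ∈ U) :
    ∃ O Γ α, q₀ ∈ O ∧ O ⊆ U ∧ IsLocalContactModel ξ G O Γ α := by
  obtain ⟨V, α, hV, hpV, hVt, hα, hker⟩ := hξ (G q₀)
  set φ := extChartAt (𝓡 d) (G q₀) with hφ
  have hφo : IsOpen φ.source := isOpen_extChartAt_source _
  set S : Set M := φ.source ∩ φ ⁻¹' V with hS
  have hSo : IsOpen S := (continuousOn_extChartAt _).isOpen_inter_preimage hφo hV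
  set O : Set E := U ∩ G ⁻¹' S with hO
  have hOo : IsOpen O := hG.continuousOn.isOpen_inter_preimage hU hSo
  have hGat : ∀ q ∈ O, ContMDiffAt 𝓘(ℝ, E) (𝓡 d) ∞ G q := fun q hq =>
    hG.contMDiffAt (hU.mem_nhds hq.1)
  have hφat : ∀ q ∈ O, ContMDiffAt (𝓡 d) 𝓘(ℝ, EuclideanSpace ℝ (Fin d)) ∞ φ (G q) := fun q hq =>
    contMDiffAt_extChartAt' (by have := hq.2.1; rwa [hφ, extChartAt_source] at this)
  have hΓ : ContDiffOn ℝ ∞ (φ ∘ G) O := fun q hq =>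
    (contMDiffAt_iff_contDiffAt.1 ((hφat q hq).comp q (hGat q hq))).contDiffWithinAt
  have hder : ∀ q ∈ O, ∀ v : E, fderiv ℝ (φ ∘ G) q v =
      mfderiv (𝓡 d) 𝓘(ℝ, EuclideanSpace ℝ (Fin d)) φ (G q) (mfderiv 𝓘(ℝ, E) (𝓡 d) G q v) :=
    fun q hq v => by
      have e1 := mfderiv_comp q ((hφat q hq).mdifferentiableAt (by simp))
        ((hGat q hq).mdifferentiableAt (by simp))
      rw [mfderiv_eq_fderiv] at e1
      exact congrArg (fun L => L v) e1
  have hinv : ∀ q ∈ O, Function.Bijective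
      (mfderiv (𝓡 d) 𝓘(ℝ, EuclideanSpace ℝ (Fin d)) φ (G q)) := fun q hq =>
    (isInvertible_mfderiv_extChartAt (I := 𝓡 d) hq.2.1).bijective
  refine ⟨O, φ ∘ G, α, ⟨hq₀, mem_extChartAt_source _, hpV⟩, inter_subset_left, hOo, hΓ,
    hΓ.pullForm hOo hα.contDiffOn fun q hq => hq.2.2, fun q hq =>
    (hα.contDiffOn.contDiffAt (hV.mem_nhds hq.2.2)).differentiableAt (by simp), fun q hq =>
    ⟨hα.ne_zero _ hq.2.2, hα.nondegenerate _ hq.2.2⟩, fun q hq v => ?_, fun q hq v => ?_,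
    fun q hq hs => ?_⟩
  · rw [pullForm_apply, hder q hq]
    exact hker _ hq.2.1 hq.2.2 _
  · rw [hder q hq]
    exact (injective_iff_map_eq_zero' _).1 (hinv q hq).injective _
  · have : (fderiv ℝ (φ ∘ G) q : E → _) = _ := funext (hder q hq)
    rw [this]
    exact (hinv q hq).surjective.comp hs

namespace IsLocalContactModel

variable {ξ : (p : M) → Submodule ℝ (TangentSpace (𝓡 d) p)} {G : E → M} {O : Set E}
  {Γ : E → EuclideanSpace ℝ (Fin d)}
  {α : EuclideanSpace ℝ (Fin d) → EuclideanSpace ℝ (Fin d) →L[ℝ] ℝ}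

theorem dForm_pull (h : IsLocalContactModel ξ G O Γ α) {q : E} (hq : q ∈ O) (u v : E) :
    dForm (pullForm Γ α) q u v = dForm α (Γ q) (fderiv ℝ Γ q u) (fderiv ℝ Γ q v) :=
  dForm_pullForm ((h.contDiffOn.contDiffAt (h.isOpen.mem_nhds hq)).of_le two_le_infty)
    (h.differentiableAt q hq) u v

/-- A form that vanishes on `(DG)⁻¹(ξ)` is locally a multiple of the local model. -/
theorem exists_smul_eq (h : IsLocalContactModel ξ G O Γ α) {a : E → E →L[ℝ] ℝ}
    (ha : ContDiffOn ℝ ∞ a O)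
    (hker : ∀ q ∈ O, ∀ v : E, mfderiv 𝓘(ℝ, E) (𝓡 d) G q v ∈ ξ (G q) → a q v = 0)
    {q : E} (hq : q ∈ O) (hb : pullForm Γ α q ≠ 0) :
    ∃ c : E → ℝ, ContDiffAt ℝ ∞ c q ∧ ∀ᶠ z in 𝓝 q, a z = c z • pullForm Γ α z := by
  obtain ⟨v₀, hv₀⟩ : ∃ v₀, pullForm Γ α q v₀ ≠ 0 := by
    by_contra! hcon
    exact hb (ContinuousLinearMap.ext hcon)
  have hOn := h.isOpen.mem_nhds hq
  have hbs := (h.contDiffOn_pull.contDiffAt hOn).clm_apply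
    (contDiffAt_const (c := v₀))
  have has := (ha.contDiffAt hOn).clm_apply (contDiffAt_const (c := v₀))
  -- The factor is the quotient of the two forms on one vector `v₀` not in the kernel; every vector
  -- differs from a multiple of `v₀` by a kernel element.
  refine ⟨fun z => a z v₀ / pullForm Γ α z v₀, has.div hbs hv₀, ?_⟩
  filter_upwards [hOn, hbs.continuousAt.eventually_ne hv₀] with z hz hz0
  refine ContinuousLinearMap.ext fun v => ?_
  have e1 : a z (v - (pullForm Γ α z v / pullForm Γ α z v₀) • v₀) = 0 :=
    hker z hz _ ((h.mem_iff z hz _).2 (by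
      rw [map_sub, map_smul, smul_eq_mul, div_mul_cancel₀ _ hz0, sub_self]))
  rw [map_sub, map_smul, sub_eq_zero] at e1
  rw [e1, smul_apply, smul_eq_mul, smul_eq_mul]
  ring

end IsLocalContactModel

/-- A form that vanishes on the preimage of `ξ` and is nonzero at `q` is a nonvanishing multiple of
the pulled back contact form near `q`. The derivative of the factor drops out on vectors in the
kernel, so `da` inherits both degeneracy along the fibres of `G` and nondegeneracy modulo them. -/
theorem IsContactStructure.dForm_of_kernel [IsManifold (𝓡 d) ∞ M]
    {ξ : (p : M) → Submodule ℝ (TangentSpace (𝓡 d) p)} (hξ : IsContactStructure ξ) {G : E → M}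
    {U : Set E} (hU : IsOpen U) (hG : ContMDiffOn 𝓘(ℝ, E) (𝓡 d) ∞ G U)
    {a : E → E →L[ℝ] ℝ} (ha : ContDiffOn ℝ ∞ a U)
    (hker : ∀ q ∈ U, ∀ v : E, mfderiv 𝓘(ℝ, E) (𝓡 d) G q v ∈ ξ (G q) → a q v = 0)
    {q : E} (hq : q ∈ U) (haq : a q ≠ 0) :
    (∀ v : E, mfderiv 𝓘(ℝ, E) (𝓡 d) G q v ∈ ξ (G q) ↔ a q v = 0) ∧
    (∀ u v : E, mfderiv 𝓘(ℝ, E) (𝓡 d) G q u = 0 → a q v = 0 → dForm a q u v = 0) ∧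
    (Function.Surjective (mfderiv 𝓘(ℝ, E) (𝓡 d) G q) → ∀ u : E, a q u = 0 →
      (∀ v, a q v = 0 → dForm a q u v = 0) → mfderiv 𝓘(ℝ, E) (𝓡 d) G q u = 0) := by
  obtain ⟨O, Γ, α, hqO, hOU, h⟩ := hξ.exists_localContactModel hU hG hq
  have hb : pullForm Γ α q ≠ 0 := fun hb => haq (ContinuousLinearMap.ext fun v =>
    hker q hq v ((h.mem_iff q hqO v).2 (by rw [hb]; rfl)))
  obtain ⟨c, hc, hac⟩ := h.exists_smul_eq (ha.mono hOU) (fun q hq => hker q (hOU hq)) hqO hb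
  have hacq := hac.self_of_nhds
  have hcq : c q ≠ 0 := fun h0 => haq (by rw [hacq, h0, zero_smul])
  have hiff : ∀ v, a q v = 0 ↔ pullForm Γ α q v = 0 := fun v => by
    rw [hacq, smul_apply, smul_eq_mul, mul_eq_zero, or_iff_right hcq]
  have hd : ∀ u v, dForm a q u v = c q * dForm α (Γ q) (fderiv ℝ Γ q u) (fderiv ℝ Γ q v) +
      fderiv ℝ c q u * pullForm Γ α q v - fderiv ℝ c q v * pullForm Γ α q u := fun u v => by
    rw [dForm_congr hac, dForm_smul (hc.differentiableAt (by simp))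
      ((h.contDiffOn_pull.contDiffAt (h.isOpen.mem_nhds hqO)).differentiableAt (by simp)),
      h.dForm_pull hqO]
  refine ⟨fun v => (h.mem_iff q hqO v).trans (hiff v).symm, fun u v hu hv => ?_,
    fun hs u hu huv => ?_⟩
  · have hu' := (h.fderiv_eq_zero_iff q hqO u).2 hu
    rw [hd, hu', (hiff v).1 hv, pullForm_apply, hu']
    simp [dForm]
  · refine (h.fderiv_eq_zero_iff q hqO u).1 ((h.contact q hqO).2 _ ((hiff u).1 hu) fun w hw => ?_)
    obtain ⟨v, rfl⟩ := h.surjective q hqO hs w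
    have e1 := huv v ((hiff v).2 hw)
    rw [hd, (hiff v).1 ((hiff v).2 hw), (hiff u).1 hu] at e1
    simpa [hcq] using e1

end LocalForms

/-! ### Division by a defining function -/

section Division

open Set

/-- Hadamard's lemma: integrate the derivative of `A`, cut off near `y₀`, along the segment from the
projection `y - l(y) w` in `ker l` to `y`. The factor `l(y)` comes out of the integral. -/
theorem exists_eq_linear_mul {E : Type} [NormedAddCommGroup E] [NormedSpace ℝ E]
    [FiniteDimensional ℝ E] {A : E → ℝ} {O : Set E} (hO : IsOpen O) (hA : ContDiffOn ℝ ∞ A O)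
    {y₀ w : E} (hy₀ : y₀ ∈ O) {l : E →L[ℝ] ℝ} (hw : l w = 1)
    (h0 : ∀ y ∈ O, l y = 0 → A y = 0) :
    ∃ B : E → ℝ, ContDiff ℝ ∞ B ∧ ∀ᶠ y in 𝓝 y₀, A y = l y * B y := by
  obtain ⟨r, hr, hrO⟩ := Metric.isOpen_iff.1 hO y₀ hy₀
  let χ : ContDiffBump y₀ := ⟨r / 3, r / 2, by positivity, by linarith⟩
  set A' : E → ℝ := fun y => χ y * A y with hA'
  have hsupp : tsupport χ ⊆ O := by
    rw [χ.tsupport_eq]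
    exact (Metric.closedBall_subset_ball (by show r / 2 < r; linarith)).trans hrO
  have hA's : ContDiff ℝ ∞ A' := by
    rw [contDiff_iff_contDiffAt]
    intro y
    by_cases hy : y ∈ tsupport χ
    · exact χ.contDiffAt.mul (hA.contDiffAt (hO.mem_nhds (hsupp hy)))
    · refine contDiffAt_const (c := (0 : ℝ)) |>.congr_of_eventuallyEq ?_
      filter_upwards [(isClosed_tsupport χ).isOpen_compl.mem_nhds hy] with z hz
      simp [hA', image_eq_zero_of_notMem_tsupport hz]
  have hA'0 : ∀ y, l y = 0 → A' y = 0 := fun y hy => by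
    by_cases hyO : y ∈ O
    · simp [hA', h0 y hyO hy]
    · have : χ y = 0 := image_eq_zero_of_notMem_tsupport fun h => hyO (hsupp h)
      simp [hA', this]
  have hd : ContDiff ℝ ∞ (fderiv ℝ A') := hA's.fderiv_right (m := ∞) (by simp)
  set g : E × ℝ → ℝ := fun z => fderiv ℝ A' (z.1 - (1 - z.2) • l z.1 • w) w with hg
  have hgs : ContDiff ℝ ∞ g := by
    have h1 : ContDiff ℝ ∞ (fun z : E × ℝ => z.1 - (1 - z.2) • l z.1 • w) := by fun_prop
    exact (hd.comp h1).clm_apply contDiff_const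
  refine ⟨_, contDiff_integral_of_contDiff (h := fun τ z => g (z, τ)) hgs fun _ _ => rfl, ?_⟩
  filter_upwards [χ.eventuallyEq_one] with y hy
  have e1 : A y = A' y := by simp [hA', hy]
  have e2 : ∀ τ : ℝ, HasDerivAt (fun τ : ℝ => A' (y - (1 - τ) • l y • w)) (l y * g (y, τ)) τ := by
    intro τ
    have e3 : HasDerivAt (fun τ : ℝ => y - (1 - τ) • l y • w) (l y • w) τ := by
      have := (((hasDerivAt_id τ).const_sub 1).smul_const (l y • w)).const_sub y
      simpa using this
    have e4 := ((hA's.differentiable (by simp) _).hasFDerivAt).comp_hasDerivAt τ e3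
    refine e4.congr_deriv ?_
    simp [hg]
  have e5 := intervalIntegral.integral_eq_sub_of_hasDerivAt (a := 0) (b := 1)
    (fun τ _ => e2 τ) ((continuous_const.mul (hgs.continuous.comp
      (continuous_const.prodMk continuous_id))).intervalIntegrable _ _)
  rw [intervalIntegral.integral_const_mul] at e5
  rw [e5, e1]
  have e6 : A' (y - l y • w) = 0 := hA'0 _ (by simp [hw])
  simp [e6]

/-- A local change of coordinates turns `ρ` into its linearization, which reduces to the linear
case. -/
theorem exists_eq_mul_of_fderiv_ne_zero {E : Type} [NormedAddCommGroup E] [NormedSpace ℝ E]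
    [FiniteDimensional ℝ E] {A ρ : E → ℝ} {O : Set E} (hO : IsOpen O) (hA : ContDiffOn ℝ ∞ A O)
    (hρ : ContDiff ℝ ∞ ρ) {z₀ : E} (hz₀ : z₀ ∈ O) (hρd : fderiv ℝ ρ z₀ ≠ 0)
    (h0 : ∀ z ∈ O, ρ z = 0 → A z = 0) :
    ∃ B : E → ℝ, ContDiff ℝ ∞ B ∧ ∀ᶠ z in 𝓝 z₀, A z = ρ z * B z := by
  set l := fderiv ℝ ρ z₀ with hl
  obtain ⟨w, hw⟩ : ∃ w, l w = 1 := by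
    obtain ⟨v, hv⟩ : ∃ v, l v ≠ 0 := by
      by_contra! hcon
      exact hρd (ContinuousLinearMap.ext hcon)
    exact ⟨(l v)⁻¹ • v, by simp [hv]⟩
  -- Since `l w = 1`, this shear satisfies `l ∘ Φ = ρ`, and its derivative at `z₀` is the identity.
  set Φ : E → E := fun z => z + (ρ z - l z) • w with hΦ
  have hΦs : ContDiff ℝ ∞ Φ := contDiff_id.add ((hρ.sub l.contDiff).smul contDiff_const)
  have hlΦ : ∀ z, l (Φ z) = ρ z := fun z => by simp [hΦ, hw]
  have hΦd : HasFDerivAt Φ ((ContinuousLinearEquiv.refl ℝ E : E ≃L[ℝ] E) : E →L[ℝ] E) z₀ := by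
    have := (hasFDerivAt_id z₀).add
      ((((hρ.differentiable (by simp)) z₀).hasFDerivAt.sub l.hasFDerivAt).smul_const w)
    refine this.congr_fderiv ?_
    rw [← hl, sub_self]
    ext; simp
  set e := hΦs.contDiffAt.toOpenPartialHomeomorph Φ hΦd (by simp) with he
  have hecoe : ∀ z, e z = Φ z := fun z => rfl
  have hze : z₀ ∈ e.source := hΦs.contDiffAt.mem_toOpenPartialHomeomorph_source hΦd (by simp)
  set S : Set E := O ∩ fderiv ℝ Φ ⁻¹' range ((↑) : (E ≃L[ℝ] E) → E →L[ℝ] E) with hS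
  have hSo : IsOpen S := hO.inter (ContinuousLinearEquiv.isOpen.preimage
    (hΦs.continuous_fderiv (by simp)))
  set T : Set E := e.target ∩ e.symm ⁻¹' S with hT
  have hTo : IsOpen T := e.symm.isOpen_inter_preimage hSo
  have hsymm : ContDiffOn ℝ ∞ e.symm T := fun y hy => by
    obtain ⟨f', hf'⟩ := hy.2.2
    refine (e.contDiffAt_symm hy.1 (f₀' := f') ?_ hΦs.contDiffAt).contDiffWithinAt
    rw [hf']
    exact ((hΦs.differentiable (by simp)) _).hasFDerivAt
  have hz₀T : e z₀ ∈ T := by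
    refine ⟨e.map_source hze, ?_⟩
    rw [mem_preimage, e.left_inv hze]
    exact ⟨hz₀, ContinuousLinearEquiv.refl ℝ E, hΦd.fderiv.symm⟩
  obtain ⟨B, hB, hBe⟩ := exists_eq_linear_mul hTo (A := A ∘ e.symm)
    (hA.comp hsymm fun y hy => hy.2.1) hz₀T hw (fun y hy hly => h0 _ hy.2.1 (by
      rw [← hlΦ, ← hecoe, e.right_inv hy.1, hly]))
  refine ⟨B ∘ Φ, hB.comp hΦs, ?_⟩
  have h1 := hΦs.continuous.continuousAt.eventually hBe
  filter_upwards [h1, e.open_source.mem_nhds hze] with z hz hze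
  rw [← hecoe] at hz
  rw [Function.comp_apply, e.left_inv hze, hecoe, hlΦ] at hz
  exact hz

end Division

/-! ### The conformal factor of a form with the kernel of `r sin r dϑ` -/

section ConformalFactor

open Set

variable {n : ℕ}

theorem eq_mul_otForm_of_ker_eq {L : Cover n →L[ℝ] ℝ} {x : Plane}
    (h : ∀ w, L w = 0 ↔ otForm x w.2 = 0) {w₀ : Plane} (hw₀ : otForm x w₀ ≠ 0) (w : Cover n) :
    L w = L (0, w₀) / otForm x w₀ * otForm x w.2 := by
  have e1 : L (w - (otForm x w.2 / otForm x w₀) • (0, w₀)) = 0 := by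
    rw [h]
    simp only [← otFormL_apply, Prod.snd_sub, Prod.smul_snd, map_sub, map_smul, smul_eq_mul]
      at hw₀ ⊢
    field_simp
    ring
  rw [map_sub, map_smul, sub_eq_zero, smul_eq_mul] at e1
  rw [e1]
  ring

/-- The rotation field `∂_ϑ`. -/
def rotate (x : Plane) : Plane := !₂[-x 1, x 0]

theorem contDiff_rotate : ContDiff ℝ ∞ rotate := by
  rw [contDiff_euclidean]
  intro i
  fin_cases i
  · change ContDiff ℝ ∞ fun x : Plane => -x 1
    fun_prop
  · change ContDiff ℝ ∞ fun x : Plane => x 0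
    fun_prop

theorem otForm_rotate (x : Plane) : otForm x (rotate x) = sincNorm x * ‖x‖ ^ 2 := by
  rw [norm_sq_plane]
  simp [otForm, rotate, sincNorm]
  left; ring

theorem otForm_eq_zero_of_sincNorm {x : Plane} (hx : sincNorm x = 0) (v : Plane) :
    otForm x v = 0 := by
  simp only [sincNorm] at hx
  simp [otForm, hx]

theorem fderiv_otForm_rotate (x v : Plane) :
    fderiv ℝ (fun x : Plane => sincNorm x * ‖x‖ ^ 2) x v =
      (sincNorm x + cosNorm x) * inner ℝ x v := by
  have h1 := ((contDiff_sincNorm.differentiable (by simp)) x).hasFDerivAt.mul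
    (hasStrictFDerivAt_norm_sq x).hasFDerivAt
  have h2 : fderiv ℝ (fun x : Plane => sincNorm x * ‖x‖ ^ 2) x = _ := h1.fderiv
  rw [h2]
  have h3 := sincSq_eq ‖x‖
  simp [fderiv_sincNorm]
  rw [sincNorm, cosNorm]
  linear_combination inner ℝ x v * h3

/-- Where `r sin r dϑ` is nonzero the factor is a quotient of values on one vector. At its zeros the
quotient is extended by smooth division; the circle `r = π` and the centre need different test
vectors. The kernels are compared only over the disk, which at `r = π` still contains the whole
local zero set of the denominator. -/
theorem exists_conformal_factor {β : Cover n → Cover n →L[ℝ] ℝ} {O : Set (Cover n)} (hO : IsOpen O)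
    (hβ : ContDiffOn ℝ ∞ β O) {p₀ : Cover n} (hp₀ : p₀ ∈ O) (hp₀D : p₀.2 ∈ diskPi)
    (hker : ∀ p ∈ O, p.2 ∈ diskPi → ∀ w, β p w = 0 ↔ otForm p.2 w.2 = 0) :
    ∃ (O' : Set (Cover n)) (h : Cover n → ℝ), IsOpen O' ∧ p₀ ∈ O' ∧ O' ⊆ O ∧ ContDiffOn ℝ ∞ h O' ∧
      ∀ p ∈ O', p.2 ∈ diskPi → ∀ w, β p w = h p * otForm p.2 w.2 := by
  set σ : Cover n → ℝ := fun p => sincNorm p.2 * ‖p.2‖ ^ 2 with hσ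
  have hσs : ContDiff ℝ ∞ σ := (contDiff_sincNorm.comp contDiff_snd).mul (contDiff_snd.norm_sq ℝ)
  set A : Cover n → ℝ := fun p => β p (0, rotate p.2) with hA
  have hAs : ContDiffOn ℝ ∞ A O := hβ.clm_apply
    (contDiff_const.prodMk (contDiff_rotate.comp contDiff_snd)).contDiffOn
  have hreg : ∀ p ∈ O, p.2 ∈ diskPi → σ p ≠ 0 → ∀ w, β p w = A p / σ p * otForm p.2 w.2 :=
    fun p hp hpD hp0 w => by
      have := eq_mul_otForm_of_ker_eq (hker p hp hpD) (w₀ := rotate p.2)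
        (by rw [otForm_rotate]; exact hp0) w
      rwa [otForm_rotate] at this
  have hsing : ∀ p ∈ O, p.2 ∈ diskPi → σ p = 0 → ∀ w, otForm p.2 w = 0 := fun p hp hpD hp0 w => by
    rcases mul_eq_zero.1 hp0 with h | h
    · exact otForm_eq_zero_of_sincNorm h w
    · have : p.2 = 0 := by simpa using h
      simp [otForm, this]
  -- it suffices to divide `A` by `σ`
  have main : ∀ (O' : Set (Cover n)) (h : Cover n → ℝ), IsOpen O' → p₀ ∈ O' → O' ⊆ O →
      ContDiffOn ℝ ∞ h O' → (∀ p ∈ O', A p = σ p * h p) →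
      ∃ (O' : Set (Cover n)) (h : Cover n → ℝ), IsOpen O' ∧ p₀ ∈ O' ∧ O' ⊆ O ∧
        ContDiffOn ℝ ∞ h O' ∧ ∀ p ∈ O', p.2 ∈ diskPi → ∀ w, β p w = h p * otForm p.2 w.2 := by
    intro O' h h1 h2 h3 h4 h5
    refine ⟨O', h, h1, h2, h3, h4, fun p hp hpD w => ?_⟩
    by_cases hp0 : σ p = 0
    · rw [hsing p (h3 hp) hpD hp0, mul_zero]
      exact (hker p (h3 hp) hpD w).2 (hsing p (h3 hp) hpD hp0 _)
    · rw [hreg p (h3 hp) hpD hp0, h5 p hp]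
      field_simp
  by_cases hσ0 : σ p₀ = 0
  swap
  · refine main (O ∩ σ ⁻¹' {0}ᶜ) (fun p => A p / σ p)
      (hO.inter (isOpen_compl_singleton.preimage hσs.continuous)) ⟨hp₀, hσ0⟩ inter_subset_left
      ((hAs.mono inter_subset_left).div hσs.contDiffOn fun p hp => hp.2) fun p hp => ?_
    have : σ p ≠ 0 := hp.2
    field_simp
  -- At the centre the value `sinc r · r²` on `∂_ϑ` vanishes to second order and is no defining
  -- function. The constant vector `e` is used instead: its value is `sinc r · x₀`, with simple zero
  -- set `x₀ = 0`.
  by_cases hx0 : p₀.2 = 0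
  · set O₁ : Set (Cover n) := O ∩ {p | ‖p.2‖ < Real.pi} with hO₁
    have hO₁o : IsOpen O₁ := hO.inter (isOpen_lt continuous_snd.norm continuous_const)
    have hpO₁ : p₀ ∈ O₁ := ⟨hp₀, by
      rw [mem_ofPred_eq, hx0, norm_zero]; exact Real.pi_pos⟩
    have hD : ∀ p ∈ O₁, p.2 ∈ diskPi := fun p hp => mem_closedBall_zero_iff.2 hp.2.le
    have hsinc : ∀ p ∈ O₁, sincNorm p.2 ≠ 0 := fun p hp =>
      (Real.sinc_pos_of_lt_pi (norm_nonneg _) hp.2).ne'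
    set e : Plane := !₂[0, 1] with he
    have hoe : ∀ x : Plane, otForm x e = sincNorm x * x 0 := fun x => by
      simp [otForm, he, sincNorm]
    set l : Cover n →L[ℝ] ℝ := (EuclideanSpace.proj (0 : Fin 2)).comp
      (ContinuousLinearMap.snd ℝ (Fin n → ℝ) Plane) with hl
    have hl_apply : ∀ p, l p = p.2 0 := fun p => rfl
    set u : Cover n := (0, !₂[1, 0]) with hu
    have hlu : l u = 1 := by simp [hl_apply, hu]
    obtain ⟨B, hB, hBe⟩ := exists_eq_linear_mul hO₁o
      (A := fun p => β p (0, e)) ((hβ.mono inter_subset_left).clm_apply contDiffOn_const) hpO₁ hlu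
      fun p hp hlp => (hker p hp.1 (hD p hp) _).2 (by
        rw [hoe, ← hl_apply, hlp, mul_zero])
    obtain ⟨O', hO'B, hO', hpO'⟩ := eventually_nhds_iff.1 (hBe.and (hO₁o.mem_nhds hpO₁))
    have hO'1 : O' ⊆ O₁ := fun p hp => (hO'B p hp).2
    have hhs : ContDiffOn ℝ ∞ (fun p => B p / sincNorm p.2) O' :=
      hB.contDiffOn.div (contDiff_sincNorm.comp contDiff_snd).contDiffOn fun p hp =>
        hsinc p (hO'1 hp)
    refine ⟨O', fun p => B p / sincNorm p.2, hO', hpO', fun p hp => (hO'1 hp).1, hhs,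
      fun p hp _ w => ?_⟩
    have hoff : ∀ p ∈ O', l p ≠ 0 → β p w = B p / sincNorm p.2 * otForm p.2 w.2 :=
      fun p hp hlp => by
        have hs := hsinc p (hO'1 hp)
        have h1 := eq_mul_otForm_of_ker_eq (hker p (hO'1 hp).1 (hD p (hO'1 hp))) (w₀ := e)
          (by rw [hoe, ← hl_apply]; exact mul_ne_zero hs hlp) w
        rw [h1, (hO'B p hp).1, hoe, ← hl_apply]
        field_simp
    by_cases hlp : l p = 0
    swap
    · exact hoff p hp hlp
    -- On the line `x₀ = 0` the test vector gives no information, but the identity passes to the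
    -- limit from nearby points with `x₀ ≠ 0`.
    have hpath : Continuous fun t : ℝ => p + t • u := by fun_prop
    have hpt : Filter.Tendsto (fun t : ℝ => p + t • u) (𝓝[≠] 0) (𝓝 p) := by
      have := hpath.tendsto 0
      simp only [zero_smul, add_zero] at this
      exact this.mono_left nhdsWithin_le_nhds
    have hn := hO'.mem_nhds hp
    have c1 : ContinuousAt (fun p => β p w) p :=
      ((hβ.contDiffAt (hO.mem_nhds (hO'1 hp).1)).clm_apply contDiffAt_const).continuousAt
    have c2 : ContinuousAt (fun p : Cover n => B p / sincNorm p.2 * otForm p.2 w.2) p := by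
      have h2 : Continuous fun p : Cover n => otForm p.2 w.2 := by
        simp only [← otFormL_apply]
        exact (contDiff_otFormL.continuous.comp continuous_snd).clm_apply continuous_const
      exact (hhs.contDiffAt hn).continuousAt.mul h2.continuousAt
    refine tendsto_nhds_unique (c1.tendsto.comp hpt) ((c2.tendsto.comp hpt).congr' ?_)
    filter_upwards [hpt hn, self_mem_nhdsWithin] with t ht ht0
    refine (hoff _ ht ?_).symm
    rw [map_add, hlp, map_smul, hlu]
    simpa using ht0
  · have hsinc : sincNorm p₀.2 = 0 := (mul_eq_zero.1 hσ0).resolve_right (by simpa using hx0)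
    have hnorm : ‖p₀.2‖ = Real.pi := by
      refine le_antisymm (mem_closedBall_zero_iff.1 hp₀D) (not_lt.1 fun hlt => ?_)
      exact (Real.sinc_pos_of_lt_pi (norm_nonneg _) hlt).ne' hsinc
    have hcos : cosNorm p₀.2 = -1 := by rw [cosNorm, hnorm, Real.cos_pi]
    set O₁ : Set (Cover n) := O ∩ {p | 0 < ‖p.2‖ ∧ ‖p.2‖ < 2 * Real.pi} with hO₁
    have hO₁o : IsOpen O₁ := hO.inter ((isOpen_lt continuous_const continuous_snd.norm).inter
      (isOpen_lt continuous_snd.norm continuous_const))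
    have hpO₁ : p₀ ∈ O₁ := ⟨hp₀, by rw [hnorm]; exact Real.pi_pos, by
      rw [hnorm]; linarith [Real.pi_pos]⟩
    -- At `r = π` the derivative of `σ` in the radial direction is `(sinc π + cos π) π² = -π²`, so
    -- the boundary circle is a regular zero set.
    have hfd : fderiv ℝ σ p₀ ≠ 0 := fun h0 => by
      have e1 : fderiv ℝ σ p₀ (0, p₀.2) = -Real.pi ^ 2 := by
        have e2 : HasFDerivAt σ _ p₀ := HasFDerivAt.comp
          (g := fun x : Plane => sincNorm x * ‖x‖ ^ 2) p₀
          ((contDiff_sincNorm.mul (contDiff_norm_sq ℝ)).differentiable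
            (by simp : (∞ : WithTop ℕ∞) ≠ 0) p₀.2).hasFDerivAt hasFDerivAt_snd
        rw [e2.fderiv]
        simp [fderiv_otForm_rotate, hsinc, hcos, hnorm]
      rw [h0] at e1
      have := Real.pi_pos
      simp at e1
    obtain ⟨B, hB, hBe⟩ := exists_eq_mul_of_fderiv_ne_zero hO₁o (hAs.mono inter_subset_left) hσs
      hpO₁ hfd fun p hp hp0 => by
        have h1 : Real.sinc ‖p.2‖ = 0 :=
          (mul_eq_zero.1 hp0).resolve_right (pow_ne_zero 2 hp.2.1.ne')
        rw [Real.sinc_of_ne_zero hp.2.1.ne', div_eq_zero_iff, or_iff_left hp.2.1.ne'] at h1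
        have h2 : ‖p.2‖ ≤ Real.pi := by
          by_contra! hlt
          have h3 := Real.sin_pos_of_pos_of_lt_pi (x := ‖p.2‖ - Real.pi) (by linarith)
            (by linarith [hp.2.2])
          rw [Real.sin_sub_pi, h1] at h3
          simp at h3
        have h4 : p.2 ∈ diskPi := mem_closedBall_zero_iff.2 h2
        exact (hker p hp.1 h4 _).2 (hsing p hp.1 h4 hp0 _)
    obtain ⟨O', hO'B, hO', hpO'⟩ := eventually_nhds_iff.1 (hBe.and (hO.mem_nhds hp₀))
    exact main O' B hO' hpO' (fun p hp => (hO'B p hp).2) hB.contDiffOn fun p hp => (hO'B p hp).1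

end ConformalFactor

/-! ### A normalized form on a thickening of the plastikstufe -/

section LatticeQuotient

open Set

variable {n : ℕ}

/-- The quotient of `ℝⁿ × ℝ² × F` by the lattice, embedded in a vector space. -/
def latticeQuot {F : Type*} (q : Cover n × F) : Plane × (Fin n → ℂ) × F :=
  (q.1.2, fun j => Complex.exp (q.1.1 j * Complex.I), q.2)

theorem contDiff_latticeQuot {F : Type*} [NormedAddCommGroup F] [NormedSpace ℝ F] : ContDiff ℝ ∞ (latticeQuot : Cover n × F → _) := by
  refine (contDiff_snd.comp contDiff_fst).prodMk (ContDiff.prodMk (contDiff_pi.2 fun j => ?_)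
    contDiff_snd)
  refine ContDiff.cexp (ContDiff.mul ?_ contDiff_const)
  refine Complex.ofRealCLM.contDiff.comp ?_
  fun_prop

theorem latticeQuot_eq_iff {F : Type*} [AddMonoid F] {q q' : Cover n × F} :
    latticeQuot q = latticeQuot q' ↔ ∃ l : Fin n → ℤ, q = q' + (shiftCover l, 0) := by
  constructor
  · intro h
    simp only [latticeQuot, Prod.mk.injEq] at h
    obtain ⟨l, hl⟩ := (torusExp_eq_iff (s := q.1.1) (s' := q'.1.1)).1
      (funext fun j => Circle.ext (congrFun h.2.1 j))
    refine ⟨l, Prod.ext (Prod.ext ?_ ?_) ?_⟩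
    · simpa [shiftCover] using hl
    · simpa [shiftCover] using h.1
    · simpa using h.2.2
  · rintro ⟨l, rfl⟩
    have h1 := torusExp_add_latticeVec q'.1.1 l
    simp only [latticeQuot, Prod.mk.injEq, Prod.fst_add, Prod.snd_add, shiftCover, add_zero,
      true_and, and_true]
    exact funext fun j => congrArg Circle.coeHom (congrFun h1 j)

/-- The local inverse of `latticeQuot` at the image of a point with first component `s`. -/
def latticeLift {F : Type*} (s : Fin n → ℝ) (z : Plane × (Fin n → ℂ) × F) : Cover n × F :=
  ((fun j => s j + (Complex.log (z.2.1 j * Complex.exp (-(s j * Complex.I)))).im, z.1), z.2.2)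

theorem latticeLift_latticeQuot_self {F : Type*} (q : Cover n × F) :
    latticeLift q.1.1 (latticeQuot q) = q := by
  simp [latticeLift, latticeQuot, ← Complex.exp_add]

/-- This holds with no smallness assumption: `z = e^{i arg z}` on the unit circle for every branch
point included. Off the slit domain only smoothness of the lift is lost. -/
theorem latticeQuot_latticeLift {F : Type*} (s : Fin n → ℝ) (q : Cover n × F) :
    latticeQuot (latticeLift s (latticeQuot q)) = latticeQuot q := by
  simp only [latticeLift, latticeQuot, Prod.mk.injEq, true_and, and_true]
  refine funext fun j => ?_
  rw [← Complex.exp_add, Complex.log_im]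
  set r := Complex.exp (q.1.1 j * Complex.I + -(s j * Complex.I)) with hr
  have h1 : ‖r‖ = 1 := by
    rw [hr, ← sub_eq_add_neg, ← sub_mul, ← Complex.ofReal_sub]
    exact Complex.norm_exp_ofReal_mul_I _
  have h2 := Complex.norm_mul_exp_arg_mul_I r
  rw [h1, Complex.ofReal_one, one_mul] at h2
  rw [Complex.ofReal_add, add_mul, Complex.exp_add, h2, hr, ← Complex.exp_add]
  congr 1
  ring

theorem contDiffOn_latticeLift {F : Type*} [NormedAddCommGroup F] [NormedSpace ℝ F] (s : Fin n → ℝ) :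
    ContDiffOn ℝ ∞ (latticeLift s : Plane × (Fin n → ℂ) × F → Cover n × F)
      {z | ∀ j, z.2.1 j * Complex.exp (-(s j * Complex.I)) ∈ Complex.slitPlane} := by
  refine ContDiffOn.prodMk (ContDiffOn.prodMk (contDiffOn_pi.2 fun j => ?_) contDiffOn_fst)
    (contDiff_snd.comp contDiff_snd).contDiffOn
  refine contDiffOn_const.add (Complex.imCLM.contDiff.comp_contDiffOn
    (f := fun z : Plane × (Fin n → ℂ) × F =>
      Complex.log (z.2.1 j * Complex.exp (-(s j * Complex.I)))) fun z hz => ?_)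
  have h1 : ContDiffAt ℝ ∞ Complex.log (z.2.1 j * Complex.exp (-(s j * Complex.I))) :=
    (Complex.contDiffAt_log (hz j)).restrict_scalars ℝ
  refine (ContDiffAt.comp (g := Complex.log) (f := fun z : Plane × (Fin n → ℂ) × F =>
    z.2.1 j * Complex.exp (-(s j * Complex.I))) z h1 ?_).contDiffWithinAt
  fun_prop

end LatticeQuotient

/-! ### A global form restricting to `r sin r dϑ` on the core -/

section NormalizedForm

open Set

variable {n : ℕ} {F : Type} [NormedAddCommGroup F] [NormedSpace ℝ F]

theorem uniqueDiffWithinAt_disk {p : Cover n} (hp : p.2 ∈ diskPi) :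
    UniqueDiffWithinAt ℝ {p : Cover n | p.2 ∈ diskPi} p := by
  have hc : Convex ℝ {p : Cover n | p.2 ∈ diskPi} :=
    (convex_closedBall (0 : Plane) Real.pi).linear_preimage (LinearMap.snd ℝ (Fin n → ℝ) Plane)
  refine uniqueDiffOn_convex hc ⟨0, mem_interior.2 ⟨Prod.snd ⁻¹' Metric.ball 0 Real.pi,
    fun q hq => Metric.ball_subset_closedBall hq,
    Metric.isOpen_ball.preimage continuous_snd, ?_⟩⟩ p hp
  simp [Real.pi_pos]

/-- The closed disk is convex with interior, so derivatives are determined by values on the disk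
even at boundary points. -/
theorem dForm_eq_of_eqOn_disk {γ γ' : Cover n → Cover n →L[ℝ] ℝ} {p : Cover n}
    (hp : p.2 ∈ diskPi) (hγ : DifferentiableAt ℝ γ p) (hγ' : DifferentiableAt ℝ γ' p)
    (h : ∀ᶠ z in 𝓝 p, z.2 ∈ diskPi → γ z = γ' z) (u v : Cover n) :
    dForm γ p u v = dForm γ' p u v := by
  have h1 : γ' =ᶠ[𝓝[{p : Cover n | p.2 ∈ diskPi}] p] γ := by
    filter_upwards [mem_nhdsWithin_of_mem_nhds h, self_mem_nhdsWithin] with z hz hzD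
    exact (hz hzD).symm
  have h2 : fderiv ℝ γ p = fderiv ℝ γ' p :=
    (uniqueDiffWithinAt_disk hp).eq hγ.hasFDerivAt.hasFDerivWithinAt
      (hγ'.hasFDerivAt.hasFDerivWithinAt.congr_of_eventuallyEq h1.symm
        (h.self_of_nhds hp))
  rw [dForm, dForm, h2]

/-- The form vanishes on the disk only at `r = 0` and `r = π`, where the coefficient `sinc r + cos
r` of its exterior derivative is `2` and `-1`. -/
theorem otForm_eq_zero_or_sum_ne_zero {x : Plane} (hx : x ∈ diskPi) :
    otForm x (rotate x) ≠ 0 ∨ ((∀ v, otForm x v = 0) ∧ sincNorm x + cosNorm x ≠ 0) := by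
  by_cases h : otForm x (rotate x) = 0
  swap
  · exact Or.inl h
  refine Or.inr ?_
  rw [otForm_rotate] at h
  rcases mul_eq_zero.1 h with h | h
  · refine ⟨otForm_eq_zero_of_sincNorm h, ?_⟩
    have : ‖x‖ = Real.pi := by
      refine le_antisymm (mem_closedBall_zero_iff.1 hx) (not_lt.1 fun hlt => ?_)
      exact (Real.sinc_pos_of_lt_pi (norm_nonneg _) hlt).ne' h
    rw [h, cosNorm, this, Real.cos_pi]
    norm_num
  · have : x = 0 := by simpa using h
    subst this
    simp [otForm, sincNorm, cosNorm]

/-- The pullback of `r sin r dϑ` to the covering. -/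
def coverForm (n : ℕ) : Cover n → Cover n →L[ℝ] ℝ := pullForm Prod.snd otFormL

theorem coverForm_apply (p w : Cover n) : coverForm n p w = otForm p.2 w.2 := by
  rw [coverForm, pullForm_apply, fderiv_snd, otFormL_apply]
  rfl

theorem contDiff_coverForm : ContDiff ℝ ∞ (coverForm n) := by
  rw [← contDiffOn_univ]
  exact contDiff_snd.contDiffOn.pullForm isOpen_univ contDiff_otFormL.contDiffOn
    (mapsTo_univ _ univ)

theorem dForm_coverForm (p w w' : Cover n) :
    dForm (coverForm n) p w w' = (sincNorm p.2 + cosNorm p.2) * wedge w.2 w'.2 := by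
  rw [coverForm, dForm_pullForm contDiff_snd.contDiffAt
    (contDiff_otFormL.differentiable (by simp) _), fderiv_snd, dForm_otFormL]
  rfl

/-- The restriction of a form on `Cover n × F` to the zero section. -/
def coreForm (a : Cover n × F → Cover n × F →L[ℝ] ℝ) : Cover n → Cover n →L[ℝ] ℝ :=
  pullForm (ContinuousLinearMap.inl ℝ (Cover n) F) a

theorem coreForm_apply (a : Cover n × F → Cover n × F →L[ℝ] ℝ) (p w : Cover n) :
    coreForm a p w = a (p, 0) (w, 0) := by
  rw [coreForm, pullForm_apply, ContinuousLinearMap.fderiv]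
  rfl

theorem contDiffOn_coreForm {a : Cover n × F → Cover n × F →L[ℝ] ℝ} {O : Set (Cover n × F)}
    (hO : IsOpen O) (ha : ContDiffOn ℝ ∞ a O) :
    ContDiffOn ℝ ∞ (coreForm a) {p | (p, (0 : F)) ∈ O} :=
  (ContinuousLinearMap.inl ℝ (Cover n) F).contDiff.contDiffOn.pullForm
    (hO.preimage (ContinuousLinearMap.inl ℝ (Cover n) F).continuous) ha fun _ hp => hp

theorem dForm_coreForm {a : Cover n × F → Cover n × F →L[ℝ] ℝ} {p : Cover n}
    (ha : DifferentiableAt ℝ a (p, 0)) (w w' : Cover n) :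
    dForm (coreForm a) p w w' = dForm a (p, 0) (w, 0) (w', 0) := by
  rw [coreForm, dForm_pullForm (ContinuousLinearMap.inl ℝ (Cover n) F).contDiff.contDiffAt ha,
    ContinuousLinearMap.fderiv]
  rfl

theorem dForm_core_of_restriction {a : Cover n × F → Cover n × F →L[ℝ] ℝ} {p : Cover n}
    (ha : ContDiff ℝ ∞ a)
    (h : ∀ p : Cover n, p.2 ∈ diskPi → ∀ w, a (p, 0) (w, 0) = otForm p.2 w.2)
    (hp : p.2 ∈ diskPi) (w w' : Cover n) :
    dForm a (p, 0) (w, 0) (w', 0) = (sincNorm p.2 + cosNorm p.2) * wedge w.2 w'.2 := by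
  rw [← dForm_coreForm (ha.differentiable (by simp) _), ← dForm_coverForm]
  have h1 := contDiffOn_coreForm isOpen_univ ha.contDiffOn
  refine dForm_eq_of_eqOn_disk hp
    ((h1.contDiffAt Filter.univ_mem).differentiableAt (by simp))
    (contDiff_coverForm.differentiable (by simp) _) (Filter.Eventually.of_forall fun z hz => ?_) w w'
  refine ContinuousLinearMap.ext fun v => ?_
  rw [coreForm_apply, h z hz, coverForm_apply]

variable {M : Type*} [TopologicalSpace M] [ChartedSpace (EuclideanSpace ℝ (Fin (2 * n + 3))) M]

/-- `G` extends the lifted plastikstufe `ℝⁿ × 𝔻² × 0` to a periodic map from `ℝⁿ × ℝ² × F` to `M`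
which is submersive along `ℝⁿ × 𝔻² × 0`. -/
structure IsThickenedPlastikstufe (ξ : (p : M) → Submodule ℝ (TangentSpace (𝓡 (2 * n + 3)) p))
    (G : Cover n × F → M) (U : Set (Cover n × F)) : Prop where
  isOpen : IsOpen U
  shift_mem : ∀ (l : Fin n → ℤ), ∀ q ∈ U, q + (shiftCover l, 0) ∈ U
  core_mem : ∀ p : Cover n, p.2 ∈ diskPi → (p, 0) ∈ U
  contMDiffOn : ContMDiffOn 𝓘(ℝ, Cover n × F) (𝓡 (2 * n + 3)) ∞ G U
  periodic : ∀ (l : Fin n → ℤ) q, G (q + (shiftCover l, 0)) = G q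
  injective : ∀ p p' : Cover n, p.2 ∈ diskPi → p'.2 ∈ diskPi → G (p, 0) = G (p', 0) →
    ∃ l : Fin n → ℤ, p = p' + shiftCover l
  immersive : ∀ p : Cover n, p.2 ∈ diskPi → ∀ w : Cover n,
    mfderiv 𝓘(ℝ, Cover n × F) (𝓡 (2 * n + 3)) G (p, 0) (w, 0) = 0 → w = 0
  surjective : ∀ p : Cover n, p.2 ∈ diskPi →
    Function.Surjective (mfderiv 𝓘(ℝ, Cover n × F) (𝓡 (2 * n + 3)) G (p, 0))
  distribution : ∀ p : Cover n, p.2 ∈ diskPi → ∀ w : Cover n,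
    mfderiv 𝓘(ℝ, Cover n × F) (𝓡 (2 * n + 3)) G (p, 0) (w, 0) ∈ ξ (G (p, 0)) ↔
      otForm p.2 w.2 = 0

/-- `Θ(·, 0)` is the identity, so along the core the derivative in the `Cover n` directions is that
of `f`; in the `F` directions it is the velocity of `Θ`, which is onto. -/
theorem IsLiftedPlastikstufe.thicken
    {ξ : (p : M) → Submodule ℝ (TangentSpace (𝓡 (2 * n + 3)) p)} {f : Cover n → M}
    {U : Set (Cover n)} (h : IsLiftedPlastikstufe ξ f U) {Θ : M × F → M} {K : Set M}
    (hΘ : IsLocalAddition (d := 2 * n + 3) Θ K) (hK : ∀ p : Cover n, p.2 ∈ diskPi → f p ∈ K) :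
    IsThickenedPlastikstufe ξ (fun q : Cover n × F => Θ (f q.1, q.2)) (U ×ˢ univ) := by
  have hfst : ContMDiff 𝓘(ℝ, Cover n × F) 𝓘(ℝ, Cover n) ∞ (Prod.fst : Cover n × F → _) :=
    contDiff_fst.contMDiff
  have hsnd : ContMDiff 𝓘(ℝ, Cover n × F) 𝓘(ℝ, F) ∞ (Prod.snd : Cover n × F → _) :=
    contDiff_snd.contMDiff
  have hs : ContMDiffOn 𝓘(ℝ, Cover n × F) (𝓡 (2 * n + 3)) ∞
      (fun q : Cover n × F => Θ (f q.1, q.2)) (U ×ˢ univ) :=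
    hΘ.contMDiff.comp_contMDiffOn
      ((h.contMDiffOn.comp hfst.contMDiffOn fun q hq => hq.1).prodMk hsnd.contMDiffOn)
  have ho : IsOpen (U ×ˢ (univ : Set F)) := h.isOpen.prod isOpen_univ
  have hd : ∀ p : Cover n, p.2 ∈ diskPi → HasMFDerivAt 𝓘(ℝ, Cover n × F) (𝓡 (2 * n + 3))
      (fun q : Cover n × F => Θ (f q.1, q.2)) (p, 0) (mfderiv 𝓘(ℝ, Cover n × F) (𝓡 (2 * n + 3))
        (fun q : Cover n × F => Θ (f q.1, q.2)) (p, 0)) := fun p hp =>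
    ((hs.contMDiffAt (ho.mem_nhds ⟨h.core_mem p hp, mem_univ _⟩)).mdifferentiableAt
      (by simp)).hasMFDerivAt
  have hcore : ∀ p : Cover n, p.2 ∈ diskPi → ∀ w : Cover n,
      mfderiv 𝓘(ℝ, Cover n × F) (𝓡 (2 * n + 3)) (fun q : Cover n × F => Θ (f q.1, q.2)) (p, 0)
        (w, 0) = mfderiv 𝓘(ℝ, Cover n) (𝓡 (2 * n + 3)) f p w := fun p hp w => by
    have e1 : f = (fun q : Cover n × F => Θ (f q.1, q.2)) ∘
        ContinuousLinearMap.inl ℝ (Cover n) F := by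
      ext q; simp [hΘ.zero]
    have e3 : HasMFDerivAt 𝓘(ℝ, Cover n) 𝓘(ℝ, Cover n × F) (ContinuousLinearMap.inl ℝ (Cover n) F) p
        (ContinuousLinearMap.inl ℝ (Cover n) F) := (ContinuousLinearMap.hasFDerivAt _).hasMFDerivAt
    have e4 := (HasMFDerivAt.comp p (hd p hp) e3).congr_of_eventuallyEq
      (Filter.Eventually.of_forall fun q => congrFun e1 q)
    exact (congrArg (fun L => L w) e4.mfderiv).symm
  refine ⟨ho, fun l q hq => ⟨h.shift_mem l _ hq.1, mem_univ _⟩,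
    fun p hp => ⟨h.core_mem p hp, mem_univ _⟩, hs, fun l q => ?_, fun p p' hp hp' hpp => ?_,
    fun p hp w hw => ?_, fun p hp => ?_, fun p hp w => ?_⟩
  · simp only [Prod.fst_add, Prod.snd_add, add_zero, h.periodic]
  · simp only [hΘ.zero] at hpp
    exact h.injective p p' hp hp' hpp
  · rw [hcore p hp] at hw
    exact (injective_iff_map_eq_zero _).1 (h.immersive p hp) w hw
  · have e2 := hΘ.surjective (f p) (hK p hp)
    have e3 : HasMFDerivAt 𝓘(ℝ, F) 𝓘(ℝ, Cover n × F) (fun u : F => ((p, u) : Cover n × F)) 0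
        (ContinuousLinearMap.inr ℝ (Cover n) F) := (hasFDerivAt_prodMk_right p 0).hasMFDerivAt
    have e4 := (HasMFDerivAt.comp (0 : F) (hd p hp) e3).mfderiv
    have e5 : mfderiv 𝓘(ℝ, F) (𝓡 (2 * n + 3)) (fun u => Θ (f p, u)) 0 = _ := e4
    rw [e5] at e2
    exact Function.Surjective.of_comp e2
  · rw [← h.distribution p hp w, hcore p hp]
    have key : ∀ m m' : M, m = m' → ∀ v : EuclideanSpace ℝ (Fin (2 * n + 3)),
        Membership.mem (ξ m) v ↔ Membership.mem (ξ m') v := by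
      rintro m _ rfl v; rfl
    exact key _ _ (hΘ.zero _) _

variable {ξ : (p : M) → Submodule ℝ (TangentSpace (𝓡 (2 * n + 3)) p)} {G : Cover n × F → M}
  {U : Set (Cover n × F)}

theorem IsThickenedPlastikstufe.mem_shift_iff (h : IsThickenedPlastikstufe ξ G U) {q : Cover n × F}
    (hq : q ∈ U) (l : Fin n → ℤ) (v : Cover n × F) :
    mfderiv 𝓘(ℝ, Cover n × F) (𝓡 (2 * n + 3)) G (q + (shiftCover l, 0)) v ∈
      ξ (G (q + (shiftCover l, 0))) ↔
    mfderiv 𝓘(ℝ, Cover n × F) (𝓡 (2 * n + 3)) G q v ∈ ξ (G q) := by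
  have key : ∀ G' : Cover n × F → M, G' = G →
      (mfderiv 𝓘(ℝ, Cover n × F) (𝓡 (2 * n + 3)) G' q v ∈ ξ (G' q) ↔
      mfderiv 𝓘(ℝ, Cover n × F) (𝓡 (2 * n + 3)) G q v ∈ ξ (G q)) := by
    rintro _ rfl; rfl
  have e1 := ((h.contMDiffOn.contMDiffAt (h.isOpen.mem_nhds (h.shift_mem l q hq))).mdifferentiableAt
    (by simp)).hasMFDerivAt
  have e2 : HasMFDerivAt 𝓘(ℝ, Cover n × F) 𝓘(ℝ, Cover n × F)
      (fun q : Cover n × F => q + (shiftCover l, 0)) q (ContinuousLinearMap.id ℝ (Cover n × F)) :=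
    ((hasFDerivAt_id q).add_const _).hasMFDerivAt
  have e3 := (HasMFDerivAt.comp q e1 e2).mfderiv
  have e4 := key (G ∘ fun q : Cover n × F => q + (shiftCover l, 0)) (funext (h.periodic l))
  rw [e3] at e4
  exact e4

variable [IsManifold (𝓡 (2 * n + 3)) ∞ M]

theorem finrank_cover : Module.finrank ℝ (Cover n) = n + 2 := by
  simp [Cover]

/-- Near each point of the core there is a form with kernel `(DG)⁻¹(ξ)` that restricts to
`r sin r dϑ` on the core. -/
theorem IsThickenedPlastikstufe.exists_local_form (h : IsThickenedPlastikstufe ξ G U)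
    (hξ : IsContactStructure ξ) {p₀ : Cover n} (hp₀ : p₀.2 ∈ diskPi) :
    ∃ (O : Set (Cover n × F)) (c : Cover n × F → Cover n × F →L[ℝ] ℝ), IsOpen O ∧ (p₀, 0) ∈ O ∧
      ContDiffOn ℝ ∞ c O ∧
      (∀ q ∈ O, ∀ v : Cover n × F,
        mfderiv 𝓘(ℝ, Cover n × F) (𝓡 (2 * n + 3)) G q v ∈ ξ (G q) → c q v = 0) ∧
      ∀ p : Cover n, p.2 ∈ diskPi → (p, 0) ∈ O → ∀ w, c (p, 0) (w, 0) = otForm p.2 w.2 := by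
  obtain ⟨O, Γ, α, hqO, hOU, hm⟩ :=
    hξ.exists_localContactModel h.isOpen h.contMDiffOn (h.core_mem p₀ hp₀)
  set b := pullForm Γ α with hb
  have hker : ∀ p : Cover n, p.2 ∈ diskPi → (p, 0) ∈ O → ∀ w, b (p, 0) (w, 0) = 0 ↔
      otForm p.2 w.2 = 0 := fun p hp hpO w =>
    (hm.mem_iff _ hpO _).symm.trans (h.distribution p hp w)
  have hO₁ : IsOpen {p : Cover n | (p, (0 : F)) ∈ O} := hm.isOpen.preimage (by fun_prop)
  obtain ⟨O', f, hO', hpO', hOO', hf, hfe⟩ := exists_conformal_factor hO₁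
    (contDiffOn_coreForm hm.isOpen hm.contDiffOn_pull) hqO hp₀ fun p hpO hp w => by
      rw [coreForm_apply]
      exact hker p hp hpO w
  have hfe' : ∀ p ∈ O', p.2 ∈ diskPi → ∀ w, b (p, 0) (w, 0) = f p * otForm p.2 w.2 :=
    fun p hp hpD w => by rw [← hfe p hp hpD, coreForm_apply]
  -- Where `r sin r dϑ` vanishes, a zero of the factor would make the whole tangent space of the
  -- core isotropic. Its dimension `n + 2` exceeds the bound `n + 1` of a contact form in dimension
  -- `2n + 3`.
  have hf0 : f p₀ ≠ 0 := fun h0 => by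
    rcases otForm_eq_zero_or_sum_ne_zero hp₀ with h1 | ⟨h1, -⟩
    · refine h1 ((hker p₀ hp₀ hqO (0, rotate p₀.2)).1 ?_)
      rw [hfe' p₀ hpO' hp₀, h0, zero_mul]
    have hfd : DifferentiableAt ℝ f p₀ :=
      (hf.contDiffAt (hO'.mem_nhds hpO')).differentiableAt (by simp)
    have hd : ∀ w w' : Cover n, dForm b (p₀, 0) (w, 0) (w', 0) = 0 := fun w w' => by
      have hbd : DifferentiableAt ℝ b (p₀, 0) :=
        (hm.contDiffOn_pull.contDiffAt (hm.isOpen.mem_nhds hqO)).differentiableAt (by simp)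
      rw [← dForm_coreForm hbd]
      have e1 := dForm_eq_of_eqOn_disk (γ := coreForm b) (γ' := fun p => f p • coverForm n p) hp₀
        (((contDiffOn_coreForm hm.isOpen hm.contDiffOn_pull).contDiffAt
          (hO₁.mem_nhds hqO)).differentiableAt (by simp))
        (hfd.smul (contDiff_coverForm.differentiable (by simp) _)) (by
          filter_upwards [hO'.mem_nhds hpO'] with z hz hzD
          refine ContinuousLinearMap.ext fun v => ?_
          rw [hfe z hz hzD, smul_apply, coverForm_apply, smul_eq_mul]) w w'
      rw [e1, dForm_smul hfd (contDiff_coverForm.differentiable (by simp) _), h0]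
      simp [coverForm_apply, h1]
    have e2 := (hm.contact _ hqO).two_mul_finrank_lt
      (j := ((fderiv ℝ Γ (p₀, 0)).comp (ContinuousLinearMap.inl ℝ (Cover n) F) :
        Cover n →L[ℝ] EuclideanSpace ℝ (Fin (2 * n + 3))).toLinearMap)
      ((injective_iff_map_eq_zero _).2 fun w hw =>
        h.immersive p₀ hp₀ w ((hm.fderiv_eq_zero_iff _ hqO _).1 hw))
      (fun w => (hker p₀ hp₀ hqO w).2 (h1 _))
      (fun w w' => by
        have := hd w w'
        rw [hb, hm.dForm_pull hqO] at this
        exact this)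
    rw [finrank_cover, finrank_euclideanSpace_fin] at e2
    omega
  refine ⟨O ∩ {q | q.1 ∈ O' ∩ f ⁻¹' {0}ᶜ}, fun q => (f q.1)⁻¹ • b q, ?_, ⟨hqO, hpO', hf0⟩, ?_,
    fun q hq v hv => ?_, fun p hp hpO w => ?_⟩
  · exact hm.isOpen.inter ((hf.continuousOn.isOpen_inter_preimage hO'
      isOpen_compl_singleton).preimage continuous_fst)
  · have e1 : ContDiffOn ℝ ∞ (fun q : Cover n × F => f q.1)
        (O ∩ {q | q.1 ∈ O' ∩ f ⁻¹' {0}ᶜ}) := hf.comp contDiff_fst.contDiffOn fun q hq => hq.2.1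
    exact (e1.inv fun q hq => hq.2.2).smul (hm.contDiffOn_pull.mono inter_subset_left)
  · rw [smul_apply, (hm.mem_iff q hq.1 v).1 hv, smul_zero]
  · rw [smul_apply, hfe' p hpO.2.1 hp, smul_eq_mul, inv_mul_cancel_left₀ hpO.2.2]

/-- Vanishing on the preimage of `ξ` and having a prescribed restriction to the core are convex
conditions on covectors, so local forms are averaged by a partition of unity. Working on the image
of `latticeQuot` makes the result periodic. The form may vanish away from the core. -/
theorem IsThickenedPlastikstufe.exists_form [FiniteDimensional ℝ F] (h : IsThickenedPlastikstufe ξ G U)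
    (hξ : IsContactStructure ξ) :
    ∃ a : Cover n × F → Cover n × F →L[ℝ] ℝ, ContDiff ℝ ∞ a ∧
      (∀ (l : Fin n → ℤ) q, a (q + (shiftCover l, 0)) = a q) ∧
      (∀ q ∈ U, ∀ v : Cover n × F,
        mfderiv 𝓘(ℝ, Cover n × F) (𝓡 (2 * n + 3)) G q v ∈ ξ (G q) → a q v = 0) ∧
      ∀ p : Cover n, p.2 ∈ diskPi → ∀ w, a (p, 0) (w, 0) = otForm p.2 w.2 := by
  let t : Plane × (Fin n → ℂ) × F → Set (Cover n × F →L[ℝ] ℝ) := fun z =>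
    {b | ∀ q ∈ U, latticeQuot q = z →
      (∀ v : Cover n × F,
        mfderiv 𝓘(ℝ, Cover n × F) (𝓡 (2 * n + 3)) G q v ∈ ξ (G q) → b v = 0) ∧
      (q.1.2 ∈ diskPi → q.2 = 0 → ∀ w : Cover n, b (w, 0) = otForm q.1.2 w.2)}
  have ht : ∀ z, Convex ℝ (t z) := by
    intro z b hb b' hb' r r' hr hr' hrr q hq hqz
    obtain ⟨h1, h2⟩ := hb q hq hqz
    obtain ⟨h3, h4⟩ := hb' q hq hqz
    refine ⟨fun v hv => ?_, fun hqD hq0 w => ?_⟩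
    · simp [h1 v hv, h3 v hv]
    · simp only [add_apply, smul_apply, h2 hqD hq0 w, h4 hqD hq0 w, smul_eq_mul]
      rw [← add_mul, hrr, one_mul]
  have hloc : ∀ z, ∃ N ∈ 𝓝 z, ∃ g : Plane × (Fin n → ℂ) × F → (Cover n × F →L[ℝ] ℝ),
      ContMDiffOn 𝓘(ℝ, Plane × (Fin n → ℂ) × F) 𝓘(ℝ, Cover n × F →L[ℝ] ℝ) ∞ g N ∧
      ∀ y ∈ N, g y ∈ t y := by
    intro z
    -- Off the closed image of the core only the vanishing condition remains, and the zero form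
    -- satisfies it.
    by_cases hz : z.1 ∈ diskPi ∧ (∀ j, ‖z.2.1 j‖ = 1) ∧ z.2.2 = 0
    · set p₀ : Cover n := (fun j => (z.2.1 j).arg, z.1) with hp₀
      have hqz : latticeQuot (p₀, (0 : F)) = z := by
        refine Prod.ext rfl (Prod.ext (funext fun j => ?_) hz.2.2.symm)
        have := Complex.norm_mul_exp_arg_mul_I (z.2.1 j)
        rwa [hz.2.1 j, Complex.ofReal_one, one_mul] at this
      obtain ⟨O, c, hO, hpO, hc, hck, hcD⟩ := h.exists_local_form hξ (p₀ := p₀) hz.1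
      set S : Set (Plane × (Fin n → ℂ) × F) :=
        {z | ∀ j, z.2.1 j * Complex.exp (-(p₀.1 j * Complex.I)) ∈ Complex.slitPlane} with hS
      have hSo : IsOpen S := by
        simp only [hS, ofPred_forall]
        exact isOpen_iInter_of_finite fun j => Complex.isOpen_slitPlane.preimage (by fun_prop)
      have hls := contDiffOn_latticeLift (F := F) p₀.1
      have hzS : z ∈ S := fun j => by
        rw [← hqz]
        simp [latticeQuot, ← Complex.exp_add]
      refine ⟨S ∩ latticeLift p₀.1 ⁻¹' O,
        (hls.continuousOn.isOpen_inter_preimage hSo hO).mem_nhds ⟨hzS, ?_⟩,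
        c ∘ latticeLift p₀.1,
        (hc.comp (hls.mono inter_subset_left) fun y hy => hy.2).contMDiffOn, fun y hy q hq hqy => ?_⟩
      · rw [mem_preimage, ← hqz, latticeLift_latticeQuot_self (p₀, (0 : F))]
        exact hpO
      · subst hqy
        obtain ⟨l, hl⟩ := latticeQuot_eq_iff.1 (latticeQuot_latticeLift p₀.1 q)
        have hmem : q + (shiftCover l, 0) ∈ O := hl ▸ hy.2
        simp only [Function.comp_apply, hl]
        refine ⟨fun v hv => hck _ hmem v ((h.mem_shift_iff hq l v).2 hv), fun hqD hq0 w => ?_⟩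
        obtain ⟨p, u⟩ := q
        obtain rfl : u = 0 := hq0
        have e1 : ((p, (0 : F)) + (shiftCover l, 0)) = (p + shiftCover l, 0) := by simp
        have e2 : (p + shiftCover l).2 = p.2 := by simp [shiftCover]
        rw [e1] at hmem ⊢
        rw [hcD _ (by rwa [e2]) hmem, e2]
    · have hcl : IsClosed {z : Plane × (Fin n → ℂ) × F |
          z.1 ∈ diskPi ∧ (∀ j, ‖z.2.1 j‖ = 1) ∧ z.2.2 = 0} := by
        refine (isCompact_diskPi.isClosed.preimage continuous_fst).inter (IsClosed.inter ?_ ?_)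
        · change IsClosed {z : Plane × (Fin n → ℂ) × F | ∀ j, ‖z.2.1 j‖ = 1}
          simp only [ofPred_forall]
          exact isClosed_iInter fun j => isClosed_eq (by fun_prop) continuous_const
        · exact isClosed_eq (by fun_prop) continuous_const
      refine ⟨_, hcl.isOpen_compl.mem_nhds hz, fun _ => 0, contMDiffOn_const,
        fun y hy q hq hqy => ⟨fun _ _ => rfl, fun hqD hq0 w => absurd ?_ hy⟩⟩
      subst hqy
      exact ⟨hqD, fun j => Complex.norm_exp_ofReal_mul_I _, hq0⟩
  obtain ⟨g, hg⟩ := exists_contMDiffMap_forall_mem_convex_of_local (n := ⊤)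
    𝓘(ℝ, Plane × (Fin n → ℂ) × F) ht hloc
  refine ⟨g ∘ latticeQuot, g.contMDiff.contDiff.comp contDiff_latticeQuot, fun l q => ?_,
    fun q hq => (hg _ q hq rfl).1, fun p hp => (hg _ (p, 0) (h.core_mem p hp) rfl).2 hp rfl⟩
  rw [Function.comp_apply, latticeQuot_eq_iff.2 ⟨l, rfl⟩]
  rfl

/-- Away from the singular points the restriction to the core is already nonzero. At a singular
point, if the form vanished it would be `c b` with `c = 0` there and `b` zero on the core, so `da`
would vanish on the core, contradicting `d(r sin r dϑ) ≠ 0`. -/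
theorem IsThickenedPlastikstufe.form_ne_zero (h : IsThickenedPlastikstufe ξ G U)
    (hξ : IsContactStructure ξ) {a : Cover n × F → Cover n × F →L[ℝ] ℝ} (ha : ContDiff ℝ ∞ a)
    (hk : ∀ q ∈ U, ∀ v : Cover n × F,
        mfderiv 𝓘(ℝ, Cover n × F) (𝓡 (2 * n + 3)) G q v ∈ ξ (G q) → a q v = 0)
    (hD : ∀ p : Cover n, p.2 ∈ diskPi → ∀ w, a (p, 0) (w, 0) = otForm p.2 w.2)
    {p : Cover n} (hp : p.2 ∈ diskPi) : a (p, 0) ≠ 0 := fun h0 => by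
  rcases otForm_eq_zero_or_sum_ne_zero hp with h1 | ⟨h1, h2⟩
  · refine h1 ?_
    rw [← hD p hp (0, rotate p.2), h0]
    rfl
  obtain ⟨O, Γ, α, hqO, hOU, hm⟩ :=
    hξ.exists_localContactModel h.isOpen h.contMDiffOn (h.core_mem p hp)
  have hb : pullForm Γ α (p, 0) ≠ 0 := fun hb => (hm.contact _ hqO).1 (by
    refine ContinuousLinearMap.ext fun w => ?_
    obtain ⟨v, rfl⟩ := hm.surjective _ hqO (h.surjective p hp) w
    exact congrArg (fun L => L v) hb)
  obtain ⟨c, hc, hac⟩ := hm.exists_smul_eq ha.contDiffOn (fun q hq => hk q (hOU hq)) hqO hb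
  have hc0 : c (p, 0) = 0 := by
    have := hac.self_of_nhds
    rw [h0] at this
    by_contra hcne
    refine hb (ContinuousLinearMap.ext fun v => ?_)
    have e1 : 0 = c (p, 0) * pullForm Γ α (p, 0) v := congrArg (fun L => L v) this
    exact (mul_eq_zero.1 e1.symm).resolve_left hcne
  have hb0 : ∀ w : Cover n, pullForm Γ α (p, 0) (w, 0) = 0 := fun w =>
    (hm.mem_iff _ hqO _).1 ((h.distribution p hp w).2 (h1 _))
  have e1 := dForm_core_of_restriction ha hD hp (0, !₂[1, 0]) (0, !₂[0, 1])
  rw [dForm_congr hac, dForm_smul (hc.differentiableAt (by simp))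
    ((hm.contDiffOn_pull.contDiffAt (hm.isOpen.mem_nhds hqO)).differentiableAt (by simp)), hc0,
    hb0, hb0] at e1
  simp only [wedge, zero_mul, mul_zero, add_zero, sub_zero] at e1
  simp at e1
  exact h2 e1.symm

end NormalizedForm

/-! ### Smooth right inverses -/

section RightInverse

open Set

variable {F : Type} [NormedAddCommGroup F] [NormedSpace ℝ F] [FiniteDimensional ℝ F] {m : ℕ}

/-- The transpose of `L : F → ℝᵐ` with respect to a basis of `F`. -/
def clmTranspose (L : F →L[ℝ] (Fin m → ℝ)) : (Fin m → ℝ) →L[ℝ] F :=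
  ∑ j, (∑ i, L (Module.finBasis ℝ F j) i • ContinuousLinearMap.proj (R := ℝ)
    (φ := fun _ : Fin m => ℝ) i).smulRight (Module.finBasis ℝ F j)

theorem clmTranspose_apply (L : F →L[ℝ] (Fin m → ℝ)) (y : Fin m → ℝ) :
    clmTranspose L y =
      ∑ j, (∑ i, L (Module.finBasis ℝ F j) i * y i) • Module.finBasis ℝ F j := by
  simp [clmTranspose, sum_apply]

/-- A right inverse of `L`, depending smoothly on `L`. -/
def clmRightInverse (L : F →L[ℝ] (Fin m → ℝ)) : (Fin m → ℝ) →L[ℝ] F :=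
  (clmTranspose L).comp (L.comp (clmTranspose L)).inverse

variable (F m) in
/-- The maps `L : F → ℝᵐ` for which `clmRightInverse L` is a right inverse. -/
def clmRightInvertible : Set (F →L[ℝ] (Fin m → ℝ)) :=
  {L | L.comp (clmTranspose L) ∈
    range ((↑) : ((Fin m → ℝ) ≃L[ℝ] (Fin m → ℝ)) → (Fin m → ℝ) →L[ℝ] (Fin m → ℝ))}

theorem contDiff_clmTranspose :
    ContDiff ℝ ∞ (clmTranspose : (F →L[ℝ] (Fin m → ℝ)) → (Fin m → ℝ) →L[ℝ] F) := by
  rw [contDiff_clm_apply_iff]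
  intro y
  simp only [clmTranspose_apply]
  refine ContDiff.sum fun j _ => ContDiff.smul (ContDiff.sum fun i _ => ?_) contDiff_const
  have : ContDiff ℝ ∞ fun L : F →L[ℝ] (Fin m → ℝ) => L (Module.finBasis ℝ F j) :=
    contDiff_id.clm_apply contDiff_const
  exact ((contDiff_pi.1 this) i).mul contDiff_const

theorem contDiff_comp_clmTranspose :
    ContDiff ℝ ∞ fun L : F →L[ℝ] (Fin m → ℝ) => L.comp (clmTranspose L) :=
  contDiff_id.clm_comp contDiff_clmTranspose

theorem isOpen_clmRightInvertible : IsOpen (clmRightInvertible F m) :=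
  ContinuousLinearEquiv.isOpen.preimage contDiff_comp_clmTranspose.continuous

theorem contDiffOn_clmRightInverse :
    ContDiffOn ℝ ∞ (clmRightInverse : (F →L[ℝ] (Fin m → ℝ)) → _) (clmRightInvertible F m) := by
  rintro L ⟨e, he⟩
  have h1 : ContDiffAt ℝ ∞ ContinuousLinearMap.inverse (L.comp (clmTranspose L)) := by
    rw [← he]
    exact contDiffAt_map_inverse e
  have h2 : ContDiffAt ℝ ∞ (fun L : F →L[ℝ] (Fin m → ℝ) => (L.comp (clmTranspose L)).inverse) L :=
    ContDiffAt.comp (g := ContinuousLinearMap.inverse) L h1 contDiff_comp_clmTranspose.contDiffAt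
  exact (contDiff_clmTranspose.contDiffAt.clm_comp h2).contDiffWithinAt

theorem apply_clmRightInverse {L : F →L[ℝ] (Fin m → ℝ)} (hL : L ∈ clmRightInvertible F m)
    (y : Fin m → ℝ) : L (clmRightInverse L y) = y := by
  obtain ⟨e, he⟩ := hL
  have h1 : L (clmRightInverse L y) =
      (L.comp (clmTranspose L)) ((L.comp (clmTranspose L)).inverse y) := rfl
  rw [h1, ← he, ContinuousLinearMap.inverse_equiv]
  simp

/-- If no nontrivial combination of the rows of `L` vanishes, then `L Lᵀ` is injective: `⟨y, L Lᵀ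
y⟩` is a sum of squares. The right inverse `Lᵀ (L Lᵀ)⁻¹` involves no choice depending on `L`, so it
preserves smoothness and periodicity. -/
theorem mem_clmRightInvertible {L : F →L[ℝ] (Fin m → ℝ)}
    (h : ∀ y : Fin m → ℝ, (∀ u, ∑ k, y k * L u k = 0) → y = 0) : L ∈ clmRightInvertible F m := by
  have hinj : Function.Injective (L.comp (clmTranspose L)) := by
    refine (injective_iff_map_eq_zero _).2 fun y hy => h y ?_
    have h1 : ∑ j, (∑ i, L (Module.finBasis ℝ F j) i * y i) ^ 2 = 0 := by
      have h2 : ∑ k, y k * L (clmTranspose L y) k = 0 := by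
        have : L (clmTranspose L y) = 0 := hy
        simp [this]
      rw [clmTranspose_apply, map_sum] at h2
      simp only [map_smul, Finset.sum_apply, Pi.smul_apply, smul_eq_mul, Finset.mul_sum] at h2
      rw [Finset.sum_comm] at h2
      rw [← h2]
      refine Finset.sum_congr rfl fun j _ => ?_
      rw [sq, Finset.mul_sum]
      exact Finset.sum_congr rfl fun k _ => by ring
    rw [Finset.sum_eq_zero_iff_of_nonneg fun _ _ => sq_nonneg _] at h1
    have h3 : ∀ j, ∑ k, y k * L (Module.finBasis ℝ F j) k = 0 := fun j => by
      rw [← pow_eq_zero_iff two_ne_zero, ← h1 j (Finset.mem_univ _)]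
      congr 1
      exact Finset.sum_congr rfl fun k _ => mul_comm _ _
    intro u
    let φ : F →ₗ[ℝ] ℝ := ∑ k, y k • (LinearMap.proj k).comp (L : F →ₗ[ℝ] (Fin m → ℝ))
    have hφ : ∀ u, φ u = ∑ k, y k * L u k := fun u => by simp [φ, LinearMap.sum_apply]
    have : φ = 0 := (Module.finBasis ℝ F).ext fun j => by rw [hφ, h3]; rfl
    rw [← hφ, this]
    rfl
  exact ⟨(LinearEquiv.ofInjectiveEndo _ hinj).toContinuousLinearEquiv,
    ContinuousLinearMap.ext fun _ => rfl⟩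

end RightInverse

/-! ### The tube around the plastikstufe -/

section Tube

open Set

variable {n : ℕ} {F : Type} [NormedAddCommGroup F] [NormedSpace ℝ F]

/-- The covectors `ℓ = (sinc r + cos r) a + sinc r da(·, r∂_r)` and `da(·, ∂_{s_i})` at the points of
the core. -/
def frameRow (a : Cover n × F → Cover n × F →L[ℝ] ℝ) (p : Cover n) :
    Fin (n + 1) → (Cover n × F →L[ℝ] ℝ) :=
  Fin.cons ((sincNorm p.2 + cosNorm p.2) • a (p, 0) -
    sincNorm p.2 • dFormL a (p, 0) (((0, p.2) : Cover n), (0 : F)))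
    fun i => -dFormL a (p, 0) (((Pi.single i 1, 0) : Cover n), (0 : F))

theorem frameRow_zero (a : Cover n × F → Cover n × F →L[ℝ] ℝ) (p : Cover n) (v : Cover n × F) :
    frameRow a p 0 v = (sincNorm p.2 + cosNorm p.2) * a (p, 0) v +
      sincNorm p.2 * dForm a (p, 0) v ((0, p.2), 0) := by
  rw [dForm_swap]
  simp [frameRow, dFormL_apply]
  ring

theorem frameRow_succ (a : Cover n × F → Cover n × F →L[ℝ] ℝ) (p : Cover n) (i : Fin n)
    (v : Cover n × F) :
    frameRow a p i.succ v = dForm a (p, 0) v ((Pi.single i 1, 0), 0) := by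
  rw [dForm_swap]
  simp [frameRow, dFormL_apply]

/-- The rows `frameRow a p`, restricted to `F`. -/
def frameMap (a : Cover n × F → Cover n × F →L[ℝ] ℝ) (p : Cover n) : F →L[ℝ] (Fin (n + 1) → ℝ) :=
  ContinuousLinearMap.pi fun k => (frameRow a p k).comp (ContinuousLinearMap.inr ℝ (Cover n) F)

theorem frameMap_apply (a : Cover n × F → Cover n × F →L[ℝ] ℝ) (p : Cover n) (u : F)
    (k : Fin (n + 1)) : frameMap a p u k = frameRow a p k (0, u) := rfl

theorem contDiff_frameMap [FiniteDimensional ℝ F] {a : Cover n × F → Cover n × F →L[ℝ] ℝ}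
    (ha : ContDiff ℝ ∞ a) : ContDiff ℝ ∞ (frameMap a) := by
  rw [contDiff_clm_apply_iff]
  intro u
  rw [contDiff_pi]
  intro k
  simp only [frameMap_apply]
  have hi : ContDiff ℝ ∞ (fun p : Cover n => (p, (0 : F))) := contDiff_id.prodMk contDiff_const
  have h1 : ContDiff ℝ ∞ (fun p : Cover n => a (p, 0)) := ha.comp hi
  have h2 : ContDiff ℝ ∞ (fun p : Cover n => dFormL a (p, 0)) := by
    have := contDiffOn_dFormL isOpen_univ ha.contDiffOn
    exact (contDiffOn_univ.1 this).comp hi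
  have h3 : ContDiff ℝ ∞ (fun p : Cover n => sincNorm p.2) := contDiff_sincNorm.comp contDiff_snd
  have h4 : ContDiff ℝ ∞ (fun p : Cover n => cosNorm p.2) := contDiff_cosNorm.comp contDiff_snd
  refine ContDiff.clm_apply ?_ contDiff_const
  refine Fin.cases ?_ (fun i => ?_) k
  · simp only [frameRow, Fin.cons_zero]
    refine ((h3.add h4).smul h1).sub (h3.smul (h2.clm_apply ?_))
    exact (contDiff_const.prodMk contDiff_snd).prodMk contDiff_const
  · simp only [frameRow, Fin.cons_succ]
    exact (h2.clm_apply contDiff_const).neg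

variable {M : Type*} [TopologicalSpace M] [ChartedSpace (EuclideanSpace ℝ (Fin (2 * n + 3))) M]

/-- `T` is a periodic map from the tube to `M`, a local diffeomorphism along the core, injective
modulo the lattice on the core, for which `(DT)⁻¹(ξ)` is the kernel of `a`. -/
structure IsPlastikstufeTube (ξ : (p : M) → Submodule ℝ (TangentSpace (𝓡 (2 * n + 3)) p))
    (T : Tube n → M) (Ω : Set (Tube n)) (a : Tube n → Tube n →L[ℝ] ℝ) : Prop where
  contMDiffOn : ContMDiffOn 𝓘(ℝ, Tube n) (𝓡 (2 * n + 3)) ∞ T Ω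
  periodic : ∀ (l : Fin n → ℤ), ∀ q ∈ Ω, T (q + shiftTube l) = T q
  injective : ∀ p p' : Cover n, p.2 ∈ diskPi → p'.2 ∈ diskPi → T (p, 0) = T (p', 0) →
    ∃ l : Fin n → ℤ, p = p' + shiftCover l
  immersive : ∀ p : Cover n, p.2 ∈ diskPi →
    Function.Injective (mfderiv 𝓘(ℝ, Tube n) (𝓡 (2 * n + 3)) T (p, 0))
  mem_iff : ∀ q ∈ Ω, ∀ v : Tube n,
    mfderiv 𝓘(ℝ, Tube n) (𝓡 (2 * n + 3)) T q v ∈ ξ (T q) ↔ a q v = 0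

variable {ξ : (p : M) → Submodule ℝ (TangentSpace (𝓡 (2 * n + 3)) p)} {G : Cover n × F → M}
  {U : Set (Cover n × F)} [IsManifold (𝓡 (2 * n + 3)) ∞ M]

/-- On core vectors `a` is `sinc r · (x ∧ w)` and `da(w, r∂_r)` is `(sinc r + cos r) (w ∧ x)`, so
the zeroth row cancels. The other rows vanish because `da` on the core has no component along
`∂_{sᵢ}`. -/
theorem frameRow_core {a : Cover n × F → Cover n × F →L[ℝ] ℝ} (ha : ContDiff ℝ ∞ a)
    (hD : ∀ p : Cover n, p.2 ∈ diskPi → ∀ w, a (p, 0) (w, 0) = otForm p.2 w.2)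
    {p : Cover n} (hp : p.2 ∈ diskPi) (w : Cover n) (k : Fin (n + 1)) :
    frameRow a p k (w, 0) = 0 := by
  refine Fin.cases ?_ (fun i => ?_) k
  · rw [frameRow_zero, hD p hp, dForm_core_of_restriction ha hD hp]
    simp only [otForm, wedge, sincNorm]
    ring
  · rw [frameRow_succ, dForm_core_of_restriction ha hD hp]
    simp [wedge]

/-- A linear relation among the rows says that `da(R, ·)` is a multiple of `a` for a core vector `R
∈ ker a`. Nondegeneracy of the contact structure and immersivity of the core force `R = 0`, and then
all coefficients vanish. -/
theorem IsThickenedPlastikstufe.frameMap_mem [FiniteDimensional ℝ F]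
    (h : IsThickenedPlastikstufe ξ G U)
    (hξ : IsContactStructure ξ) {a : Cover n × F → Cover n × F →L[ℝ] ℝ} (ha : ContDiff ℝ ∞ a)
    (hk : ∀ q ∈ U, ∀ v : Cover n × F,
        mfderiv 𝓘(ℝ, Cover n × F) (𝓡 (2 * n + 3)) G q v ∈ ξ (G q) → a q v = 0)
    (hD : ∀ p : Cover n, p.2 ∈ diskPi → ∀ w, a (p, 0) (w, 0) = otForm p.2 w.2)
    {p : Cover n} (hp : p.2 ∈ diskPi) : frameMap a p ∈ clmRightInvertible F (n + 1) := by
  have ha0 := h.form_ne_zero hξ ha hk hD hp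
  obtain ⟨-, -, h3⟩ := hξ.dForm_of_kernel h.isOpen h.contMDiffOn ha.contDiffOn hk
    (h.core_mem p hp) ha0
  refine mem_clmRightInvertible fun c hc => ?_
  have hc' : ∀ v : Cover n × F, ∑ k, c k * frameRow a p k v = 0 := fun v => by
    have e1 : v = (v.1, 0) + (0, v.2) := by simp
    rw [e1]
    simp only [map_add, frameRow_core ha hD hp, zero_add]
    exact hc v.2
  -- `R` collects the second arguments of `da` in the relation: `c₀ sinc r · r∂_r + ∑ cᵢ₊₁ ∂_{sᵢ}`.
  set R : Cover n := (fun i => c i.succ, (c 0 * sincNorm p.2) • p.2) with hR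
  have hRsum : ((R, 0) : Cover n × F) = (c 0 * sincNorm p.2) • ((0, p.2), 0) +
      ∑ i, c i.succ • ((Pi.single i 1, 0), 0) := by
    refine Prod.ext (Prod.ext ?_ ?_) ?_
    · ext i
      simp [hR, Prod.fst_sum, Finset.sum_apply, Pi.single_apply]
    · simp [hR, Prod.fst_sum, Prod.snd_sum]
    · simp [Prod.snd_sum]
  have hRd : ∀ v, c 0 * (sincNorm p.2 + cosNorm p.2) * a (p, 0) v =
      dForm a (p, 0) (R, 0) v := fun v => by
    have e1 := hc' v
    rw [Fin.sum_univ_succ, frameRow_zero] at e1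
    simp only [frameRow_succ] at e1
    rw [hRsum, dForm_add_left, dForm_smul_left, dForm_sum_left]
    simp only [dForm_smul_left]
    rw [dForm_swap a (p, 0) ((0, p.2), 0)]
    simp only [fun i => dForm_swap a (p, 0) ((Pi.single i 1, 0), 0) v, mul_neg,
      Finset.sum_neg_distrib]
    linear_combination e1
  have hR0 : R = 0 := by
    refine h.immersive p hp R (h3 (h.surjective p hp) _ ?_ fun v hv => ?_)
    · rw [hD p hp]
      simp [hR, otForm]
      right; ring
    · rw [← hRd, hv, mul_zero]
  have hc0 : c 0 = 0 := by
    by_contra hne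
    have e1 : c 0 * (sincNorm p.2 + cosNorm p.2) = 0 := by
      by_contra hne'
      refine ha0 (ContinuousLinearMap.ext fun v => ?_)
      have := hRd v
      rw [hR0] at this
      have e2 : dForm a (p, 0) ((0, 0) : Cover n × F) v = 0 := by
        rw [Prod.mk_zero_zero]; simp [dForm]
      rw [e2] at this
      exact (mul_eq_zero.1 this).resolve_left hne'
    have e2 : sincNorm p.2 + cosNorm p.2 = 0 := (mul_eq_zero.1 e1).resolve_left hne
    have e3 : (c 0 * sincNorm p.2) • p.2 = 0 := congrArg Prod.snd hR0
    rcases otForm_eq_zero_or_sum_ne_zero hp with h4 | ⟨-, h4⟩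
    · refine h4 ?_
      rw [otForm_rotate]
      rcases smul_eq_zero.1 e3 with h5 | h5
      · rw [(mul_eq_zero.1 h5).resolve_left hne, zero_mul]
      · rw [h5]; simp
    · exact h4 e2
  refine funext fun k => Fin.cases hc0 (fun i => ?_) k
  exact congrFun (congrArg Prod.fst hR0) i

/-- Inside `F` a frame dual to the rows of `frameMap` spans the transverse directions. Duality is
exactly the core normalization, and since the rows detect vectors tangent to the fibres of `G`, the
restricted map is a local diffeomorphism along the core: `(n + 2) + (n + 1) = 2n + 3`. -/
theorem IsThickenedPlastikstufe.exists_tube [FiniteDimensional ℝ F]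
    (h : IsThickenedPlastikstufe ξ G U) (hξ : IsContactStructure ξ) :
    ∃ (T : Tube n → M) (Ω : Set (Tube n)) (a : Tube n → Tube n →L[ℝ] ℝ),
      IsContactGerm a Ω ∧ IsCoreNormalized a ∧ IsPlastikstufeTube ξ T Ω a := by
  obtain ⟨a, ha, haper, hk, hD⟩ := h.exists_form hξ
  set Y : Cover n → (Fin (n + 1) → ℝ) →L[ℝ] F := fun p => clmRightInverse (frameMap a p) with hY
  set U₁ : Set (Cover n) := frameMap a ⁻¹' clmRightInvertible F (n + 1) with hU₁
  have hU₁o : IsOpen U₁ := isOpen_clmRightInvertible.preimage (contDiff_frameMap ha).continuous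
  have hYs : ContDiffOn ℝ ∞ Y U₁ :=
    contDiffOn_clmRightInverse.comp (contDiff_frameMap ha).contDiffOn fun p hp => hp
  have hframe : ∀ (l : Fin n → ℤ) p, frameMap a (p + shiftCover l) = frameMap a p := fun l p => by
    have e1 : ((p + shiftCover l, 0) : Cover n × F) = (p, 0) + (shiftCover l, 0) := by simp
    have e2 : (p + shiftCover l).2 = p.2 := by simp [shiftCover]
    have e3 : dFormL a (p + shiftCover l, 0) = dFormL a (p, 0) := by
      rw [e1, dFormL, dFormL,
        fderiv_add_right_eq (Filter.Eventually.of_forall fun z => haper l z)]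
    have e4 : frameRow a (p + shiftCover l) = frameRow a p := by
      rw [frameRow, frameRow, e2, e3, e1, haper]
    rw [frameMap, frameMap, e4]
  set j : Tube n → Cover n × F := fun q => (q.1, Y q.1 q.2) with hj
  have hU₂o : IsOpen (U₁ ×ˢ (univ : Set (Fin (n + 1) → ℝ))) := hU₁o.prod isOpen_univ
  have hjs : ContDiffOn ℝ ∞ j (U₁ ×ˢ univ) :=
    contDiffOn_fst.prodMk ((hYs.comp contDiffOn_fst fun q hq => hq.1).clm_apply contDiffOn_snd)
  have hjl : ∀ (l : Fin n → ℤ) q, j (q + shiftTube l) = j q + (shiftCover l, 0) := fun l q => by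
    simp [hj, hY, shiftTube, hframe]
  have hj0 : ∀ p : Cover n, j (p, 0) = (p, 0) := fun p => by simp [hj]
  set S : Set (Cover n × F) := U ∩ a ⁻¹' {0}ᶜ with hS
  have hSo : IsOpen S := h.isOpen.inter (isOpen_compl_singleton.preimage ha.continuous)
  set Ω : Set (Tube n) := (U₁ ×ˢ univ) ∩ j ⁻¹' S with hΩ
  have hΩo : IsOpen Ω := hjs.continuousOn.isOpen_inter_preimage hU₂o hSo
  have hjat : ∀ q ∈ Ω, ContDiffAt ℝ ∞ j q := fun q hq => hjs.contDiffAt (hU₂o.mem_nhds hq.1)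
  have hU₁c : ∀ p : Cover n, p.2 ∈ diskPi → p ∈ U₁ := fun p hp => h.frameMap_mem hξ ha hk hD hp
  have hcore : ∀ p : Cover n, p.2 ∈ diskPi → (p, 0) ∈ Ω := fun p hp => by
    refine ⟨⟨hU₁c p hp, mem_univ _⟩, ?_⟩
    rw [mem_preimage, hj0]
    exact ⟨h.core_mem p hp, h.form_ne_zero hξ ha hk hD hp⟩
  have hjd : ∀ p : Cover n, p.2 ∈ diskPi → ∀ v : Tube n,
      fderiv ℝ j (p, 0) v = (v.1, Y p v.2) := fun p hp v => by
    have e1 : HasFDerivAt Y (fderiv ℝ Y p) p :=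
      ((hYs.contDiffAt (hU₁o.mem_nhds (hU₁c p hp))).differentiableAt (by simp)).hasFDerivAt
    have e2 : HasFDerivAt (fun q : Tube n => Y q.1) _ (p, 0) :=
      HasFDerivAt.comp (g := Y) ((p, 0) : Tube n) e1 hasFDerivAt_fst
    have e3 : HasFDerivAt j _ (p, 0) := hasFDerivAt_fst.prodMk (e2.clm_apply hasFDerivAt_snd)
    rw [e3.fderiv]
    simp
  have hjper : ∀ (l : Fin n → ℤ) q, fderiv ℝ j (q + shiftTube l) = fderiv ℝ j q := fun l q => by
    rw [← fderiv_comp_add_right, funext (hjl l), fderiv_add_const]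
  set a' : Tube n → Tube n →L[ℝ] ℝ := pullForm j a with ha'
  have ha's : ContDiffOn ℝ ∞ a' Ω :=
    (hjs.mono inter_subset_left).pullForm hΩo ha.contDiffOn (mapsTo_univ _ _)
  have hGat : ∀ q ∈ Ω, ContMDiffAt 𝓘(ℝ, Cover n × F) (𝓡 (2 * n + 3)) ∞ G (j q) := fun q hq =>
    h.contMDiffOn.contMDiffAt (h.isOpen.mem_nhds hq.2.1)
  have hTs : ContMDiffOn 𝓘(ℝ, Tube n) (𝓡 (2 * n + 3)) ∞ (G ∘ j) Ω := fun q hq =>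
    ((hGat q hq).comp q (hjat q hq).contMDiffAt).contMDiffWithinAt
  have hTd : ∀ q ∈ Ω, ∀ v : Tube n, mfderiv 𝓘(ℝ, Tube n) (𝓡 (2 * n + 3)) (G ∘ j) q v =
      mfderiv 𝓘(ℝ, Cover n × F) (𝓡 (2 * n + 3)) G (j q) (fderiv ℝ j q v) := fun q hq v => by
    have e1 := mfderiv_comp q ((hGat q hq).mdifferentiableAt (by simp))
      ((hjat q hq).contMDiffAt.mdifferentiableAt (by simp))
    rw [mfderiv_eq_fderiv] at e1
    exact congrArg (fun L => L v) e1
  have hmem : ∀ q ∈ Ω, ∀ v : Tube n,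
      mfderiv 𝓘(ℝ, Tube n) (𝓡 (2 * n + 3)) (G ∘ j) q v ∈ ξ ((G ∘ j) q) ↔ a' q v = 0 :=
    fun q hq v => by
      rw [hTd q hq, ha', pullForm_apply]
      exact (hξ.dForm_of_kernel h.isOpen h.contMDiffOn ha.contDiffOn hk hq.2.1 hq.2.2).1 _
  have hTd0 : ∀ p : Cover n, p.2 ∈ diskPi → ∀ v : Tube n,
      mfderiv 𝓘(ℝ, Tube n) (𝓡 (2 * n + 3)) (G ∘ j) (p, 0) v =
      mfderiv 𝓘(ℝ, Cover n × F) (𝓡 (2 * n + 3)) G (p, 0) (v.1, Y p v.2) := fun p hp v => by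
    have key : ∀ q q' : Cover n × F, q = q' → ∀ v : Cover n × F,
        (mfderiv 𝓘(ℝ, Cover n × F) (𝓡 (2 * n + 3)) G q v : EuclideanSpace ℝ (Fin (2 * n + 3))) =
        mfderiv 𝓘(ℝ, Cover n × F) (𝓡 (2 * n + 3)) G q' v := by
      rintro q _ rfl v; rfl
    rw [hTd _ (hcore p hp), hjd p hp]
    exact key _ _ (hj0 p) _
  have hrow : ∀ p : Cover n, p.2 ∈ diskPi → ∀ (y : Fin (n + 1) → ℝ) k,
      frameRow a p k (0, Y p y) = y k := fun p hp y k =>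
    congrFun (apply_clmRightInverse (hU₁c p hp) y) k
  have hinj : ∀ p : Cover n, p.2 ∈ diskPi → Function.Injective
      (mfderiv 𝓘(ℝ, Tube n) (𝓡 (2 * n + 3)) (G ∘ j) (p, 0)) := fun p hp => by
    refine (injective_iff_map_eq_zero _).2 fun (v : Tube n) hv => ?_
    have hv' : mfderiv 𝓘(ℝ, Cover n × F) (𝓡 (2 * n + 3)) G (p, 0) (v.1, Y p v.2) = 0 :=
      (hTd0 p hp v).symm.trans hv
    obtain ⟨h1, h2, -⟩ := hξ.dForm_of_kernel h.isOpen h.contMDiffOn ha.contDiffOn hk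
      (h.core_mem p hp) (h.form_ne_zero hξ ha hk hD hp)
    have hav : a (p, 0) (v.1, Y p v.2) = 0 := (h1 _).1 (by rw [hv']; exact Submodule.zero_mem _)
    have hy : v.2 = 0 := by
      funext k
      -- The rows recover the transverse components of `v`; they also vanish on vectors killed by
      -- `DG`, because such vectors lie in the kernel of `a` and of `da` against `ker a`.
      have e1 : frameRow a p k (v.1, Y p v.2) = v.2 k := by
        have e2 : ((v.1, Y p v.2) : Cover n × F) = (v.1, 0) + (0, Y p v.2) := by simp
        rw [e2, map_add, frameRow_core ha hD hp, hrow p hp, zero_add]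
      rw [← e1]
      refine Fin.cases ?_ (fun i => ?_) k
      · rw [frameRow_zero, hav, h2 _ _ hv' (by
          rw [hD p hp]
          simp [otForm]
          right; ring)]
        simp
      · rw [frameRow_succ, h2 _ _ hv' (by rw [hD p hp]; simp [otForm])]
        rfl
    have hw : v.1 = 0 := h.immersive p hp _ (by rw [hy, map_zero] at hv'; exact hv')
    exact Prod.ext hw hy
  have hdim : Module.finrank ℝ (Tube n) = Module.finrank ℝ (EuclideanSpace ℝ (Fin (2 * n + 3))) := by
    simp [Tube, Cover]
    ring
  have hsurj : ∀ p : Cover n, p.2 ∈ diskPi → Function.Surjective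
      (mfderiv 𝓘(ℝ, Tube n) (𝓡 (2 * n + 3)) (G ∘ j) (p, 0)) := fun p hp =>
    (LinearMap.injective_iff_surjective_of_finrank_eq_finrank (V := Tube n)
      (V₂ := EuclideanSpace ℝ (Fin (2 * n + 3))) hdim
      (f := (mfderiv 𝓘(ℝ, Tube n) (𝓡 (2 * n + 3)) (G ∘ j) (p, 0)).toLinearMap)).1 (hinj p hp)
  have ha'0 : ∀ p : Cover n, p.2 ∈ diskPi → ∀ v, a' (p, 0) v = a (p, 0) (v.1, Y p v.2) :=
    fun p hp v => by rw [ha', pullForm_apply, hjd p hp, hj0]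
  have ha'd : ∀ p : Cover n, p.2 ∈ diskPi → ∀ u v, dForm a' (p, 0) u v =
      dForm a (p, 0) (u.1, Y p u.2) (v.1, Y p v.2) := fun p hp u v => by
    rw [ha', dForm_pullForm ((hjat _ (hcore p hp)).of_le two_le_infty)
      (ha.differentiable (by simp) _), hjd p hp, hjd p hp, hj0]
  refine ⟨G ∘ j, Ω, a', ⟨hΩo, fun l q hq => ?_, hcore, ha's, fun l q hq => ?_, fun p hp => ?_⟩,
    ⟨fun p hp w => ?_, fun p hp w w' => ?_, fun p hp i => ?_, fun p hp k i => ?_,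
      fun p hp k => ?_⟩, ⟨hTs, fun l q hq => ?_, fun p p' hp hp' hpp => ?_, hinj, hmem⟩⟩
  · refine ⟨⟨?_, mem_univ _⟩, ?_⟩
    · have := hq.1.1
      simpa [hU₁, shiftTube, hframe] using this
    · rw [mem_preimage, hjl]
      refine ⟨h.shift_mem l _ hq.2.1, ?_⟩
      rw [mem_preimage, haper]
      exact hq.2.2
  · refine ContinuousLinearMap.ext fun v => ?_
    rw [ha', pullForm_apply, pullForm_apply, hjper, hjl, haper]
  · have hne : a' (p, 0) ≠ 0 := fun h0 => by
      refine h.form_ne_zero hξ ha hk hD hp (ContinuousLinearMap.ext fun v => ?_)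
      obtain ⟨(v' : Tube n), hv'⟩ := hsurj p hp (mfderiv 𝓘(ℝ, Cover n × F) (𝓡 (2 * n + 3)) G (p, 0) v)
      have e1 : a (p, 0) (v - (v'.1, Y p v'.2)) = 0 := hk _ (h.core_mem p hp) _ (by
        have e2 : mfderiv 𝓘(ℝ, Cover n × F) (𝓡 (2 * n + 3)) G (p, 0) (v - (v'.1, Y p v'.2)) = 0 := by
          refine (map_sub _ _ _).trans (sub_eq_zero.2 ?_)
          rw [← hv']
          exact hTd0 p hp v'
        rw [e2]
        exact Submodule.zero_mem _)
      rw [map_sub, ← ha'0 p hp, h0] at e1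
      simpa using e1
    obtain ⟨-, -, h3⟩ := hξ.dForm_of_kernel hΩo hTs ha's (fun q hq v => (hmem q hq v).1)
      (hcore p hp) hne
    exact ⟨hne, fun u hu huv => (injective_iff_map_eq_zero _).1 (hinj p hp) u
      (h3 (hsurj p hp) u hu huv)⟩
  · rw [ha'0 p hp]
    simp [hD p hp]
  · rw [ha'd p hp]
    simp [dForm_core_of_restriction ha hD hp]
  · have := hrow p hp (Pi.single 0 1) i.succ
    rw [frameRow_succ] at this
    rw [ha'd p hp]
    simpa [tubeVec, periodVec] using this
  · have := hrow p hp (Pi.single k.succ 1) i.succ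
    rw [frameRow_succ] at this
    rw [ha'd p hp]
    simpa [tubeVec, periodVec, Pi.single_apply] using this
  · have := hrow p hp (Pi.single k.succ 1) 0
    rw [frameRow_zero] at this
    rw [ha'd p hp, ha'0 p hp]
    simpa [tubeVec, radialVec, Pi.single_apply, (Fin.succ_ne_zero k).symm] using this
  · rw [Function.comp_apply, hjl, h.periodic, Function.comp_apply]
  · simp only [Function.comp_apply, hj0] at hpp
    exact h.injective p p' hp hp' hpp

end Tube

/-! ### Embedding the hypersurface -/

section Final

open Set

/-- The inverse function theorem for `T` read in a chart; invertibility of the derivative is an open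
condition. -/
theorem ContMDiffOn.exists_nhds_injOn {d : ℕ} {M : Type*} [TopologicalSpace M]
    [ChartedSpace (EuclideanSpace ℝ (Fin d)) M] [IsManifold (𝓡 d) ∞ M] {E : Type*}
    [NormedAddCommGroup E] [NormedSpace ℝ E] [FiniteDimensional ℝ E]
    (hdim : Module.finrank ℝ E = d) {T : E → M} {Ω : Set E} (hΩ : IsOpen Ω)
    (hT : ContMDiffOn 𝓘(ℝ, E) (𝓡 d) ∞ T Ω) {q : E} (hq : q ∈ Ω)
    (hinj : Function.Injective (mfderiv 𝓘(ℝ, E) (𝓡 d) T q)) :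
    ∃ N ∈ 𝓝 q, InjOn T N ∧
      ∀ z ∈ N, z ∈ Ω ∧ Function.Injective (mfderiv 𝓘(ℝ, E) (𝓡 d) T z) := by
  set φ := extChartAt (𝓡 d) (T q) with hφ
  set O : Set E := Ω ∩ T ⁻¹' φ.source with hO
  have hOo : IsOpen O := hT.continuousOn.isOpen_inter_preimage hΩ (isOpen_extChartAt_source _)
  have hTat : ∀ z ∈ O, ContMDiffAt 𝓘(ℝ, E) (𝓡 d) ∞ T z := fun z hz =>
    hT.contMDiffAt (hΩ.mem_nhds hz.1)
  have hφat : ∀ z ∈ O, ContMDiffAt (𝓡 d) 𝓘(ℝ, EuclideanSpace ℝ (Fin d)) ∞ φ (T z) := fun z hz =>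
    contMDiffAt_extChartAt' (by have := hz.2; rwa [hφ, mem_preimage, extChartAt_source] at this)
  have hΓ : ContDiffOn ℝ ∞ (φ ∘ T) O := fun z hz =>
    (contMDiffAt_iff_contDiffAt.1 ((hφat z hz).comp z (hTat z hz))).contDiffWithinAt
  have hder : ∀ z ∈ O, ∀ v : E, fderiv ℝ (φ ∘ T) z v =
      mfderiv (𝓡 d) 𝓘(ℝ, EuclideanSpace ℝ (Fin d)) φ (T z) (mfderiv 𝓘(ℝ, E) (𝓡 d) T z v) :=
    fun z hz v => by
      have e1 := mfderiv_comp z ((hφat z hz).mdifferentiableAt (by simp))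
        ((hTat z hz).mdifferentiableAt (by simp))
      rw [mfderiv_eq_fderiv] at e1
      exact congrArg (fun L => L v) e1
  have hqO : q ∈ O := ⟨hq, mem_extChartAt_source _⟩
  have hinjΓ : Function.Injective (fderiv ℝ (φ ∘ T) q) := by
    have : (fderiv ℝ (φ ∘ T) q : E → _) = _ := funext (hder q hqO)
    rw [this]
    exact (isInvertible_mfderiv_extChartAt (I := 𝓡 d) hqO.2).bijective.injective.comp hinj
  have hfr : Module.finrank ℝ E = Module.finrank ℝ (EuclideanSpace ℝ (Fin d)) := by
    rw [hdim, finrank_euclideanSpace_fin]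
  let e : E ≃L[ℝ] EuclideanSpace ℝ (Fin d) :=
    (LinearEquiv.ofInjectiveOfFinrankEq (fderiv ℝ (φ ∘ T) q).toLinearMap hinjΓ
      hfr).toContinuousLinearEquiv
  have he : (e : E →L[ℝ] _) = fderiv ℝ (φ ∘ T) q := ContinuousLinearMap.ext fun _ => rfl
  have hΓq := hΓ.contDiffAt (hOo.mem_nhds hqO)
  have hder' : HasFDerivAt (φ ∘ T) (e : E →L[ℝ] _) q := by
    rw [he]; exact (hΓq.differentiableAt (by simp)).hasFDerivAt
  set Φ := hΓq.toOpenPartialHomeomorph (φ ∘ T) hder' (by simp) with hΦ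
  have hqΦ : q ∈ Φ.source := hΓq.mem_toOpenPartialHomeomorph_source hder' (by simp)
  set R : Set E := O ∩ fderiv ℝ (φ ∘ T) ⁻¹'
    range ((↑) : (E ≃L[ℝ] EuclideanSpace ℝ (Fin d)) → E →L[ℝ] EuclideanSpace ℝ (Fin d)) with hR
  have hRo : IsOpen R :=
    (hΓ.continuousOn_fderiv_of_isOpen hOo (by simp)).isOpen_inter_preimage hOo
      ContinuousLinearEquiv.isOpen
  refine ⟨Φ.source ∩ R, (Φ.open_source.inter hRo).mem_nhds ⟨hqΦ, hqO, e, he⟩,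
    fun z hz z' hz' hzz => Φ.injOn hz.1 hz'.1 (congrArg φ hzz), fun z hz => ⟨hz.2.1.1, ?_⟩⟩
  obtain ⟨e', he'⟩ := hz.2.2
  have h1 : Function.Injective (fderiv ℝ (φ ∘ T) z) := by
    rw [← he']; exact e'.injective
  have h2 : (fderiv ℝ (φ ∘ T) z : E → _) = _ := funext (hder z hz.2.1)
  rw [h2] at h1
  exact Function.Injective.of_comp h1

variable {n : ℕ} {M : Type*} [TopologicalSpace M]
  [ChartedSpace (EuclideanSpace ℝ (Fin (2 * n + 3))) M]
  {ξ : (p : M) → Submodule ℝ (TangentSpace (𝓡 (2 * n + 3)) p)}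

theorem IsPlastikstufeTube.reparam {T : Tube n → M} {Ω Ω' : Set (Tube n)}
    {a a' : Tube n → Tube n →L[ℝ] ℝ} {Ψ : Tube n → Tube n} (h : IsPlastikstufeTube ξ T Ω a)
    (hΩ : IsOpen Ω) (hΩ' : IsOpen Ω') (hcore : ∀ p : Cover n, p.2 ∈ diskPi → (p, 0) ∈ Ω')
    (hΨ : IsReparam a Ω a' Ω' Ψ) : IsPlastikstufeTube ξ (T ∘ Ψ) Ω' a' := by
  have hTat : ∀ q ∈ Ω', ContMDiffAt 𝓘(ℝ, Tube n) (𝓡 (2 * n + 3)) ∞ T (Ψ q) := fun q hq =>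
    h.contMDiffOn.contMDiffAt (hΩ.mem_nhds (hΨ.mapsTo hq))
  have hΨat : ∀ q ∈ Ω', ContDiffAt ℝ ∞ Ψ q := fun q hq =>
    hΨ.contDiffOn.contDiffAt (hΩ'.mem_nhds hq)
  have hd : ∀ q ∈ Ω', ∀ v : Tube n, mfderiv 𝓘(ℝ, Tube n) (𝓡 (2 * n + 3)) (T ∘ Ψ) q v =
      mfderiv 𝓘(ℝ, Tube n) (𝓡 (2 * n + 3)) T (Ψ q) (fderiv ℝ Ψ q v) := fun q hq v => by
    have e1 := mfderiv_comp q ((hTat q hq).mdifferentiableAt (by simp))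
      ((hΨat q hq).contMDiffAt.mdifferentiableAt (by simp))
    rw [mfderiv_eq_fderiv] at e1
    exact congrArg (fun L => L v) e1
  refine ⟨fun q hq => ((hTat q hq).comp q (hΨat q hq).contMDiffAt).contMDiffWithinAt,
    fun l q hq => ?_, fun p p' hp hp' hpp => ?_, fun p hp => ?_, fun q hq v => ?_⟩
  · rw [Function.comp_apply, hΨ.shift l q hq, h.periodic l _ (hΨ.mapsTo hq)]
    rfl
  · simp only [Function.comp_apply, hΨ.core] at hpp
    exact h.injective p p' hp hp' hpp
  · have e1 : (mfderiv 𝓘(ℝ, Tube n) (𝓡 (2 * n + 3)) (T ∘ Ψ) (p, 0) : Tube n → _) = _ :=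
      funext (hd _ (hcore p hp))
    have key : ∀ q, q = (p, 0) → Function.Injective
        (mfderiv 𝓘(ℝ, Tube n) (𝓡 (2 * n + 3)) T q) := by
      rintro _ rfl; exact h.immersive p hp
    exact e1 ▸ (key _ (hΨ.core p)).comp (hΨ.injective p hp)
  · obtain ⟨ρ, hρ, hs⟩ := hΨ.scale q hq
    rw [hd q hq, hs v, mul_eq_zero, or_iff_right hρ.ne']
    exact h.mem_iff _ (hΨ.mapsTo hq) _

/-- The dimension of `ℝ` over `ℚ` is infinite, so `n` rationally independent reals exist. -/
theorem exists_rat_independent (n : ℕ) :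
    ∃ β : Fin n → ℝ, ∀ l : Fin n → ℤ, ∑ j, β j * l j = 0 → l = 0 := by
  have h : (n : Cardinal) ≤ Module.rank ℚ ℝ := by
    rw [Real.rank_rat_real]
    exact (Cardinal.nat_lt_continuum n).le
  obtain ⟨β, hβ⟩ := Module.le_rank_iff.1 h
  refine ⟨β, fun l hl => funext fun j => ?_⟩
  have := Fintype.linearIndependent_iff.1 hβ (fun j => (l j : ℚ)) (by
    simpa [Algebra.smul_def, mul_comm] using hl) j
  exact_mod_cast this

theorem shiftTube_neg (l : Fin n → ℤ) : (shiftTube (-l) : Tube n) = -shiftTube l := by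
  simp [shiftTube, shiftCover, latticeVec_neg]

theorem latticeVec_add (l l' : Fin n → ℤ) : latticeVec (l + l') = latticeVec l + latticeVec l' := by
  ext j
  simp [latticeVec]
  ring

theorem shiftTube_add (l l' : Fin n → ℤ) :
    (shiftTube (l + l') : Tube n) = shiftTube l + shiftTube l' := by
  simp [shiftTube, shiftCover, latticeVec_add]

/-- A compact set of points of the core whose translates by the lattice cover the core. -/
def coreCell (n : ℕ) : Set (Tube n) :=
  (Icc (0 : Fin n → ℝ) (fun _ => 2 * Real.pi) ×ˢ diskPi) ×ˢ {0}

theorem isCompact_coreCell : IsCompact (coreCell n) :=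
  (isCompact_Icc.prod isCompact_diskPi).prod isCompact_singleton

theorem exists_core_shift {q : Tube n} (hq : q.1.2 ∈ diskPi) :
    ∃ l : Fin n → ℤ, ∃ p : Cover n, p.2 ∈ diskPi ∧ (p, 0) ∈ coreCell n ∧
      q + shiftTube l = (p, q.2) := by
  obtain ⟨l, hl⟩ := exists_add_latticeVec_mem q.1.1
  exact ⟨l, (q.1.1 + latticeVec l, q.1.2), hq, ⟨⟨hl, hq⟩, rfl⟩, by
    simp [shiftTube, shiftCover, Prod.ext_iff]⟩

theorem IsPlastikstufeTube.injective_mfderiv_shift {T : Tube n → M} {Ω : Set (Tube n)}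
    {a : Tube n → Tube n →L[ℝ] ℝ} (h : IsPlastikstufeTube ξ T Ω a) (hΩ : IsOpen Ω)
    {l : Fin n → ℤ} {q : Tube n} (hq : q ∈ Ω) (hql : q + shiftTube l ∈ Ω)
    (hi : Function.Injective (mfderiv 𝓘(ℝ, Tube n) (𝓡 (2 * n + 3)) T (q + shiftTube l))) :
    Function.Injective (mfderiv 𝓘(ℝ, Tube n) (𝓡 (2 * n + 3)) T q) := by
  have e1 := ((h.contMDiffOn.contMDiffAt (hΩ.mem_nhds hql)).mdifferentiableAt
    (by simp)).hasMFDerivAt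
  have e2 : HasMFDerivAt 𝓘(ℝ, Tube n) 𝓘(ℝ, Tube n)
      (fun q : Tube n => q + shiftTube l) q (ContinuousLinearMap.id ℝ (Tube n)) :=
    ((hasFDerivAt_id q).add_const _).hasMFDerivAt
  have e3 := (HasMFDerivAt.comp q e1 e2).congr_of_eventuallyEq (f₁ := T) (by
    filter_upwards [hΩ.mem_nhds hq] with z hz
    exact (h.periodic l z hz).symm)
  rw [e3.mfderiv]
  exact hi

variable [IsManifold (𝓡 (2 * n + 3)) ∞ M]

theorem finrank_tube : Module.finrank ℝ (Tube n) = 2 * n + 3 := by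
  simp [Tube, Cover]
  ring

/-- A thin tube is immersed, and embedded modulo the lattice. -/
theorem IsPlastikstufeTube.exists_thin [T2Space M] {T : Tube n → M} {Ω : Set (Tube n)}
    {a : Tube n → Tube n →L[ℝ] ℝ} (h : IsPlastikstufeTube ξ T Ω a) (hg : IsContactGerm a Ω) :
    ∃ ε > 0, (∀ q : Tube n, q.1.2 ∈ diskPi → ‖q.2‖ < ε →
        q ∈ Ω ∧ Function.Injective (mfderiv 𝓘(ℝ, Tube n) (𝓡 (2 * n + 3)) T q)) ∧
      ∀ q q' : Tube n, q.1.2 ∈ diskPi → ‖q.2‖ < ε → q'.1.2 ∈ diskPi → ‖q'.2‖ < ε → T q = T q' →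
        ∃ l : Fin n → ℤ, q = q' + shiftTube l := by
  have hloc : ∀ p : Cover n, p.2 ∈ diskPi → ∃ N ∈ 𝓝 ((p, 0) : Tube n), InjOn T N ∧
      ∀ z ∈ N, z ∈ Ω ∧ Function.Injective (mfderiv 𝓘(ℝ, Tube n) (𝓡 (2 * n + 3)) T z) := fun p hp =>
    h.contMDiffOn.exists_nhds_injOn finrank_tube hg.isOpen (hg.core_mem p hp) (h.immersive p hp)
  set good : Set (Tube n) :=
    {z | z ∈ Ω ∧ Function.Injective (mfderiv 𝓘(ℝ, Tube n) (𝓡 (2 * n + 3)) T z)} with hgood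
  set inj : Set (Tube n × Tube n) :=
    {z | T z.1 = T z.2 → ∃ l : Fin n → ℤ, z.1 = z.2 + shiftTube l} with hinj
  have h1 : coreCell n ⊆ interior good := by
    rintro ⟨p, y⟩ ⟨⟨-, hp⟩, rfl⟩
    obtain ⟨N, hN, -, hNg⟩ := hloc p hp
    exact mem_interior_iff_mem_nhds.2 (Filter.mem_of_superset hN hNg)
  -- Pairs with the same image differ by a lattice vector, and local injectivity covers a
  -- neighbourhood. Pairs with different images stay separated nearby because `M` is Hausdorff.
  -- Compactness of the cell makes both uniform.
  have h2 : coreCell n ×ˢ coreCell n ⊆ interior inj := by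
    rintro ⟨⟨p, y⟩, p', y'⟩ ⟨⟨⟨-, hp⟩, hy⟩, ⟨⟨-, hp'⟩, hy'⟩⟩
    obtain rfl : y = 0 := hy
    obtain rfl : y' = 0 := hy'
    rw [mem_interior_iff_mem_nhds]
    have hTc : ∀ p : Cover n, p.2 ∈ diskPi → ContinuousAt T (p, 0) := fun p hp =>
      h.contMDiffOn.continuousOn.continuousAt (hg.isOpen.mem_nhds (hg.core_mem p hp))
    by_cases hT : T (p, 0) = T (p', 0)
    · obtain ⟨l, rfl⟩ := h.injective p p' hp hp' hT
      obtain ⟨N, hN, hNi, -⟩ := hloc _ hp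
      have e1 : ((p' + shiftCover l, 0) : Tube n) = (p', 0) + shiftTube l := by simp [shiftTube]
      have hN' : ∀ᶠ z in 𝓝 ((p', 0) : Tube n), z + shiftTube l ∈ N := by
        refine (continuous_id.add continuous_const).continuousAt.eventually_mem ?_
        rw [e1] at hN
        exact hN
      rw [nhds_prod_eq]
      filter_upwards [Filter.prod_mem_prod hN
        (Filter.inter_mem hN' (hg.isOpen.mem_nhds (hg.core_mem p' hp')))] with z hz hzT
      refine ⟨l, hNi hz.1 hz.2.1 ?_⟩
      rw [hzT, h.periodic l _ hz.2.2]
    · have e1 : ContinuousAt (fun z : Tube n × Tube n => T z.1) ((p, 0), (p', 0)) :=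
        ContinuousAt.comp (g := T) (hTc p hp) continuousAt_fst
      have e2 : ContinuousAt (fun z : Tube n × Tube n => T z.2) ((p, 0), (p', 0)) :=
        ContinuousAt.comp (g := T) (hTc p' hp') continuousAt_snd
      filter_upwards [e1.ne_iff_eventually_ne e2 |>.1 hT] with z hz hzT
      exact absurd hzT hz
  obtain ⟨ε₁, hε₁, hε₁s⟩ := isCompact_coreCell.exists_thickening_subset_open isOpen_interior h1
  obtain ⟨ε₂, hε₂, hε₂s⟩ :=
    (isCompact_coreCell.prod isCompact_coreCell).exists_thickening_subset_open isOpen_interior h2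
  have hdist : ∀ (p : Cover n) (y : Fin (n + 1) → ℝ), dist ((p, y) : Tube n) (p, 0) = ‖y‖ :=
    fun p y => by simp [Prod.dist_eq]
  have hgoodε : ∀ q : Tube n, q.1.2 ∈ diskPi → ‖q.2‖ < min ε₁ ε₂ →
      q ∈ Ω ∧ Function.Injective (mfderiv 𝓘(ℝ, Tube n) (𝓡 (2 * n + 3)) T q) := fun q hq hqε => by
    obtain ⟨l, p, hp, hpc, hqp⟩ := exists_core_shift hq
    have e1 : q + shiftTube l ∈ good := by
      refine interior_subset (hε₁s (Metric.mem_thickening_iff.2 ⟨_, hpc, ?_⟩))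
      rw [hqp, hdist]
      exact lt_of_lt_of_le hqε (min_le_left _ _)
    have e2 : q ∈ Ω := by
      have := hg.shift_mem (-l) _ e1.1
      rwa [shiftTube_neg, add_neg_cancel_right] at this
    exact ⟨e2, h.injective_mfderiv_shift hg.isOpen e2 e1.1 e1.2⟩
  refine ⟨min ε₁ ε₂, lt_min hε₁ hε₂, hgoodε, fun q q' hq hqε hq' hqε' hT => ?_⟩
  obtain ⟨l, p, hp, hpc, hqp⟩ := exists_core_shift hq
  obtain ⟨l', p', hp', hpc', hqp'⟩ := exists_core_shift hq'
  have e1 : (q + shiftTube l, q' + shiftTube l') ∈ inj := by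
    refine interior_subset (hε₂s (Metric.mem_thickening_iff.2
      ⟨((p, 0), (p', 0)), ⟨hpc, hpc'⟩, ?_⟩))
    rw [hqp, hqp', Prod.dist_eq, hdist, hdist]
    exact max_lt (lt_of_lt_of_le hqε (min_le_right _ _)) (lt_of_lt_of_le hqε' (min_le_right _ _))
  obtain ⟨k, hk⟩ := e1 (by
    rw [h.periodic l q (hgoodε q hq hqε).1, h.periodic l' q' (hgoodε q' hq' hqε').1, hT])
  refine ⟨l' + k - l, ?_⟩
  rw [sub_eq_add_neg, shiftTube_add, shiftTube_add, shiftTube_neg]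
  have hk' : q + shiftTube l = q' + shiftTube l' + shiftTube k := hk
  rw [← add_assoc, ← add_assoc, ← hk', add_neg_cancel_right]

/-- The map from `ℝ² × ℝⁿ × ℝⁿ` to the tube given by `sⱼ ↦ k sⱼ`, `y₀ = ∑ δⱼ sⱼ` and
`y_{j+1} = -(tⱼ + cos r δⱼ) / k`. -/
def sigmaMap (k : ℝ) (δ : Fin n → ℝ) (z : SigmaSpace n) : Tube n :=
  ((fun j => k * z.2.1 j, z.1),
    Fin.cons (∑ j, δ j * z.2.1 j) fun j => -(z.2.2 j + cosNorm z.1 * δ j) / k)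

theorem contDiff_sigmaMap (k : ℝ) (δ : Fin n → ℝ) : ContDiff ℝ ∞ (sigmaMap k δ) := by
  refine ContDiff.prodMk (ContDiff.prodMk (contDiff_pi.2 fun j => ?_) contDiff_fst)
    (contDiff_pi.2 fun i => ?_)
  · fun_prop
  · have h : ContDiff ℝ ∞ (fun z : SigmaSpace n => cosNorm z.1) :=
      contDiff_cosNorm.comp contDiff_fst
    refine Fin.cases ?_ (fun j => ?_) i
    · simp only [Fin.cons_zero]
      fun_prop
    · simp only [Fin.cons_succ]
      fun_prop

theorem fderiv_sigmaMap (k : ℝ) (δ : Fin n → ℝ) (z v : SigmaSpace n) :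
    fderiv ℝ (sigmaMap k δ) z v = ((fun j => k * v.2.1 j, v.1),
      Fin.cons (∑ j, δ j * v.2.1 j) fun j => -(v.2.2 j + fderiv ℝ cosNorm z.1 v.1 * δ j) / k) := by
  have hpath : HasDerivAt (fun t : ℝ => z + t • v) v 0 := by
    simpa using ((hasDerivAt_id (0 : ℝ)).smul_const v).const_add z
  have h1 : HasDerivAt (fun t : ℝ => sigmaMap k δ (z + t • v)) (fderiv ℝ (sigmaMap k δ) z v) 0 := by
    refine HasFDerivAt.comp_hasDerivAt (l := sigmaMap k δ) (0 : ℝ) ?_ hpath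
    rw [zero_smul, add_zero]
    exact ((contDiff_sigmaMap k δ).differentiable (by simp) z).hasFDerivAt
  have hx : HasDerivAt (fun t : ℝ => z.1 + t • v.1) v.1 0 := by
    simpa using ((hasDerivAt_id (0 : ℝ)).smul_const v.1).const_add z.1
  have hs : ∀ j, HasDerivAt (fun t : ℝ => z.2.1 j + t * v.2.1 j) (v.2.1 j) 0 := fun j => by
    simpa using ((hasDerivAt_id (0 : ℝ)).mul_const (v.2.1 j)).const_add (z.2.1 j)
  have ht : ∀ j, HasDerivAt (fun t : ℝ => z.2.2 j + t * v.2.2 j) (v.2.2 j) 0 := fun j => by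
    simpa using ((hasDerivAt_id (0 : ℝ)).mul_const (v.2.2 j)).const_add (z.2.2 j)
  have hcos : HasDerivAt (fun t : ℝ => cosNorm (z.1 + t • v.1)) (fderiv ℝ cosNorm z.1 v.1) 0 := by
    refine HasFDerivAt.comp_hasDerivAt (l := cosNorm) (0 : ℝ) ?_ hx
    rw [zero_smul, add_zero]
    exact ((contDiff_cosNorm.differentiable (by simp)) z.1).hasFDerivAt
  refine h1.unique (HasDerivAt.prodMk (HasDerivAt.prodMk (hasDerivAt_pi.2 fun j => ?_) hx)
    (hasDerivAt_pi.2 fun i => ?_))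
  · exact (hs j).const_mul k
  · refine Fin.cases ?_ (fun j => ?_) i
    · simp only [Fin.cons_zero]
      exact HasDerivAt.fun_sum fun j _ => (hs j).const_mul (δ j)
    · simp only [Fin.cons_succ]
      exact (((ht j).add (hcos.mul_const (δ j))).neg).div_const k

theorem fderiv_sigmaMap_injective {k : ℝ} (hk : k ≠ 0) (δ : Fin n → ℝ) (z : SigmaSpace n) :
    Function.Injective (fderiv ℝ (sigmaMap k δ) z) := by
  refine (injective_iff_map_eq_zero _).2 fun v hv => ?_
  rw [fderiv_sigmaMap] at hv
  have h1 : v.1 = 0 := congrArg (fun q : Tube n => q.1.2) hv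
  have h2 : v.2.1 = 0 := funext fun j => by
    have : k * v.2.1 j = 0 := congrArg (fun q : Tube n => q.1.1 j) hv
    simpa [hk] using this
  have h3 : v.2.2 = 0 := funext fun j => by
    have : -(v.2.2 j + fderiv ℝ cosNorm z.1 v.1 * δ j) / k = 0 :=
      congrArg (fun q : Tube n => q.2 j.succ) hv
    rw [h1] at this
    simpa [hk] using this
  exact Prod.ext h1 (Prod.ext h2 h3)

/-- Equality modulo the lattice gives `k (s - s') = 2π l`, and equality of the `y₀`-coordinates
gives `∑ δⱼ (sⱼ - s'ⱼ) = 0`. Hence `∑ δⱼ lⱼ = 0`, so `l = 0` by independence. -/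
theorem eq_of_sigmaMap_eq {k : ℝ} (hk : k ≠ 0) {δ : Fin n → ℝ}
    (hδ : ∀ l : Fin n → ℤ, ∑ j, δ j * l j = 0 → l = 0) {z z' : SigmaSpace n} {l : Fin n → ℤ}
    (h : sigmaMap k δ z = sigmaMap k δ z' + shiftTube l) : z = z' := by
  have h1 : z.1 = z'.1 := by
    have : z.1 = z'.1 + 0 := congrArg (fun q : Tube n => q.1.2) h
    simpa using this
  have h2 : ∀ j, k * z.2.1 j = k * z'.2.1 j + 2 * Real.pi * l j := fun j =>
    congrArg (fun q : Tube n => q.1.1 j) h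
  have h3 : ∑ j, δ j * z.2.1 j = ∑ j, δ j * z'.2.1 j := by
    have : ∑ j, δ j * z.2.1 j = ∑ j, δ j * z'.2.1 j + 0 := congrArg (fun q : Tube n => q.2 0) h
    simpa using this
  have h4 : ∀ j, -(z.2.2 j + cosNorm z.1 * δ j) / k = -(z'.2.2 j + cosNorm z'.1 * δ j) / k :=
    fun j => by
      have : -(z.2.2 j + cosNorm z.1 * δ j) / k = -(z'.2.2 j + cosNorm z'.1 * δ j) / k + 0 :=
        congrArg (fun q : Tube n => q.2 j.succ) h
      simpa using this
  have hl : l = 0 := hδ l (by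
    have e1 : ∑ j, δ j * (k * z.2.1 j) = ∑ j, δ j * (k * z'.2.1 j) := by
      have : ∀ s : Fin n → ℝ, ∑ j, δ j * (k * s j) = k * ∑ j, δ j * s j := fun s => by
        rw [Finset.mul_sum]; exact Finset.sum_congr rfl fun _ _ => by ring
      rw [this, this, h3]
    simp only [h2, mul_add, Finset.sum_add_distrib, add_eq_left] at e1
    have e2 : 2 * Real.pi * ∑ j, δ j * l j = 0 := by
      rw [← e1, Finset.mul_sum]; exact Finset.sum_congr rfl fun _ _ => by ring
    exact (mul_eq_zero.1 e2).resolve_left (by positivity))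
  have h5 : z.2.1 = z'.2.1 := funext fun j => by
    have := h2 j
    simpa [hl, hk] using this
  have h6 : z.2.2 = z'.2.2 := funext fun j => by
    have := h4 j
    rw [h1] at this
    field_simp at this
    linarith
  exact Prod.ext h1 (Prod.ext h5 h6)

/-- The closure of `Σ_C`. -/
def closedSigma (n : ℕ) (C : ℝ) : Set (SigmaSpace n) :=
  diskPi ×ˢ (Icc (fun _ => -C) (fun _ => C)) ×ˢ (Icc (fun _ => -C) (fun _ => C))

theorem sigmaSet_subset_closedSigma (n : ℕ) (C : ℝ) : sigmaSet n C ⊆ closedSigma n C :=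
  fun _ hz => ⟨hz.1, ⟨fun j => (hz.2.1 j).1.le, fun j => (hz.2.1 j).2.le⟩,
    fun j => (hz.2.2 j).1.le, fun j => (hz.2.2 j).2.le⟩

theorem isCompact_closedSigma (n : ℕ) (C : ℝ) : IsCompact (closedSigma n C) :=
  isCompact_diskPi.prod (isCompact_Icc.prod isCompact_Icc)

theorem exists_sigmaMap_thin (n : ℕ) {C ε : ℝ} (hC : 0 < C) (hε : 0 < ε) :
    ∃ (k : ℝ) (δ : Fin n → ℝ), k ≠ 0 ∧ (∀ l : Fin n → ℤ, ∑ j, δ j * l j = 0 → l = 0) ∧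
      ∀ z ∈ closedSigma n C, ‖(sigmaMap k δ z).2‖ < ε := by
  obtain ⟨β, hβ⟩ := exists_rat_independent n
  set S := ∑ j, |β j| with hS
  have hS0 : 0 ≤ S := Finset.sum_nonneg fun _ _ => abs_nonneg _
  -- Scaling preserves independence. The bound `ε / (2C)` makes `|y₀| ≤ ε / 2`, and the bound `1`
  -- gives `|δⱼ| ≤ 1`; adding `1` to `S` avoids division by zero when `n = 0`.
  set r : ℝ := min 1 (ε / (2 * C)) / (1 + S) with hr
  have hr0 : 0 < r := by positivity
  have hrS : r * S ≤ min 1 (ε / (2 * C)) := by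
    rw [hr, div_mul_eq_mul_div, div_le_iff₀ (by positivity)]
    exact mul_le_mul_of_nonneg_left (by linarith) (by positivity)
  -- The numerator `tⱼ + cos r δⱼ` is at most `C + 1`, so `|yⱼ₊₁| ≤ ε / 2`.
  set k : ℝ := 2 * (C + 1) / ε with hk
  have hk0 : 0 < k := by positivity
  refine ⟨k, fun j => r * β j, hk0.ne', fun l hl => hβ l ?_, fun z hz => ?_⟩
  · have : r * ∑ j, β j * l j = 0 := by
      rw [← hl, Finset.mul_sum]; exact Finset.sum_congr rfl fun _ _ => by ring
    exact (mul_eq_zero.1 this).resolve_left hr0.ne'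
  · refine (pi_norm_lt_iff hε).2 fun i => ?_
    have hsz : ∀ j, |z.2.1 j| ≤ C := fun j => abs_le.2 ⟨hz.2.1.1 j, hz.2.1.2 j⟩
    have htz : ∀ j, |z.2.2 j| ≤ C := fun j => abs_le.2 ⟨hz.2.2.1 j, hz.2.2.2 j⟩
    refine Fin.cases ?_ (fun j => ?_) i
    · change |∑ j, r * β j * z.2.1 j| < ε
      calc |∑ j, r * β j * z.2.1 j| ≤ ∑ j, |r * β j * z.2.1 j| := Finset.abs_sum_le_sum_abs _ _
        _ ≤ ∑ j, r * |β j| * C := Finset.sum_le_sum fun j _ => by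
            rw [abs_mul, abs_mul, abs_of_pos hr0]
            exact mul_le_mul_of_nonneg_left (hsz j) (by positivity)
        _ = r * S * C := by rw [hS, Finset.mul_sum, Finset.sum_mul]
        _ ≤ ε / (2 * C) * C :=
            mul_le_mul_of_nonneg_right (hrS.trans (min_le_right _ _)) hC.le
        _ = ε / 2 := by field_simp
        _ < ε := by linarith
    · change |-(z.2.2 j + cosNorm z.1 * (r * β j)) / k| < ε
      have h1 : |cosNorm z.1 * (r * β j)| ≤ 1 := by
        rw [abs_mul, abs_mul, abs_of_pos hr0]
        have e1 : |cosNorm z.1| ≤ 1 := Real.abs_cos_le_one _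
        have e2 : r * |β j| ≤ 1 := by
          refine le_trans (mul_le_mul_of_nonneg_left ?_ hr0.le) (hrS.trans (min_le_left _ _))
          exact Finset.single_le_sum (f := fun j => |β j|) (fun _ _ => abs_nonneg _)
            (Finset.mem_univ j)
        exact mul_le_one₀ e1 (by positivity) e2
      rw [abs_div, abs_neg, abs_of_pos hk0, div_lt_iff₀ hk0]
      have h2 : ε * k = 2 * (C + 1) := by rw [hk]; field_simp
      rw [h2]
      have := abs_add_le (z.2.2 j) (cosNorm z.1 * (r * β j))
      linarith [htz j]

/-- The factor `k` cancels in `yⱼ₊₁ d(k sⱼ)`, and the correction `cos r δⱼ` in `yⱼ₊₁` removes the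
contribution `cos r ∑ δⱼ dsⱼ` of `dy₀`. -/
theorem sigmaForm_eq {k : ℝ} (hk : k ≠ 0) (δ : Fin n → ℝ) (z v : SigmaSpace n) :
    sigmaForm z v = otForm (sigmaMap k δ z).1.2 (fderiv ℝ (sigmaMap k δ) z v).1.2 +
      cosNorm (sigmaMap k δ z).1.2 * (fderiv ℝ (sigmaMap k δ) z v).2 0 +
      ∑ j : Fin n, (sigmaMap k δ z).2 j.succ * (fderiv ℝ (sigmaMap k δ) z v).1.1 j := by
  rw [fderiv_sigmaMap, sigmaForm]
  have e1 : ∀ j, -(z.2.2 j + cosNorm z.1 * δ j) / k * (k * v.2.1 j) =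
      -(z.2.2 j * v.2.1 j) - cosNorm z.1 * (δ j * v.2.1 j) := fun j => by
    field_simp
    ring
  simp only [sigmaMap, Fin.cons_zero, Fin.cons_succ, e1, Finset.sum_sub_distrib,
    Finset.sum_neg_distrib, ← Finset.mul_sum]
  ring

theorem IsPlastikstufeTube.exists_convexDisk [T2Space M] {T : Tube n → M} {Ω : Set (Tube n)}
    {a : Tube n → Tube n →L[ℝ] ℝ} (h : IsPlastikstufeTube ξ T Ω a) (hg : IsContactGerm a Ω)
    (hform : ∀ q ∈ Ω, q.1.2 ∈ diskPi → ∀ v, a q v =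
      otForm q.1.2 v.1.2 + cosNorm q.1.2 * v.2 0 + ∑ j : Fin n, q.2 j.succ * v.1.1 j)
    {C : ℝ} (hC : 0 < C) : ∃ g : SigmaSpace n → M, IsConvexDiskEmbedding ξ C g := by
  obtain ⟨ε, hε, hthin, hinj⟩ := h.exists_thin hg
  obtain ⟨k, δ, hk, hδ, hkδ⟩ := exists_sigmaMap_thin n hC hε
  have hφs := contDiff_sigmaMap k δ
  have hD : ∀ z ∈ closedSigma n C, (sigmaMap k δ z).1.2 ∈ diskPi := fun z hz => hz.1
  have hΩ : ∀ z ∈ closedSigma n C, sigmaMap k δ z ∈ Ω := fun z hz =>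
    (hthin (sigmaMap k δ z) (hD z hz) (hkδ z hz)).1
  have hW : IsOpen (sigmaMap k δ ⁻¹' Ω) := hg.isOpen.preimage hφs.continuous
  have hsub := sigmaSet_subset_closedSigma n C
  have hgs : ContMDiffOn 𝓘(ℝ, SigmaSpace n) (𝓡 (2 * n + 3)) ∞ (T ∘ sigmaMap k δ)
      (sigmaMap k δ ⁻¹' Ω) :=
    h.contMDiffOn.comp hφs.contMDiff.contMDiffOn fun z hz => hz
  have hd : ∀ z ∈ closedSigma n C, ∀ v : SigmaSpace n,
      mfderiv 𝓘(ℝ, SigmaSpace n) (𝓡 (2 * n + 3)) (T ∘ sigmaMap k δ) z v =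
      mfderiv 𝓘(ℝ, Tube n) (𝓡 (2 * n + 3)) T (sigmaMap k δ z) (fderiv ℝ (sigmaMap k δ) z v) :=
    fun z hz v => by
      have e1 := mfderiv_comp z ((h.contMDiffOn.contMDiffAt
        (hg.isOpen.mem_nhds (hΩ z hz))).mdifferentiableAt (by simp))
        (hφs.contMDiff.contMDiffAt.mdifferentiableAt (by simp))
      rw [mfderiv_eq_fderiv] at e1
      exact congrArg (fun L => L v) e1
  -- A continuous injection from a compact space to a Hausdorff space is an embedding; this is why
  -- the estimates are made on the closure of `Σ_C`.
  have hemb : Topology.IsEmbedding ((closedSigma n C).domRestrict (T ∘ sigmaMap k δ)) := by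
    have : CompactSpace (closedSigma n C) := isCompact_iff_compactSpace.1 (isCompact_closedSigma n C)
    refine (Continuous.isClosedEmbedding ?_ ?_).isEmbedding
    · exact continuousOn_iff_continuous_domRestrict.1 (hgs.continuousOn.mono hΩ)
    · rintro ⟨z, hz⟩ ⟨z', hz'⟩ hzz
      obtain ⟨l, hl⟩ := hinj _ _ (hD z hz) (hkδ z hz) (hD z' hz') (hkδ z' hz') hzz
      exact Subtype.ext (eq_of_sigmaMap_eq hk hδ hl)
  have hemb' : Topology.IsEmbedding ((sigmaSet n C).domRestrict (T ∘ sigmaMap k δ)) :=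
    hemb.comp (Topology.IsEmbedding.inclusion hsub)
  have hsm : ∃ W : Set (SigmaSpace n), IsOpen W ∧ sigmaSet n C ⊆ W ∧
      ContMDiffOn 𝓘(ℝ, SigmaSpace n) (𝓡 (2 * n + 3)) ∞ (T ∘ sigmaMap k δ) W :=
    ⟨_, hW, fun z hz => hΩ z (hsub hz), hgs⟩
  refine ⟨T ∘ sigmaMap k δ, ⟨hsm, fun z hz => ?_, hemb'⟩, fun z hz v => ?_⟩
  · exact fun u v huv => fderiv_sigmaMap_injective hk δ z
      ((hthin _ (hD z (hsub hz)) (hkδ z (hsub hz))).2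
        ((hd z (hsub hz) u).symm.trans (huv.trans (hd z (hsub hz) v))))
  · rw [hd z (hsub hz)]
    refine (h.mem_iff _ (hΩ z (hsub hz)) _).trans ?_
    rw [hform _ (hΩ z (hsub hz)) (hD z (hsub hz)), sigmaForm_eq hk δ z v]

end Final

end

theorem mainTheorem2 (n : ℕ) {M : Type*} [TopologicalSpace M] [T2Space M]
    [SecondCountableTopology M] [ChartedSpace (EuclideanSpace ℝ (Fin (2 * n + 3))) M]
    [IsManifold (𝓡 (2 * n + 3)) ∞ M]
    (ξ : (p : M) → Submodule ℝ (TangentSpace (𝓡 (2 * n + 3)) p))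
    (hξ : IsContactStructure ξ)
    (hP : ∃ f : Plane × Torus n → M, IsToricPlastikstufe ξ f) :
    ∀ C : ℝ, 0 < C → ∃ g : SigmaSpace n → M, IsConvexDiskEmbedding ξ C g := by
  obtain ⟨f, hf⟩ := hP
  obtain ⟨f', U, hlift⟩ := hf.exists_lift
  -- By periodicity the image of one period cell is the whole plastikstufe, so a single local
  -- addition serves all of it.
  have hK : IsCompact (f' '' (Set.Icc (0 : Fin n → ℝ) (fun _ => 2 * Real.pi) ×ˢ diskPi)) :=
    (isCompact_Icc.prod isCompact_diskPi).image_of_continuousOn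
      (hlift.contMDiffOn.continuousOn.mono fun p hp => hlift.core_mem p hp.2)
  obtain ⟨F, i₁, i₂, i₃, Θ, hΘ⟩ := exists_isLocalAddition (d := 2 * n + 3) hK
  have hthick := hlift.thicken hΘ fun p hp => by
    obtain ⟨l, hl⟩ := exists_add_latticeVec_mem p.1
    exact ⟨p + shiftCover l, ⟨hl, by simpa [shiftCover] using hp⟩, hlift.periodic l p⟩
  obtain ⟨T, Ω, a, hgerm, hnorm, htube⟩ := hthick.exists_tube hξ
  obtain ⟨Ω', Ψ, a', hgerm', hΨ, hform⟩ := hgerm.exists_normal_form hnorm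
  exact fun C hC => (htube.reparam hgerm.isOpen hgerm'.isOpen hgerm'.core_mem hΨ).exists_convexDisk
    hgerm' hform hC
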